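/- Let $M\ge 5$ and let $\mathcal F=\mathbb P(H^0(\mathbb P^M,\mathcal O_{\mathbb P^M}(M)))$ be the projective space parametrizing hypersurfaces of degree $M$ in the complex projective space $\mathbb P^M$. A point $x$ of a hypersurface $V=\{f=0\}$ is called a quadratic singularity of rank $r$ if in suitable analytic coordinates $z$ of $\mathbb P^M$ around $x$ the hypersurface $V$ is given by an equation $q_2(z)+(\text{terms of degree}\ge 3)=0$ with $q_2$ a quadratic form of rank $r$. A smooth point $x\in V$ is called regular if, in homogeneous coordinates with $x=(1:0:\dots:0)$, where $V\cap\{X_0\ne0\}$ is given by $q_1+\dots+q_M=0$ with $q_i\in\mathbb C[X_1,\dots,X_M]$ homogeneous of degree $i$, the polynomials $q_1,\dots,q_{M-1}$ form a regular sequence in $\mathbb C[X_1,\dots,X_M]$. Let $\mathcal F_{\mathrm{reg},\,\mathrm{qsing}\ge5}\subset\mathcal F$ be the set of hypersurfaces $V$ such that every point of $V$ is either smooth or a quadratic singularity of rank at least $5$, every smooth point of $V$ is regular, and through every singular point of $V$ there are only finitely many lines contained in $V$. Then the codimension in $\mathcal F$ of the complement $\mathcal F\setminus\mathcal F_{\mathrm{reg},\,\mathrm{qsing}\ge5}$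 (that is, of its Zariski closure) is at least $\binom{M-3}{2}+1$. -/

import Mathlib

open scoped LinearAlgebra.Projectivization

/-- The vector space `H⁰(ℙ^M, 𝒪(M))` of complex forms of degree `M` in `M + 1` variables. -/
abbrev Forms (M : ℕ) : Type :=
  MvPolynomial.homogeneousSubmodule (Fin (M + 1)) ℂ M

/-- The parameter space `𝓕 = ℙ(H⁰(ℙ^M, 𝒪(M)))` of hypersurfaces of degree `M` in `ℙ^M`. -/
def HypersurfaceSpace (M : ℕ) : Type := ℙ ℂ (Forms M)

/-- The exponents of the monomials of degree `M`; they index the homogeneous coordinates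
(the coefficients of the equation) of the projective space `HypersurfaceSpace M`. -/
abbrev CoeffIndex (M : ℕ) : Type := {d : Fin (M + 1) →₀ ℕ // d.degree = M}

namespace HypersurfaceSpace

/-- An equation of the hypersurface `V`. It is determined up to a nonzero scalar, and all the
conditions below are insensitive to such a scalar. -/
noncomputable def equation {M : ℕ} (V : HypersurfaceSpace M) :
    MvPolynomial (Fin (M + 1)) ℂ :=
  ((Projectivization.rep (K := ℂ) (V := Forms M) V : Forms M) : MvPolynomial (Fin (M + 1)) ℂ)

/-- The vector of homogeneous coordinates of `V`. -/
noncomputable def coords {M : ℕ} (V : HypersurfaceSpace M) : CoeffIndex M → ℂ :=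
  fun d => V.equation.coeff d.1

/-- The common zero locus in `HypersurfaceSpace M` of a set of polynomials in the homogeneous
coordinates. -/
def zeroLocus {M : ℕ} (T : Set (MvPolynomial (CoeffIndex M) ℂ)) : Set (HypersurfaceSpace M) :=
  {V | ∀ P ∈ T, MvPolynomial.eval V.coords P = 0}

/-- Zariski closed subsets: the zero loci of sets of homogeneous polynomials. -/
def IsZariskiClosed {M : ℕ} (S : Set (HypersurfaceSpace M)) : Prop :=
  ∃ T : Set (MvPolynomial (CoeffIndex M) ℂ),
    (∀ P ∈ T, ∃ k : ℕ, P.IsHomogeneous k) ∧ S = zeroLocus T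

/-- The Zariski topology on `HypersurfaceSpace M`. -/
instance zariskiTopology (M : ℕ) : TopologicalSpace (HypersurfaceSpace M) :=
  TopologicalSpace.ofClosed {S | IsZariskiClosed S}
    ⟨{1}, by
      rintro P rfl
      exact ⟨0, MvPolynomial.isHomogeneous_one _ _⟩, by
      ext V
      simp [zeroLocus]⟩
    (by
      intro A hA
      have hA' : ∀ S ∈ A, IsZariskiClosed S := fun S h => hA h
      choose! T hT hS using hA'
      refine ⟨⋃ S ∈ A, T S, ?_, ?_⟩
      · intro P hP
        simp only [Set.mem_iUnion] at hP
        obtain ⟨S, hSA, hP⟩ := hP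
        exact hT S hSA P hP
      · ext V
        constructor
        · intro hV P hP
          simp only [Set.mem_iUnion] at hP
          obtain ⟨S, hSA, hP⟩ := hP
          have h := hV S hSA
          rw [hS S hSA] at h
          exact h P hP
        · intro hV S hSA
          rw [hS S hSA]
          intro P hP
          exact hV P (by simp only [Set.mem_iUnion]; exact ⟨S, hSA, hP⟩))
    (by
      rintro _ ⟨T₁, h₁, rfl⟩ _ ⟨T₂, h₂, rfl⟩
      refine ⟨Set.image2 (fun P Q => P * Q) T₁ T₂, ?_, ?_⟩
      · rintro _ ⟨P, hP, Q, hQ, rfl⟩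
        obtain ⟨k, hk⟩ := h₁ P hP
        obtain ⟨l, hl⟩ := h₂ Q hQ
        exact ⟨k + l, hk.mul hl⟩
      · ext V
        constructor
        · rintro (hV | hV) _ ⟨P, hP, Q, hQ, rfl⟩
          · simp [hV P hP]
          · simp [hV Q hQ]
        · intro hV
          by_contra hcon
          rw [Set.mem_union, not_or] at hcon
          obtain ⟨hc₁, hc₂⟩ := hcon
          simp only [zeroLocus, Set.mem_ofPred_eq, not_forall] at hc₁ hc₂
          obtain ⟨P, hP, hP0⟩ := hc₁
          obtain ⟨Q, hQ, hQ0⟩ := hc₂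
          have h := hV (P * Q) ⟨P, hP, Q, hQ, rfl⟩
          rw [map_mul] at h
          exact (mul_ne_zero hP0 hQ0) h)

end HypersurfaceSpace

/-- The subset `S` of the (finite-dimensional, irreducible) space `X` has codimension at least
`c`, where the codimension of `S` is that of its closure: `dim X - dim (closure S) ≥ c`. The
dimension is the Krull dimension of the topological space, the empty set has dimension `⊥`. -/
def CodimAtLeast {X : Type*} [TopologicalSpace X] (c : ℕ) (S : Set X) : Prop :=
  topologicalKrullDim (closure S) + (c : WithBot ℕ∞) ≤ topologicalKrullDim X

section Points

/-! Points of `ℙ^M` are given by nonzero vectors `p` of homogeneous coordinates. -/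

/-- The point `p` of the hypersurface `f = 0` is smooth (Jacobian criterion). -/
def IsSmoothPoint {M : ℕ} (f : MvPolynomial (Fin (M + 1)) ℂ) (p : Fin (M + 1) → ℂ) : Prop :=
  ∃ i, MvPolynomial.eval p (MvPolynomial.pderiv i f) ≠ 0

/-- The point `p` of the hypersurface `f = 0` is a quadratic point of rank `r`: in some analytic
coordinates `z` of `ℙ^M` around `p`, the hypersurface is given by an equation `q₂(z) + (terms of
degree at least three)` with a quadratic form `q₂(z) = zᵀ A z` of rank `r`.

The coordinates are given by their inverse, a germ `φ` of an analytic map from `ℂ^M` to the cone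
`ℂ^{M+1}` over `ℙ^M`, whose composition with the projection to `ℙ^M` is locally biholomorphic. -/
def IsQuadraticPoint {M : ℕ} (f : MvPolynomial (Fin (M + 1)) ℂ) (p : Fin (M + 1) → ℂ)
    (r : ℕ) : Prop :=
  ∃ (φ : (Fin M → ℂ) → (Fin (M + 1) → ℂ)) (A : Matrix (Fin M) (Fin M) ℂ),
    AnalyticAt ℂ φ 0 ∧ φ 0 = p ∧
    IsCompl (LinearMap.range (fderiv ℂ φ 0 : (Fin M → ℂ) →ₗ[ℂ] (Fin (M + 1) → ℂ)))
      (Submodule.span ℂ {p}) ∧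
    A.IsSymm ∧ A.rank = r ∧
    (fun z => MvPolynomial.eval (φ z) f - z ⬝ᵥ A.mulVec z)
      =O[nhds (0 : Fin M → ℂ)] (fun z => ‖z‖ ^ 3)

/-- Let `p, b₁, …, b_M` be a basis of `ℂ^{M+1}`, that is, a choice of homogeneous coordinates
`(X₀ : … : X_M)` in which `p` becomes `(1 : 0 : … : 0)`. This is the equation of the hypersurface
`f = 0` in the affine chart `X₀ = 1`, the polynomial `f(p + X₁ b₁ + … + X_M b_M)`. -/
noncomputable def localEquation {M : ℕ} (f : MvPolynomial (Fin (M + 1)) ℂ)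
    (p : Fin (M + 1) → ℂ) (b : Fin M → Fin (M + 1) → ℂ) : MvPolynomial (Fin M) ℂ :=
  MvPolynomial.aeval
    (fun j => MvPolynomial.C (p j) + ∑ k, MvPolynomial.C (b k j) * MvPolynomial.X k) f

/-- The regularity condition at a point `p` of the hypersurface `f = 0`: choosing homogeneous
coordinates with `p = (1 : 0 : … : 0)` and writing the equation in the affine chart as
`q₁ + ⋯ + q_M` with `q_i` homogeneous of degree `i`, the sequence `q₁, …, q_{M-1}` is regular
in `ℂ[X₁, …, X_M]`. (A change of coordinates fixing `p` does not change, up to a linear change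
of variables, the ideals `(q₁, …, q_i)`, so the condition does not depend on the choice.) -/
def IsRegularPoint {M : ℕ} (f : MvPolynomial (Fin (M + 1)) ℂ) (p : Fin (M + 1) → ℂ) : Prop :=
  ∃ b : Fin M → Fin (M + 1) → ℂ,
    LinearIndependent ℂ (Fin.cons p b : Fin (M + 1) → Fin (M + 1) → ℂ) ∧
    RingTheory.Sequence.IsRegular (MvPolynomial (Fin M) ℂ)
      (List.ofFn fun i : Fin (M - 1) =>
        MvPolynomial.homogeneousComponent ((i : ℕ) + 1) (localEquation f p b))

/-- The lines in `ℙ^M` (two-dimensional subspaces of `ℂ^{M+1}`) through `p` which are contained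
in the hypersurface `f = 0`. -/
def linesThrough {M : ℕ} (f : MvPolynomial (Fin (M + 1)) ℂ) (p : Fin (M + 1) → ℂ) :
    Set (Submodule ℂ (Fin (M + 1) → ℂ)) :=
  {L | Module.finrank ℂ L = 2 ∧ p ∈ L ∧ ∀ v ∈ L, MvPolynomial.eval v f = 0}

end Points

/-- `𝓕_{qsing ≥ r}`: the hypersurfaces every point of which is either smooth or a quadratic
singularity of rank at least `r`. -/
def qsing (M r : ℕ) : Set (HypersurfaceSpace M) :=
  {V | ∀ p : Fin (M + 1) → ℂ, p ≠ 0 → MvPolynomial.eval p V.equation = 0 →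
    IsSmoothPoint V.equation p ∨ ∃ s, r ≤ s ∧ IsQuadraticPoint V.equation p s}

/-- `𝓕_{reg, qsing ≥ r}`: the hypersurfaces in `𝓕_{qsing ≥ r}` which satisfy the regularity
condition at every smooth point and carry only finitely many lines through every singular
point. -/
def regQsing (M r : ℕ) : Set (HypersurfaceSpace M) :=
  {V | V ∈ qsing M r ∧
    ∀ p : Fin (M + 1) → ℂ, p ≠ 0 → MvPolynomial.eval p V.equation = 0 →
      (IsSmoothPoint V.equation p → IsRegularPoint V.equation p) ∧
      (¬ IsSmoothPoint V.equation p → (linesThrough V.equation p).Finite)}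

/-! Parameters are counted by transcendence degrees of single complex points rather than by
dimensions of incidence varieties. `transRank S` is the transcendence degree of ℚ(S), and
`ratClosure S` is the algebraic closure of ℚ(S) in ℂ.

Reduction to local equations. A hypersurface outside `regQsing M 5` has a point p at which the local
equation q_0 + ... + q_M has q_0 = 0 and one of three defects: (a) q_1 = 0 and q_2 has rank at most
4; (b) q_1 = 0 and q_2, ..., q_M have a common zero on every hyperplane, as is the case when
infinitely many lines pass through p; (c) q_1 ≠ 0 and q_1, ..., q_{M-1} have a common zero on every
hyperplane, as is the case when they are not a regular sequence. Each defect lowers the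
transcendence degree of the local coefficients by at least C(M-3,2) + 1 + M, and the position of p
gives back at most M.

From points to dimension. Let N be the number of coefficients. By this count, more than N - C(M-3,2)
- 1 coefficients of a suitable multiple of the equation of a bad hypersurface are algebraically
dependent over ℚ. Since ℂ is uncountable and there are countably many rational polynomials, one
relation serves all bad hypersurfaces (`exists_relation_of_forall_not_algebraicIndependent`). A
chain of length m of irreducible closed subsets of their closure yields m + 1 algebraically
independent coordinates, which bounds m; the whole space has a chain of length N - 1.

The local count. In (a) it is the codimension of symmetric matrices of rank at most 4. In (b) and
(c), cutting by a generic hyperplane and rescaling gives a zero ξ of transcendence degree at least 2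
over the coefficients. The forms are adjoined degree by degree, and the transcendence degree of ξ
never grows. If it does not drop when q_j is adjoined, then q_j vanishes at a point independent of
it, so its coefficients satisfy as many linear conditions as the Hilbert function in degree j of the
locus of ξ (`transRank_union_range_add_finrank_le`). This Hilbert function is at least bj + 1 if the
locus spans a ℙ^b, and at least C(d+j-1, j) if ξ has transcendence degree d. For small b, choosing
the span costs few parameters and most steps save; for large b, one well chosen step is enough
(`two_mul_transRank_coeffStage_le`). -/

/-! ### Transcendence degree over ℚ of finite sets of complex numbers -/

/-- The relative algebraic closure in `ℂ` of the field generated by `S`. -/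
noncomputable def ratClosure (S : Set ℂ) : IntermediateField ℚ ℂ :=
  (algebraicClosure (IntermediateField.adjoin ℚ S) ℂ).restrictScalars ℚ

theorem mem_ratClosure {S : Set ℂ} {z : ℂ} :
    z ∈ ratClosure S ↔ IsAlgebraic (IntermediateField.adjoin ℚ S) z :=
  mem_algebraicClosure_iff

/-- These fields are the flats of the algebraic independence matroid, so monotonicity, submodularity
and the existence of bases are facts about matroid rank. -/
theorem coe_ratClosure (S : Set ℂ) :
    (ratClosure S : Set ℂ) = (AlgebraicIndependent.matroid ℚ ℂ).closure S := by
  ext z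
  rw [AlgebraicIndependent.matroid_closure_eq, SetLike.mem_coe, mem_ratClosure,
    IntermediateField.isAlgebraic_adjoin_iff]
  rfl

instance (S : Set ℂ) : IsAlgClosed (ratClosure S) :=
  IsAlgClosure.isAlgClosed (K := algebraicClosure (IntermediateField.adjoin ℚ S) ℂ)
    (IntermediateField.adjoin ℚ S)

theorem subset_ratClosure (S : Set ℂ) : S ⊆ ratClosure S := by
  rw [coe_ratClosure]
  exact Matroid.subset_closure _ _ (Set.subset_univ _)

theorem ratClosure_mono {S T : Set ℂ} (h : S ⊆ T) : ratClosure S ≤ ratClosure T := by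
  rw [← SetLike.coe_subset_coe, coe_ratClosure, coe_ratClosure]
  exact Matroid.closure_subset_closure _ h

theorem ratClosure_le {S T : Set ℂ} (h : S ⊆ ratClosure T) : ratClosure S ≤ ratClosure T := by
  rw [← SetLike.coe_subset_coe, coe_ratClosure, coe_ratClosure]
  rw [coe_ratClosure] at h
  exact Matroid.closure_subset_closure_of_subset_closure h

/-- The transcendence degree over `ℚ` of the field generated by the (finite) set `S`. -/
noncomputable def transRank (S : Set ℂ) : ℕ := ((AlgebraicIndependent.matroid ℚ ℂ).eRk S).toNat

theorem eRk_eq_transRank {S : Set ℂ} (hS : S.Finite) :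
    (AlgebraicIndependent.matroid ℚ ℂ).eRk S = transRank S := by
  rw [transRank, ENat.natCast_toNat]
  exact Matroid.eRk_ne_top_iff.2 (Matroid.isRkFinite_of_finite _ hS)

theorem transRank_mono {S T : Set ℂ} (hT : T.Finite) (h : S ⊆ T) :
    transRank S ≤ transRank T := by
  have := (AlgebraicIndependent.matroid ℚ ℂ).eRk_mono h
  rw [eRk_eq_transRank hT, eRk_eq_transRank (hT.subset h)] at this
  exact_mod_cast this

theorem transRank_union_le {S T : Set ℂ} (hS : S.Finite) (hT : T.Finite) :
    transRank (S ∪ T) ≤ transRank S + T.ncard := by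
  have := (AlgebraicIndependent.matroid ℚ ℂ).eRk_union_le_eRk_add_encard S T
  rw [eRk_eq_transRank (hS.union hT), eRk_eq_transRank hS, ← hT.cast_ncard_eq] at this
  exact_mod_cast this

theorem transRank_le_ncard {S : Set ℂ} (hS : S.Finite) : transRank S ≤ S.ncard := by
  have := (AlgebraicIndependent.matroid ℚ ℂ).eRk_le_encard S
  rw [eRk_eq_transRank hS, ← hS.cast_ncard_eq] at this
  exact_mod_cast this

theorem transRank_congr {S T : Set ℂ} (h : ratClosure S = ratClosure T) :
    transRank S = transRank T := by
  have h' : (ratClosure S : Set ℂ) = ratClosure T := by rw [h]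
  rw [coe_ratClosure, coe_ratClosure] at h'
  rw [transRank, transRank, ← Matroid.eRk_closure_eq, h', Matroid.eRk_closure_eq]

theorem transRank_union_of_subset {S T : Set ℂ} (h : T ⊆ ratClosure S) :
    transRank (S ∪ T) = transRank S :=
  transRank_congr (le_antisymm (ratClosure_le (Set.union_subset (subset_ratClosure S) h))
    (ratClosure_mono Set.subset_union_left))

theorem transRank_le_of_subset_ratClosure {S T : Set ℂ} (hS : S.Finite) (hT : T.Finite)
    (h : T ⊆ ratClosure S) : transRank T ≤ transRank S :=
  (transRank_mono (hS.union hT) Set.subset_union_right).trans (transRank_union_of_subset h).le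

theorem transRank_insert {S : Set ℂ} (hS : S.Finite) {z : ℂ} (hz : z ∉ ratClosure S) :
    transRank (insert z S) = transRank S + 1 := by
  have h : z ∉ (AlgebraicIndependent.matroid ℚ ℂ).closure S := by
    rw [← coe_ratClosure]; exact hz
  have := Matroid.eRk_insert_eq_add_one (M := AlgebraicIndependent.matroid ℚ ℂ)
    (e := z) (X := S) ⟨Set.mem_univ _, h⟩
  rw [eRk_eq_transRank (hS.insert z), eRk_eq_transRank hS] at this
  exact_mod_cast this

/-- The transcendence degree of `X` over `A` decreases when `A` grows. -/
theorem transRank_submodular {A B X : Set ℂ} (hB : B.Finite) (hX : X.Finite) (h : A ⊆ B) :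
    transRank (B ∪ X) + transRank A ≤ transRank (A ∪ X) + transRank B := by
  have hA := hB.subset h
  have := (AlgebraicIndependent.matroid ℚ ℂ).eRk_inter_add_eRk_union_le (A ∪ X) B
  have h1 : A ∪ X ∪ B = B ∪ X := by
    rw [Set.union_right_comm, Set.union_eq_self_of_subset_left h]
  have h2 := (AlgebraicIndependent.matroid ℚ ℂ).eRk_mono
    (show A ⊆ (A ∪ X) ∩ B from Set.subset_inter Set.subset_union_left h)
  have h3 := (add_le_add_left h2 _).trans this
  rw [h1, eRk_eq_transRank (hB.union hX), eRk_eq_transRank hA, eRk_eq_transRank (hA.union hX),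
    eRk_eq_transRank hB] at h3
  rw [add_comm]
  exact_mod_cast h3

/-- Linear relations bound transcendence degree: a basis of the span chosen among the `c` generates
all of them over `ratClosure S`. -/
theorem transRank_union_range_le_finrank {κ : Type*} [Finite κ] {S : Set ℂ} (hS : S.Finite)
    (c : κ → ℂ) : transRank (S ∪ Set.range c) ≤
      transRank S +
        Module.finrank (ratClosure S) (Submodule.span (ratClosure S) (Set.range c)) := by
  obtain ⟨b, hb, hspan, hli⟩ := exists_linearIndependent (ratClosure S) (Set.range c)
  have hbf : b.Finite := (Set.finite_range c).subset hb
  have hcard : b.ncard = Module.finrank (ratClosure S)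
      (Submodule.span (ratClosure S) (Set.range c)) := by
    have := hbf.fintype
    rw [← hspan, finrank_span_set_eq_card hli, Set.ncard_eq_toFinset_card']
  rw [← hcard]
  refine le_trans (transRank_le_of_subset_ratClosure (hS.union hbf)
    (hS.union (Set.finite_range c)) (Set.union_subset ?_ ?_)) (transRank_union_le hS hbf)
  · exact Set.subset_union_left.trans (subset_ratClosure _)
  · intro z hz
    have hz' : z ∈ Submodule.span (ratClosure S) b := by
      rw [hspan]; exact Submodule.subset_span hz
    refine Submodule.span_induction (p := fun z _ => z ∈ ratClosure (S ∪ b)) ?_ ?_ ?_ ?_ hz'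
    · exact fun x hx => subset_ratClosure _ (Or.inr hx)
    · exact zero_mem _
    · exact fun x y _ _ => add_mem
    · intro a x _ hx
      exact mul_mem (ratClosure_mono Set.subset_union_left a.2) hx

theorem countable_mvPolynomial_rat (σ : Type*) [Countable σ] : Countable (MvPolynomial σ ℚ) := by
  rw [← Cardinal.mk_le_aleph0_iff]
  refine MvPolynomial.cardinalMk_le_max_lift.trans ?_
  simp

theorem countable_ratClosure {S : Set ℂ} (hS : S.Finite) : Countable (ratClosure S) := by
  have h1 : Countable (Algebra.adjoin ℚ S) := by
    have := hS.countable.to_subtype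
    have := countable_mvPolynomial_rat S
    rw [Algebra.adjoin_eq_range]
    exact (AlgHom.rangeRestrict_surjective _).countable
  refine Set.Countable.to_subtype ((Algebraic.countable (Algebra.adjoin ℚ S) ℂ).mono ?_)
  intro z hz
  exact IntermediateField.isAlgebraic_adjoin_iff.1 (mem_ratClosure.1 hz)

theorem exists_notMem_ratClosure {S : Set ℂ} (hS : S.Finite) : ∃ z, z ∉ ratClosure S := by
  by_contra! h
  have := countable_ratClosure hS
  refine not_countable_complex ?_
  exact (Set.countable_coe_iff.1 this).mono fun z _ => h z

/-- A finite-dimensional space over a countable field is countable, and ℂ is not. This supplies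
generic hyperplanes. -/
theorem exists_linearIndependent_ratClosure {S : Set ℂ} (hS : S.Finite) (n : ℕ) :
    ∃ l : Fin n → ℂ, LinearIndependent (ratClosure S) l := by
  have hc := countable_ratClosure hS
  have hrank : (n : Cardinal) ≤ Module.rank (ratClosure S) ℂ := by
    by_contra! hlt
    have hfin : Module.Finite (ratClosure S) ℂ :=
      Module.rank_lt_aleph0_iff.1 (hlt.trans Cardinal.natCast_lt_aleph0)
    have e := (Module.finBasis (ratClosure S) ℂ).equivFun
    have : Countable ℂ := e.toEquiv.countable_iff.2 inferInstance
    exact not_countable_complex Set.countable_univ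
  obtain ⟨s, hs, hli⟩ := le_rank_iff_exists_linearIndependent_finset.1 hrank
  exact ⟨fun i => ((s.equivFin.trans (finCongr hs)).symm i : ℂ),
    hli.comp _ (Equiv.injective _)⟩

/-- If `B` is a transcendence basis of `T`, the rank hypothesis forces `B ∪ J` to be independent and
`B`, `J` to be disjoint; independence over ℚ(B) then persists over its algebraic closure. -/
theorem algebraicIndependent_ratClosure {T J : Set ℂ} (hT : T.Finite) (hJ : J.Finite)
    (h : transRank T + J.ncard ≤ transRank (T ∪ J)) :
    AlgebraicIndependent (ratClosure T) ((↑) : J → ℂ) := by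
  obtain ⟨B, hB⟩ := (AlgebraicIndependent.matroid ℚ ℂ).exists_isBasis T
  have hBf : B.Finite := hT.subset hB.subset
  have hcl : ratClosure T = ratClosure B := by
    rw [← SetLike.coe_set_eq, coe_ratClosure, coe_ratClosure, hB.closure_eq_closure]
  have hBT : transRank T = B.ncard := by
    have := hB.encard_eq_eRk
    rw [eRk_eq_transRank hT, ← hBf.cast_ncard_eq] at this
    exact_mod_cast this.symm
  have hBJ : transRank (T ∪ J) = transRank (B ∪ J) := by
    rw [transRank, transRank, hB.eRk_eq_eRk_union]
  have hle : (B ∪ J).encard ≤ (AlgebraicIndependent.matroid ℚ ℂ).eRk (B ∪ J) := by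
    rw [eRk_eq_transRank (hBf.union hJ), ← hBJ, ← (hBf.union hJ).cast_ncard_eq]
    exact_mod_cast (Set.ncard_union_le B J).trans (hBT ▸ h)
  have hind := (Matroid.isRkFinite_of_finite _ (hBf.union hJ)).indep_of_encard_le_eRk hle
  have hdisj : Disjoint B J := by
    have h1 := Set.ncard_union_add_ncard_inter B J hBf hJ
    have h2 := transRank_le_ncard (hBf.union hJ)
    rw [Set.disjoint_iff_inter_eq_empty, ← Set.ncard_eq_zero (hBf.inter_of_left J)]
    omega
  rw [AlgebraicIndependent.matroid_indep_iff] at hind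
  have h1 : AlgebraicIndependent ℚ (Sum.elim ((↑) : J → ℂ) ((↑) : B → ℂ)) := by
    have := hind.comp (Sum.elim (fun j : J => (⟨j, Or.inr j.2⟩ : ↥(B ∪ J)))
      (fun j : B => (⟨j, Or.inl j.2⟩ : ↥(B ∪ J)))) (by
      rintro (a | a) (b | b) hab <;> replace hab := congrArg Subtype.val hab <;>
        simp only [Sum.elim_inl, Sum.elim_inr] at hab
      · rw [Subtype.ext hab]
      · exact absurd b.2 (hab ▸ Set.disjoint_right.1 hdisj a.2)
      · exact absurd a.2 (hab ▸ Set.disjoint_right.1 hdisj b.2)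
      · rw [Subtype.ext hab])
    convert this using 1
    ext (a | a) <;> rfl
  have h2 := (AlgebraicIndependent.sumElim_iff.1 h1).2
  rw [Subtype.range_coe, ← IntermediateField.algebraicIndependent_adjoin_iff] at h2
  rw [hcl]
  exact h2.algebraicClosure

theorem exists_finite_basis_over {S X : Set ℂ} (hS : S.Finite) (hX : X.Finite) :
    ∃ J ⊆ X, X ⊆ ratClosure (S ∪ J) ∧ transRank (S ∪ X) = transRank S + J.ncard := by
  obtain ⟨B, hB⟩ := (AlgebraicIndependent.matroid ℚ ℂ).exists_isBasis S
  obtain ⟨B', hB', hBB'⟩ := hB.exists_isBasis_inter_eq_of_superset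
    (Set.subset_union_left (t := X)) (by simp)
  have hf : B'.Finite := (hS.union hX).subset hB'.subset
  have hBf : B.Finite := hS.subset hB.subset
  have hcl : B' ⊆ S ∪ (B' \ S) := by
    intro z hz
    by_cases h : z ∈ S
    · exact Or.inl h
    · exact Or.inr ⟨hz, h⟩
  refine ⟨B' \ S, ?_, ?_, ?_⟩
  · intro z hz
    exact (hB'.subset hz.1).resolve_left hz.2
  · have h1 : ((S ∪ X : Set ℂ)) ⊆ ratClosure B' := by
      rw [coe_ratClosure, hB'.closure_eq_closure]
      exact Matroid.subset_closure _ _ (Set.subset_univ _)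
    exact Set.subset_union_right.trans (h1.trans (ratClosure_mono hcl))
  · have h1 : transRank (S ∪ X) = B'.ncard := by
      have := hB'.encard_eq_eRk
      rw [eRk_eq_transRank (hS.union hX), ← hf.cast_ncard_eq] at this
      exact_mod_cast this.symm
    have h2 : transRank S = B.ncard := by
      have := hB.encard_eq_eRk
      rw [eRk_eq_transRank hS, ← hBf.cast_ncard_eq] at this
      exact_mod_cast this.symm
    rw [h1, h2, ← hBB', add_comm]
    have h3 := Set.encard_sdiff_add_encard_inter B' S
    rw [← hf.cast_ncard_eq, ← hf.sdiff.cast_ncard_eq, ← (hf.inter_of_left S).cast_ncard_eq] at h3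
    exact_mod_cast h3.symm

/-! ### Specialization of points by valuation rings -/

theorem ValuationSubring.valuation_mvPolynomial_sub_lt_one {E σ R : Type*} [Field E] [CommRing R]
    [Algebra R E] (O : ValuationSubring E) (hR : ∀ r : R, algebraMap R E r ∈ O) {x y : σ → E}
    (hx : ∀ i, x i ∈ O) (hy : ∀ i, y i ∈ O) (hxy : ∀ i, O.valuation (x i - y i) < 1)
    (P : MvPolynomial σ R) :
    O.valuation (MvPolynomial.aeval x P - MvPolynomial.aeval y P) < 1 := by
  have hmem : ∀ (z : σ → E), (∀ i, z i ∈ O) → ∀ Q : MvPolynomial σ R,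
      MvPolynomial.aeval z Q ∈ O := by
    intro z hz Q
    induction Q using MvPolynomial.induction_on with
    | C a => simpa using hR a
    | add p q hp hq => rw [map_add]; exact O.add_mem _ _ hp hq
    | mul_X p i hp => rw [map_mul, MvPolynomial.aeval_X]; exact O.mul_mem _ _ hp (hz i)
  induction P using MvPolynomial.induction_on with
  | C a => simp
  | add p q hp hq =>
    rw [map_add, map_add, add_sub_add_comm]
    exact O.valuation.map_add_lt hp hq
  | mul_X p i hp =>
    rw [map_mul, map_mul, MvPolynomial.aeval_X, MvPolynomial.aeval_X]
    have h : MvPolynomial.aeval x p * x i - MvPolynomial.aeval y p * y i =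
      (MvPolynomial.aeval x p - MvPolynomial.aeval y p) * x i +
        MvPolynomial.aeval y p * (x i - y i) := by ring
    rw [h]
    refine O.valuation.map_add_lt ?_ ?_
    · rw [map_mul]
      exact mul_lt_one_of_lt_of_le hp ((O.valuation_le_one_iff _).2 (hx i))
    · rw [map_mul, mul_comm]
      exact mul_lt_one_of_lt_of_le (hxy i) ((O.valuation_le_one_iff _).2 (hmem y hy p))

/-- In the factorization of p(w) into the w - r, some factor must have valuation less than one. -/
theorem ValuationSubring.exists_root_sub_lt_one {E : Type*} [Field E] (O : ValuationSubring E)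
    {p : Polynomial E} (hp : p.Monic) (hs : p.Splits) {w : E} (hw : O.valuation (p.eval w) < 1) :
    ∃ r ∈ p.roots, O.valuation (w - r) < 1 := by
  by_contra! h
  rw [hs.eq_prod_roots, hp.leadingCoeff, Polynomial.C_1, one_mul, Polynomial.eval_multiset_prod,
    Multiset.map_map, map_multiset_prod, Multiset.map_map] at hw
  refine absurd hw (not_lt.2 (Multiset.one_le_prod ?_))
  intro a ha
  obtain ⟨r, hr, rfl⟩ := Multiset.mem_map.1 ha
  simpa using h r hr

/-- Independence of `J` makes the substitution of `t` for `J` a ring homomorphism on L[J]; a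
valuation ring is chosen that dominates L[J] along its kernel. -/
theorem exists_valuationSubring_centered {k L : IntermediateField ℚ ℂ} (hkL : k ≤ L) {J : Set ℂ}
    (hJ : AlgebraicIndependent L ((↑) : J → ℂ)) (t : J → k) :
    ∃ O : ValuationSubring ℂ, (∀ z ∈ L, z ∈ O) ∧ (∀ j : J, O.valuation ((j : ℂ) - t j) < 1) := by
  let A := Algebra.adjoin L (Set.range ((↑) : J → ℂ))
  let φ : A →+* L := (MvPolynomial.eval fun j => (⟨t j, hkL (t j).2⟩ : L)).comp
    (hJ.aevalEquiv.symm : A →+* MvPolynomial J L)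
  obtain ⟨O, hAO, hI⟩ := Ideal.image_subset_nonunits_valuationSubring (A := A.toSubring)
    (RingHom.ker φ) (RingHom.ker_ne_top φ)
  refine ⟨O, fun z hz => hAO (A.algebraMap_mem (⟨z, hz⟩ : L)), fun j => ?_⟩
  have hmem : (j : ℂ) - t j ∈ O.nonunits := by
    have he : φ (hJ.aevalEquiv (MvPolynomial.X j - MvPolynomial.C ⟨t j, hkL (t j).2⟩)) = 0 := by
      simp [φ]
    have := hI ⟨_, he, rfl⟩
    have h2 : (j : ℂ) - t j = MvPolynomial.aeval ((↑) : J → ℂ)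
        (MvPolynomial.X j - MvPolynomial.C ⟨t j, hkL (t j).2⟩ : MvPolynomial J L) := by
      simp [IntermediateField.algebraMap_apply]
    rw [h2, ← hJ.algebraMap_aevalEquiv]
    exact this
  exact hmem

/-- A nonzero multiple of each `y` by a polynomial `d y` in `J` is integral over k[J]. If `t` avoids
the zeros of these finitely many polynomials, the monic equation of the multiple reduces to one over
the algebraically closed field `k`. Hence the residue lies in `k`, and dividing by the value of `d
y` at `t` gives the residue of `y`. -/
theorem exists_valuationSubring_of_isAlgebraic {k L : IntermediateField ℚ ℂ} [IsAlgClosed k]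
    (hkL : k ≤ L) {J : Set ℂ} (hJ : AlgebraicIndependent L ((↑) : J → ℂ)) {Y : Set ℂ}
    (hY : Y.Finite) (hYJ : ∀ y ∈ Y, IsAlgebraic (Algebra.adjoin k J) y) :
    ∃ O : ValuationSubring ℂ, (∀ z ∈ L, z ∈ O) ∧
      ∀ y ∈ Y, ∃ x : k, O.valuation (y - x) < 1 := by
  have hJk : AlgebraicIndependent k ((↑) : J → ℂ) := by
    let _ : Algebra k L := (IntermediateField.inclusion hkL).toRingHom.toAlgebra
    have : IsScalarTower k L ℂ := .of_algebraMap_eq fun _ => rfl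
    exact hJ.restrictScalars (algebraMap k L).injective
  let _ : Algebra (MvPolynomial J k) ℂ := (MvPolynomial.aeval ((↑) : J → ℂ)).toRingHom.toAlgebra
  have halg : ∀ P : MvPolynomial J k,
    algebraMap (MvPolynomial J k) ℂ P = MvPolynomial.aeval ((↑) : J → ℂ) P := fun _ => rfl
  have hint : ∀ y ∈ Y, ∃ d : MvPolynomial J k, d ≠ 0 ∧ IsIntegral (MvPolynomial J k) (d • y) := by
    intro y hy
    have h1 := hYJ y hy
    rw [← Subtype.range_coe (s := J)] at h1
    have h2 : IsAlgebraic (MvPolynomial J k) y :=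
      h1.ringHom_of_comp_eq (hJk.aevalEquiv.symm : _ →+* MvPolynomial J k) (RingHom.id ℂ)
        hJk.aevalEquiv.symm.injective (by
          ext z
          obtain ⟨P, rfl⟩ := hJk.aevalEquiv.surjective z
          simp [halg])
    exact h2.exists_integral_multiple
  choose! d hd0 hdint using hint
  -- The field `k` is infinite, so a nonzero polynomial has a point of nonvanishing.
  obtain ⟨t, ht⟩ : ∃ t : J → k, MvPolynomial.eval t (∏ y ∈ hY.toFinset, d y) ≠ 0 := by
    by_contra! h
    refine Finset.prod_ne_zero_iff.2 (fun y hy => hd0 y (hY.mem_toFinset.1 hy))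
      (MvPolynomial.funext (q := 0) fun t => ?_)
    rw [h t, map_zero]
  obtain ⟨O, hLO, htO⟩ := exists_valuationSubring_centered hkL hJ t
  have hkO : ∀ z : k, algebraMap k ℂ z ∈ O := fun z => hLO _ (hkL z.2)
  have hval1 : ∀ z : k, z ≠ 0 → O.valuation (z : ℂ) = 1 := by
    intro z hz
    refine (O.valuation_eq_one_iff ⟨z, hkO z⟩).1 (IsUnit.of_mul_eq_one ⟨(z⁻¹ : k), hkO z⁻¹⟩ ?_)
    ext
    simp [hz]
  have hJO : ∀ j : J, (j : ℂ) ∈ O := by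
    intro j
    have := O.add_mem _ _ ((O.valuation_le_one_iff _).1 (htO j).le) (hkO (t j))
    simpa [IntermediateField.algebraMap_apply] using this
  have hcong : ∀ P : MvPolynomial J k, O.valuation (MvPolynomial.aeval ((↑) : J → ℂ) P -
      (MvPolynomial.eval t P : k)) < 1 := by
    intro P
    have := O.valuation_mvPolynomial_sub_lt_one hkO hJO (fun j => hkO (t j)) htO P
    have h2 : MvPolynomial.aeval (fun j => algebraMap k ℂ (t j)) P
        = ((MvPolynomial.eval t P : k) : ℂ) := by
      have := MvPolynomial.aeval_algebraMap_apply (B := ℂ) t P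
      rw [MvPolynomial.aeval_eq_eval] at this
      exact this
    rwa [h2] at this
  have hPO : ∀ P : MvPolynomial J k, algebraMap (MvPolynomial J k) ℂ P ∈ O := by
    intro P
    have := O.add_mem _ _ ((O.valuation_le_one_iff _).1 (hcong P).le) (hkO (MvPolynomial.eval t P))
    rw [halg]
    simpa [IntermediateField.algebraMap_apply] using this
  refine ⟨O, hLO, fun y hy => ?_⟩
  have hD : MvPolynomial.eval t (d y) ≠ 0 := by
    rw [map_prod] at ht
    exact Finset.prod_ne_zero_iff.1 ht y (hY.mem_toFinset.2 hy)
  obtain ⟨p, hp, hpw⟩ := hdint y hy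
  set w := d y • y with hw
  have hwO : w ∈ O := by
    have h1 : IsIntegral O w := by
      refine ⟨p.map ((algebraMap (MvPolynomial J k) ℂ).codRestrict O.toSubring hPO),
        hp.map _, ?_⟩
      rw [Polynomial.eval₂_map]
      exact hpw
    obtain ⟨z, hz⟩ := IsIntegrallyClosed.isIntegral_iff.1 h1
    rw [← hz]
    exact z.2
  let p0 : Polynomial k := p.map (MvPolynomial.eval t)
  have hp0 : p0.Monic := hp.map _
  have hval : O.valuation ((p0.map (algebraMap k ℂ)).eval w) < 1 := by
    have h1 : (p0.map (algebraMap k ℂ)).eval w = (p0.map (algebraMap k ℂ)).eval w -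
        (p.map (algebraMap (MvPolynomial J k) ℂ)).eval w := by
      rw [Polynomial.eval_map (algebraMap (MvPolynomial J k) ℂ), hpw, sub_zero]
    rw [h1, Polynomial.eval_eq_sum_range, Polynomial.eval_eq_sum_range,
      (hp0).natDegree_map, hp.natDegree_map, hp.natDegree_map, ← Finset.sum_sub_distrib]
    refine O.valuation.map_sum_lt one_ne_zero fun i _ => ?_
    rw [← sub_mul, map_mul]
    refine mul_lt_one_of_lt_of_le ?_ ((O.valuation_le_one_iff _).2 (pow_mem hwO i))
    rw [O.valuation.map_sub_swap]
    simpa [p0, halg] using hcong (p.coeff i)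
  obtain ⟨r, hr, hrw⟩ := O.exists_root_sub_lt_one (hp0.map (algebraMap k ℂ))
    ((IsAlgClosed.splits p0).map _) hval
  rw [(IsAlgClosed.splits p0).roots_map] at hr
  obtain ⟨r, -, rfl⟩ := Multiset.mem_map.1 hr
  refine ⟨r / MvPolynomial.eval t (d y), ?_⟩
  set D := MvPolynomial.eval t (d y) with hDdef
  set δ := MvPolynomial.aeval ((↑) : J → ℂ) (d y) with hδ
  have hcD : O.valuation (δ - D) < 1 := hcong (d y)
  have hvD := hval1 D hD
  have hvδ : O.valuation δ = 1 := by
    have := O.valuation.map_add_eq_of_lt_right (x := δ - D) (y := (D : ℂ)) (by rwa [hvD])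
    rw [sub_add_cancel] at this
    rw [this, hvD]
  have hw' : w = δ * y := rfl
  have hDC : (D : ℂ) ≠ 0 := fun h => hD (by exact_mod_cast h)
  have hid : δ * D * (y - (r / D : k)) =
        (w - algebraMap k ℂ r) * D - algebraMap k ℂ r * (δ - D) := by
    rw [hw', IntermediateField.algebraMap_apply]
    push_cast
    field_simp
    ring
  have hfin : O.valuation (δ * D * (y - (r / D : k))) < 1 := by
    rw [hid]
    refine O.valuation.map_sub_lt ?_ ?_
    · rw [map_mul, hvD, mul_one]; exact hrw
    · rw [map_mul, mul_comm]
      exact mul_lt_one_of_lt_of_le hcD ((O.valuation_le_one_iff _).2 (hkO r))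
  rwa [map_mul, map_mul, hvδ, hvD, one_mul, one_mul] at hfin

/-- The hypothesis `h` says that `ξ` and `c` are independent over `S`. A transcendence basis of `ξ`
over `S` thus stays independent over `ratClosure (S ∪ c)` and can be moved to values in `ratClosure
S` without breaking relations that involve `c`. Keeping the inverse of g(ξ) finite ensures that `g`
does not vanish at the new point. -/
theorem exists_specialization {ι : Type*} [Finite ι] {S c : Set ℂ} (hS : S.Finite) (hc : c.Finite)
    (ξ : ι → ℂ) (h : transRank (S ∪ c) + transRank (S ∪ Set.range ξ) ≤
      transRank (S ∪ c ∪ Set.range ξ) + transRank S)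
    (g : MvPolynomial ι (ratClosure S)) (hg : MvPolynomial.aeval ξ g ≠ 0) :
    ∃ x : ι → ratClosure S, MvPolynomial.eval x g ≠ 0 ∧
      ∀ F : MvPolynomial ι (ratClosure (S ∪ c)), MvPolynomial.aeval ξ F = 0 →
        MvPolynomial.aeval (fun i => (x i : ℂ)) F = 0 := by
  obtain ⟨J, hJξ, hξJ, hJcard⟩ := exists_finite_basis_over hS (Set.finite_range ξ)
  have hJf : J.Finite := (Set.finite_range ξ).subset hJξ
  have hind : AlgebraicIndependent (ratClosure (S ∪ c)) ((↑) : J → ℂ) := by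
    refine algebraicIndependent_ratClosure (hS.union hc) hJf ?_
    have : transRank (S ∪ c ∪ Set.range ξ) ≤ transRank (S ∪ c ∪ J) := by
      refine transRank_le_of_subset_ratClosure ((hS.union hc).union hJf)
        ((hS.union hc).union (Set.finite_range ξ)) (Set.union_subset ?_ ?_)
      · exact Set.subset_union_left.trans (subset_ratClosure _)
      · refine hξJ.trans (ratClosure_mono ?_)
        exact Set.union_subset_union_left _ Set.subset_union_left
    omega
  have hle : ratClosure S ≤ ratClosure (S ∪ c) := ratClosure_mono Set.subset_union_left
  have hgmem : ∀ Q : MvPolynomial ι (ratClosure S),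
      MvPolynomial.aeval ξ Q ∈ ratClosure (S ∪ J) := by
    intro Q
    induction Q using MvPolynomial.induction_on with
    | C a => simpa using! ratClosure_mono Set.subset_union_left a.2
    | add p q hp hq => rw [map_add]; exact add_mem hp hq
    | mul_X p i hp => rw [map_mul, MvPolynomial.aeval_X]; exact mul_mem hp (hξJ ⟨i, rfl⟩)
  have halg : ∀ y ∈ ratClosure (S ∪ J), IsAlgebraic (Algebra.adjoin (ratClosure S) J) y := by
    intro y hy
    have h1 := IntermediateField.isAlgebraic_adjoin_iff.1 (mem_ratClosure.1 hy)
    have hsub : Algebra.adjoin ℚ (S ∪ J) ≤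
        (Algebra.adjoin (ratClosure S) J).restrictScalars ℚ := by
      refine Algebra.adjoin_le (Set.union_subset ?_ ?_)
      · intro z hz
        exact (Algebra.adjoin (ratClosure S) J).algebraMap_mem ⟨z, subset_ratClosure S hz⟩
      · exact Algebra.subset_adjoin
    exact h1.ringHom_of_comp_eq
      (Subalgebra.inclusion hsub).toRingHom
      (RingHom.id ℂ) (Subalgebra.inclusion_injective hsub) rfl
  obtain ⟨O, hLO, hO⟩ := exists_valuationSubring_of_isAlgebraic hle hind
    (Y := insert (MvPolynomial.aeval ξ g)⁻¹ (Set.range ξ)) ((Set.finite_range ξ).insert _) (by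
      rintro y (rfl | ⟨i, rfl⟩)
      · exact halg _ (inv_mem (hgmem g))
      · exact halg _ (hξJ ⟨i, rfl⟩))
  choose x hx using fun i => hO (ξ i) (Or.inr ⟨i, rfl⟩)
  have hkO : ∀ z : ratClosure S, algebraMap _ ℂ z ∈ O := fun z => hLO _ (hle z.2)
  have hmemO : ∀ y : ℂ, ∀ z : ratClosure S, O.valuation (y - z) < 1 → y ∈ O := by
    intro y z hyz
    have := O.add_mem _ _ ((O.valuation_le_one_iff _).1 hyz.le) (hkO z)
    simpa [IntermediateField.algebraMap_apply] using this
  refine ⟨x, fun h0 => ?_, fun F hF => ?_⟩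
  · have h1 := O.valuation_mvPolynomial_sub_lt_one hkO (fun i => hmemO _ _ (hx i))
      (fun i => hkO (x i)) hx g
    rw [show (MvPolynomial.aeval fun i => algebraMap (ratClosure S) ℂ (x i)) g =
      algebraMap (ratClosure S) ℂ (MvPolynomial.aeval x g) from
        MvPolynomial.aeval_algebraMap_apply _ _ _, MvPolynomial.aeval_eq_eval, h0, map_zero,
      sub_zero] at h1
    obtain ⟨z, hz⟩ := hO _ (Or.inl rfl)
    have h2 := (O.valuation_le_one_iff _).2 (hmemO _ _ hz)
    have h3 := mul_lt_one_of_lt_of_le h1 h2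
    rw [← map_mul, mul_inv_cancel₀ hg, map_one] at h3
    exact lt_irrefl _ h3
  · have h1 := O.valuation_mvPolynomial_sub_lt_one (fun z => hLO _ z.2)
      (fun i => hmemO _ _ (hx i)) (fun i => hkO (x i)) hx F
    rw [hF, zero_sub, Valuation.map_neg] at h1
    -- The valuation ring contains the whole field `ratClosure (S ∪ c)`, so a nonzero element of
    -- that field cannot have valuation less than one.
    by_contra h0
    have hmem : MvPolynomial.aeval (fun i => (x i : ℂ)) F ∈ ratClosure (S ∪ c) := by
      have := MvPolynomial.aeval_algebraMap_apply (B := ℂ)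
        (fun i => (⟨x i, hle (x i).2⟩ : ratClosure (S ∪ c))) F
      change MvPolynomial.aeval (fun i => (x i : ℂ)) F = _ at this
      rw [this]
      exact (MvPolynomial.aeval _ F : ratClosure (S ∪ c)).2
    have h2 := (O.valuation_le_one_iff _).2 (hLO _ (inv_mem hmem))
    have h3 := mul_lt_one_of_lt_of_le h1 h2
    have h4 : O.valuation (MvPolynomial.aeval (fun i => (x i : ℂ)) F *
        (MvPolynomial.aeval (fun i => (x i : ℂ)) F)⁻¹) < 1 := by
      rw [map_mul]; exact h3
    rw [mul_inv_cancel₀ h0, map_one] at h4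
    exact lt_irrefl _ h4

/-! ### Conditions imposed by a generic zero, and Hilbert functions -/

open scoped Pointwise

/-- Duality: `τ` kills the annihilator of `R`, so it factors through the functionals on the span of
`R`. -/
theorem finrank_range_le_finrank_span {k M E : Type*} [Field k] [AddCommGroup M] [Module k M]
    [Fintype E] (R : Set (E → k)) (τ : (E → k) →ₗ[k] M)
    (h : ∀ a : E → k, (∀ v ∈ R, a ⬝ᵥ v = 0) → τ a = 0) :
    Module.finrank k (LinearMap.range τ) ≤ Module.finrank k (Submodule.span k R) := by
  classical
  have h1 : (Submodule.span k R).dualAnnihilator.comap (dotProductEquiv k E).toLinearMap ≤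
      LinearMap.ker τ := by
    intro a ha
    refine h a fun v hv => ?_
    rw [Submodule.mem_comap, Submodule.mem_dualAnnihilator] at ha
    exact ha v (Submodule.subset_span hv)
  have h2 := Submodule.finrank_mono h1
  have h3 := LinearMap.finrank_range_add_finrank_ker τ
  have h4 := Subspace.finrank_add_finrank_dualAnnihilator_eq (Submodule.span k R)
  have h5 : Module.finrank k ((Submodule.span k R).dualAnnihilator.comap
      (dotProductEquiv k E).toLinearMap) =
      Module.finrank k (Submodule.span k R).dualAnnihilator :=
    LinearEquiv.finrank_eq ((dotProductEquiv k E).ofSubmodule' _)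
  omega

/-- If the form with coefficients `c` vanishes at `ξ` and `c` is independent of `ξ` over `S`, then
each independent monomial in `ξ` imposes one condition on `c`. -/
theorem transRank_union_range_add_finrank_le {ι E : Type*} [Finite ι] [Fintype E] {S : Set ℂ}
    (hS : S.Finite) (c : E → ℂ) (ξ : ι → ℂ) (m : E → ι →₀ ℕ)
    (hc : ∑ e, c e * (m e).prod (fun i n => ξ i ^ n) = 0)
    (h : transRank (S ∪ Set.range c) + transRank (S ∪ Set.range ξ) ≤
      transRank (S ∪ Set.range c ∪ Set.range ξ) + transRank S) :
    transRank (S ∪ Set.range c) + Module.finrank (ratClosure S) (Submodule.span (ratClosure S)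
      (Set.range fun e => (m e).prod (fun i n => ξ i ^ n))) ≤ transRank S + Fintype.card E := by
  classical
  let k := ratClosure S
  let L := ratClosure (S ∪ Set.range c)
  have hspec := exists_specialization hS (Set.finite_range c) ξ h
  let Z : Set (ι → k) := {x | ∀ F : MvPolynomial ι L, MvPolynomial.aeval ξ F = 0 →
        MvPolynomial.aeval (fun i => (x i : ℂ)) F = 0}
  let v : (ι → k) → (E → k) := fun x e => (m e).prod (fun i n => x i ^ n)
  let F0 : MvPolynomial ι L := ∑ e, MvPolynomial.monomial (m e)
    (⟨c e, subset_ratClosure _ (Or.inr ⟨e, rfl⟩)⟩ : L)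
  have hF0 : ∀ y : ι → ℂ, MvPolynomial.aeval y F0 =
      ∑ e, c e * (m e).prod (fun i n => y i ^ n) := by
    intro y
    simp [F0, MvPolynomial.aeval_monomial, IntermediateField.algebraMap_apply]
  -- Each specialization `x` of `ξ` to a point over `k` turns the equation F0(ξ) = 0 into a linear
  -- relation among the `c` with coefficients in `k`.
  have h1 : Submodule.span k (v '' Z) ≤ LinearMap.ker (Fintype.linearCombination k c) := by
    rw [Submodule.span_le]
    rintro _ ⟨x, hx, rfl⟩
    have := hx F0 (by rw [hF0, hc])
    rw [hF0] at this
    rw [SetLike.mem_coe, LinearMap.mem_ker, Fintype.linearCombination_apply, ← this]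
    refine Finset.sum_congr rfl fun e _ => ?_
    rw [mul_comm]
    simp [v, Algebra.smul_def, IntermediateField.algebraMap_apply, Finsupp.prod]
  -- The specializations are dense in the locus of `ξ`: a form over `k` vanishing at all of them
  -- vanishes at `ξ`. They therefore give at least as many relations as there are independent
  -- monomials in `ξ`.
  have h2 := finrank_range_le_finrank_span (v '' Z) (Fintype.linearCombination k
    (fun e => (m e).prod (fun i n => ξ i ^ n))) (by
    intro a ha
    by_contra hne
    let G : MvPolynomial ι k := ∑ e, MvPolynomial.monomial (m e) (a e)
    have hG : MvPolynomial.aeval ξ G ≠ 0 := by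
      rw [Fintype.linearCombination_apply] at hne
      simpa [G, MvPolynomial.aeval_monomial, Algebra.smul_def] using hne
    obtain ⟨x, hx, hxZ⟩ := hspec G hG
    refine hx ?_
    have := ha (v x) ⟨x, hxZ, rfl⟩
    simpa [G, MvPolynomial.eval_monomial, dotProduct, v] using this)
  have h3 := LinearMap.finrank_range_add_finrank_ker (Fintype.linearCombination k c)
  have h4 := Submodule.finrank_mono h1
  have h5 := transRank_union_range_le_finrank hS c
  rw [Fintype.range_linearCombination] at h2 h3
  rw [Module.finrank_fintype_fun_eq_card] at h3
  change _ + Module.finrank k (Submodule.span k _) ≤ _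
  change _ ≤ _ + Module.finrank k (Submodule.span k _) at h5
  omega

/-- A dimension bound of Hopf type: if the points of `Z` separate the polynomial functions of `ξ`
after inverting any one of them, then `dim (A * U) ≥ dim A + dim U - 1` for the span `A` of `ξ`. -/
theorem finrank_add_finrank_le_finrank_mul {ι k E : Type*} [Fintype ι] [Field k] [Field E]
    [Algebra k E] (ξ : ι → E) {Z : Set (ι → k)}
    (hZ : ∀ x ∈ Z, ∀ F : MvPolynomial ι k, MvPolynomial.aeval ξ F = 0 → MvPolynomial.eval x F = 0)
    (hspec' : ∀ g : MvPolynomial ι k, MvPolynomial.aeval ξ g ≠ 0 →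
      ∃ x ∈ Z, MvPolynomial.eval x g ≠ 0) {U : Submodule k E} (hU : U ≠ ⊥)
    (hUfg : U.FG) (hξ : ξ ≠ 0)
    (hUξ : U ≤ Subalgebra.toSubmodule (Algebra.adjoin k (Set.range ξ))) :
    Module.finrank k U + Module.finrank k (Submodule.span k (Set.range ξ)) ≤
    Module.finrank k ↥(Submodule.span k (Set.range ξ) * U) + 1 := by
  classical
  set A := Submodule.span k (Set.range ξ) with hA
  have hpoly : ∀ u ∈ U, ∃ g : MvPolynomial ι k, MvPolynomial.aeval ξ g = u := by
    intro u hu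
    have := hUξ hu
    rw [Subalgebra.mem_toSubmodule, Algebra.adjoin_range_eq_range_aeval] at this
    exact this
  obtain ⟨b0, hb0U, hb0⟩ := (Submodule.ne_bot_iff U).1 hU
  obtain ⟨g0, rfl⟩ := hpoly b0 hb0U
  have hA0 := finrank_range_le_finrank_span {x | x ∈ Z ∧ MvPolynomial.eval x g0 ≠ 0}
    (Fintype.linearCombination k ξ) (by
    intro a ha
    by_contra hne
    -- Multiplying the linear form by `g0` selects points of `Z` at which `g0` does not vanish as
    -- well.
    obtain ⟨x, hxZ, hx⟩ := hspec' ((∑ i, MvPolynomial.C (a i) * MvPolynomial.X i) * g0) (by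
      rw [map_mul]
      refine mul_ne_zero ?_ hb0
      rw [Fintype.linearCombination_apply] at hne
      simpa [Algebra.smul_def] using hne)
    rw [map_mul] at hx
    refine left_ne_zero_of_mul hx ?_
    simpa [dotProduct] using ha x ⟨hxZ, right_ne_zero_of_mul hx⟩)
  rw [Fintype.range_linearCombination] at hA0
  have hfinA : Module.Finite k A := .span_of_finite k (Set.finite_range ξ)
  have hApos : 0 < Module.finrank k A := by
    rw [Module.finrank_pos_iff, Submodule.nontrivial_iff_ne_bot]
    intro h0
    refine hξ (funext fun i => ?_)
    have : ξ i ∈ A := Submodule.subset_span ⟨i, rfl⟩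
    rw [h0] at this
    simpa using this
  obtain ⟨n, hn⟩ : ∃ n, Module.finrank k A = n + 1 := ⟨_, (Nat.succ_pred_eq_of_pos hApos).symm⟩
  obtain ⟨x, hxZ, hxg, hxli⟩ : ∃ x : Fin n → ι → k, (∀ j, x j ∈ Z) ∧
      (∀ j, MvPolynomial.eval (x j) g0 ≠ 0) ∧ LinearIndependent k x := by
    obtain ⟨b, hb, hspan, hli⟩ := exists_linearIndependent k
      {x | x ∈ Z ∧ MvPolynomial.eval x g0 ≠ 0}
    have hbf : Finite b := hli.finite
    have := Fintype.ofFinite b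
    have hcard : n ≤ Fintype.card b := by
      rw [← Set.toFinset_card, ← finrank_span_set_eq_card hli, hspan]
      change Module.finrank k A ≤ _ at hA0
      omega
    let e : Fin n ↪ b := (Fin.castLEEmb hcard).trans (Fintype.equivFin b).symm.toEmbedding
    exact ⟨fun j => e j, fun j => (hb (e j).2).1, fun j => (hb (e j).2).2,
      hli.comp e e.injective⟩
  let T : (ι → k) →ₗ[k] (Fin n → k) := (Matrix.of x).mulVecLin
  have hTrank : Module.finrank k (LinearMap.range T) = n := by
    have : (Matrix.of x).rank = Fintype.card (Fin n) := LinearIndependent.rank_matrix hxli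
    rw [Fintype.card_fin] at this
    exact this
  have hTsurj : Function.Surjective T := by
    rw [← LinearMap.range_eq_top]
    exact Submodule.eq_top_of_finrank_eq (by simp [hTrank])
  -- The n conditions of vanishing at the chosen points cannot exhaust the (n + 1)-dimensional space
  -- of linear forms in `ξ`.
  obtain ⟨a, haT, haξ⟩ : ∃ a, T a = 0 ∧ Fintype.linearCombination k ξ a ≠ 0 := by
    by_contra! h
    have h1 : LinearMap.ker T ≤ LinearMap.ker (Fintype.linearCombination k ξ) :=
      fun a ha => h a ha
    have h2 := Submodule.finrank_mono h1
    have h3 := LinearMap.finrank_range_add_finrank_ker T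
    have h4 := LinearMap.finrank_range_add_finrank_ker (Fintype.linearCombination k ξ)
    rw [Fintype.range_linearCombination] at h4
    change Module.finrank k A + _ = _ at h4
    omega
  choose G hG using hTsurj
  let lin : (ι → k) → MvPolynomial ι k := fun a => ∑ i, MvPolynomial.C (a i) * MvPolynomial.X i
  have hlinξ : ∀ a, MvPolynomial.aeval ξ (lin a) = Fintype.linearCombination k ξ a := by
    intro a
    simp [lin, Fintype.linearCombination_apply, Algebra.smul_def]
  have hlinx : ∀ a j, MvPolynomial.eval (x j) (lin a) = T a j := by
    intro a j
    simp [lin, T, Matrix.mulVec, dotProduct, mul_comm]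
  have hlinA : ∀ a, Fintype.linearCombination k ξ a ∈ A := by
    intro a
    rw [hA, ← Fintype.range_linearCombination]
    exact LinearMap.mem_range_self _ _
  set f := Fintype.linearCombination k ξ a with hf
  set b0 := MvPolynomial.aeval ξ g0 with hb0def
  let g : Fin n → E := fun i => Fintype.linearCombination k ξ (G (Pi.single i 1))
  -- Evaluating an equation f u + (∑ α_i g_i) b0 = 0 at the point x_j isolates α_j, because `f`
  -- vanishes there, the g_i are dual to the points and `g0` is nonzero there. Then f u = 0 gives u
  -- = 0, so this map is injective on a space of dimension dim U + n.
  let Θ : (U × (Fin n → k)) →ₗ[k] ↥(A * U) :=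
    LinearMap.coprod
      ((LinearMap.mulLeft k f).restrict (p := U) (q := A * U)
        fun u hu => Submodule.mul_mem_mul (hlinA a) hu)
      (Fintype.linearCombination k fun i => (⟨g i * b0, Submodule.mul_mem_mul (hlinA _) hb0U⟩ :
        ↥(A * U)))
  have hΘ : ∀ u α, (Θ (u, α) : E) = f * u + (∑ i, algebraMap k E (α i) * g i) * b0 := by
    intro u α
    simp [Θ, Fintype.linearCombination_apply, Finset.sum_mul, Algebra.smul_def, mul_assoc]
    rfl
  have hinj : Function.Injective Θ := by
    rw [injective_iff_map_eq_zero]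
    rintro ⟨u, α⟩ h0
    obtain ⟨gu, hgu⟩ := hpoly u u.2
    have h1 : f * u + (∑ i, algebraMap k E (α i) * g i) * b0 = 0 := by
      rw [← hΘ, h0, Submodule.coe_zero]
    let F : MvPolynomial ι k := lin a * gu +
      (∑ i, MvPolynomial.C (α i) * lin (G (Pi.single i 1))) * g0
    have hFξ : MvPolynomial.aeval ξ F = 0 := by
      simp only [F, map_add, map_mul, map_sum, hlinξ, hgu, MvPolynomial.aeval_C]
      exact h1
    have hα : α = 0 := by
      funext j
      have h2 := hZ _ (hxZ j) F hFξ
      simp only [F, map_add, map_mul, map_sum, hlinx, haT, MvPolynomial.eval_C, hG,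
        Pi.zero_apply, zero_mul, zero_add] at h2
      have h3 := (mul_eq_zero.1 h2).resolve_right (hxg j)
      simpa [Pi.single_apply] using h3
    have hu : u = 0 := by
      subst hα
      simpa [haξ] using h1
    rw [hu, hα]
    rfl
  have hfinU : Module.Finite k U := Module.Finite.iff_fg.2 hUfg
  have hfinAU : Module.Finite k ↥(A * U) :=
    Module.Finite.iff_fg.2 ((Module.Finite.iff_fg.1 hfinA).mul hUfg)
  have := LinearMap.finrank_le_finrank_of_injective hinj
  rw [Module.finrank_prod, Module.finrank_fintype_fun_eq_card, Fintype.card_fin] at this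
  change Module.finrank k U + Module.finrank k A ≤ Module.finrank k ↥(A * U) + 1
  omega

theorem eval_eq_zero_of_le {ι : Type*} {k L : IntermediateField ℚ ℂ} (hkL : k ≤ L) {ξ : ι → ℂ}
    {x : ι → k} (h : ∀ F : MvPolynomial ι L, MvPolynomial.aeval ξ F = 0 →
      MvPolynomial.aeval (fun i => (x i : ℂ)) F = 0) (F : MvPolynomial ι k)
    (hF : MvPolynomial.aeval ξ F = 0) : MvPolynomial.eval x F = 0 := by
  have h1 : ∀ y : ι → ℂ, MvPolynomial.aeval y
      (F.map (IntermediateField.inclusion hkL).toRingHom) = MvPolynomial.aeval y F := by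
    intro y
    have hcomp : (algebraMap L ℂ).comp (IntermediateField.inclusion hkL).toRingHom =
      algebraMap k ℂ := RingHom.ext fun _ => rfl
    rw [MvPolynomial.aeval_def, MvPolynomial.eval₂_map, hcomp, MvPolynomial.aeval_def]
  have h2 := h _ ((h1 ξ).trans hF)
  rw [h1] at h2
  have hx : (fun i => (x i : ℂ)) = algebraMap k ℂ ∘ x := rfl
  rw [hx, MvPolynomial.aeval_algebraMap_apply, MvPolynomial.aeval_eq_eval] at h2
  exact (map_eq_zero (algebraMap k ℂ)).1 h2

/-- The case c = ∅ of specialization: the points over `ratClosure S` are dense in the locus of `ξ`.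
-/
theorem exists_separating_points {ι : Type*} [Finite ι] {S : Set ℂ} (hS : S.Finite) (ξ : ι → ℂ) :
    ∃ Z : Set (ι → ratClosure S),
      (∀ x ∈ Z, ∀ F : MvPolynomial ι (ratClosure S), MvPolynomial.aeval ξ F = 0 →
        MvPolynomial.eval x F = 0) ∧
      (∀ g : MvPolynomial ι (ratClosure S), MvPolynomial.aeval ξ g ≠ 0 →
        ∃ x ∈ Z, MvPolynomial.eval x g ≠ 0) := by
  refine ⟨{x | ∀ F : MvPolynomial ι (ratClosure S), MvPolynomial.aeval ξ F = 0 →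
        MvPolynomial.eval x F = 0}, fun x hx => hx, fun g hg => ?_⟩
  have hle : transRank (S ∪ ∅) + transRank (S ∪ Set.range ξ) ≤
      transRank (S ∪ ∅ ∪ Set.range ξ) + transRank S := by
    rw [Set.union_empty, add_comm]
  obtain ⟨x, hx, hxZ⟩ := exists_specialization hS Set.finite_empty ξ hle g hg
  exact ⟨x, eval_eq_zero_of_le (ratClosure_mono Set.subset_union_left) hxZ, hx⟩

/-- The exponents of the monomials of degree `j` in the variables `ι`. -/
abbrev Expts (ι : Type*) (j : ℕ) : Type _ := {d : ι →₀ ℕ // d.degree = j}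

theorem span_pow_eq_span_monomials {ι : Type*} (k : IntermediateField ℚ ℂ) (ξ : ι → ℂ) (j : ℕ) :
    Submodule.span k (Set.range ξ) ^ j ≤ Submodule.span k
      (Set.range fun e : Expts ι j => e.1.prod (fun i n => ξ i ^ n)) := by
  classical
  rw [Submodule.span_pow]
  refine Submodule.span_mono ?_
  induction j with
  | zero =>
    intro z hz
    rw [pow_zero, Set.mem_one] at hz
    exact ⟨⟨0, by simp⟩, by simp [hz]⟩
  | succ j ih =>
    intro z hz
    rw [pow_succ, Set.mem_mul] at hz
    obtain ⟨x, hx, _, ⟨i, rfl⟩, rfl⟩ := hz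
    obtain ⟨e, rfl⟩ := ih hx
    refine ⟨⟨e.1 + Finsupp.single i 1, by simp [e.2]⟩, ?_⟩
    simp only
    rw [Finsupp.prod_add_index' (by simp) (by intros; rw [pow_add])]
    simp

theorem finite_expts (ι : Type*) [Finite ι] (j : ℕ) : Finite (Expts ι j) := by
  have := Fintype.ofFinite ι
  classical
  refine Finite.of_injective (fun e : Expts ι j => fun i : ι =>
    (⟨e.1 i, Nat.lt_succ_of_le ((Finsupp.le_degree i e.1).trans e.2.le)⟩ : Fin (j + 1))) ?_
  intro a b h
  ext i
  simpa using congrArg Fin.val (congrFun h i)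

instance {ι : Type*} [Finite ι] (j : ℕ) : Finite (Expts ι j) := finite_expts ι j

/-- Each multiplication by the span of `ξ` adds at least `b` dimensions. The bound is the Hilbert
function of a rational normal curve of degree b, minimal for loci spanning ℙ^b. -/
theorem mul_finrank_le_finrank_span_monomials {ι : Type*} [Finite ι] {S : Set ℂ} (hS : S.Finite)
    {ξ : ι → ℂ} (hξ : ξ ≠ 0) {b : ℕ}
    (hb : b + 1 ≤ Module.finrank (ratClosure S) (Submodule.span (ratClosure S) (Set.range ξ)))
    (j : ℕ) : b * j + 1 ≤ Module.finrank (ratClosure S) (Submodule.span (ratClosure S)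
      (Set.range fun e : Expts ι j => e.1.prod (fun i n => ξ i ^ n))) := by
  set A := Submodule.span (ratClosure S) (Set.range ξ) with hA
  have hAfg : A.FG := Submodule.fg_span (Set.finite_range ξ)
  have := Fintype.ofFinite ι
  obtain ⟨Z, hZ, hZ'⟩ := exists_separating_points hS ξ
  obtain ⟨i, hi⟩ : ∃ i, ξ i ≠ 0 := by
    by_contra! h
    exact hξ (funext h)
  have hne : ∀ j, A ^ j ≠ ⊥ := by
    intro j
    rw [Submodule.ne_bot_iff]
    exact ⟨ξ i ^ j, Submodule.pow_mem_pow _ (Submodule.subset_span (Set.mem_range_self i)) _,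
      pow_ne_zero _ hi⟩
  have hle : ∀ j, A ^ j ≤ Subalgebra.toSubmodule
      (Algebra.adjoin (ratClosure S) (Set.range ξ)) := by
    intro j
    refine (span_pow_eq_span_monomials _ ξ j).trans (Submodule.span_le.2 ?_)
    rintro _ ⟨e, rfl⟩
    exact Subalgebra.prod_mem _ fun i _ => Subalgebra.pow_mem _
      (Algebra.subset_adjoin (Set.mem_range_self _)) _
  have key : b * j + 1 ≤ Module.finrank (ratClosure S) ↥(A ^ j) := by
    induction j with
    | zero =>
      rw [mul_zero, zero_add, Nat.one_le_iff_ne_zero, ← Nat.pos_iff_ne_zero]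
      have : Module.Finite (ratClosure S) ↥(A ^ 0) := Module.Finite.iff_fg.2 (hAfg.pow 0)
      rw [Module.finrank_pos_iff, Submodule.nontrivial_iff_ne_bot]
      exact hne 0
    | succ j ih =>
      have h := finrank_add_finrank_le_finrank_mul ξ hZ hZ' (hne j) (hAfg.pow j) hξ (hle j)
      rw [pow_succ']
      change _ + Module.finrank _ A ≤ Module.finrank _ ↥(A * A ^ j) + 1 at h
      have : b * (j + 1) = b * j + b := by ring
      omega
  have hfin : Module.Finite (ratClosure S) (Submodule.span (ratClosure S)
      (Set.range fun e : Expts ι j => e.1.prod (fun i n => ξ i ^ n))) :=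
    .span_of_finite _ (Set.finite_range _)
  refine key.trans (Submodule.finrank_mono ?_)
  exact span_pow_eq_span_monomials _ ξ j

theorem natCard_expts (ι : Type*) [Finite ι] (j : ℕ) :
    Nat.card (Expts ι j) = (Nat.card ι).multichoose j := by
  classical
  have := Fintype.ofFinite ι
  have e : Sym ι j ≃ Expts ι j :=
    (Sym.equivNatSum ι j).trans (Equiv.subtypeEquivRight fun d => by
      rw [Finsupp.degree_eq_sum, Finsupp.sum_fintype _ _ (fun _ => rfl)]; rfl)
  rw [← Nat.card_congr e, Nat.card_eq_fintype_card, Sym.card_sym_eq_multichoose,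
    Nat.card_eq_fintype_card]

theorem Nat.multichoose_mono_left {d e : ℕ} (h : d ≤ e) (j : ℕ) :
    d.multichoose j ≤ e.multichoose j := by
  rw [Nat.multichoose_eq, Nat.multichoose_eq]
  exact Nat.choose_le_choose _ (by omega)

/-- Among the coordinates of `ξ` there are at least `d` algebraically independent ones, and their
distinct monomials are linearly independent. -/
theorem multichoose_le_finrank_span_monomials {ι : Type*} [Finite ι] {S : Set ℂ} (hS : S.Finite)
    {ξ : ι → ℂ} {d : ℕ} (h : transRank S + d ≤ transRank (S ∪ Set.range ξ)) (j : ℕ) :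
    d.multichoose j ≤ Module.finrank (ratClosure S) (Submodule.span (ratClosure S)
      (Set.range fun e : Expts ι j => e.1.prod (fun i n => ξ i ^ n))) := by
  obtain ⟨J, hJξ, hξJ, hJcard⟩ := exists_finite_basis_over hS (Set.finite_range ξ)
  have hJf : J.Finite := (Set.finite_range ξ).subset hJξ
  have := hJf.to_subtype
  have hind : AlgebraicIndependent (ratClosure S) ((↑) : J → ℂ) := by
    refine algebraicIndependent_ratClosure hS hJf ?_
    rw [← hJcard]
    exact transRank_le_of_subset_ratClosure (hS.union hJf) (hS.union (Set.finite_range ξ))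
      (Set.union_subset (Set.subset_union_left.trans (subset_ratClosure _)) hξJ)
  choose σ hσ using fun z : J => hJξ z.2
  have heq : (fun e : Expts J j => e.1.prod (fun z n => (z : ℂ) ^ n)) =
      (MvPolynomial.aeval (R := ratClosure S) ((↑) : J → ℂ)).toLinearMap ∘
        (MvPolynomial.basisMonomials J (ratClosure S)) ∘ fun e : Expts J j => e.1 := by
    ext e
    simp [MvPolynomial.aeval_monomial]
  have hli : LinearIndependent (ratClosure S)
      (fun e : Expts J j => e.1.prod (fun z n => (z : ℂ) ^ n)) := by
    rw [heq]
    exact ((MvPolynomial.basisMonomials J (ratClosure S)).linearIndependent.comp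
      (fun e : Expts J j => e.1) Subtype.val_injective).map' _ (LinearMap.ker_eq_bot.2 hind)
  have := Fintype.ofFinite (Expts J j)
  have hfg : Module.Finite (ratClosure S) (Submodule.span (ratClosure S)
      (Set.range fun e : Expts ι j => e.1.prod (fun i n => ξ i ^ n))) :=
    Module.Finite.span_of_finite _ (Set.finite_range _)
  calc d.multichoose j ≤ J.ncard.multichoose j := Nat.multichoose_mono_left (by omega) j
    _ = Fintype.card (Expts J j) := by
      rw [← Nat.card_coe_set_eq, ← natCard_expts, Nat.card_eq_fintype_card]
    _ = Module.finrank (ratClosure S) (Submodule.span (ratClosure S)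
          (Set.range fun e : Expts J j => e.1.prod (fun z n => (z : ℂ) ^ n))) :=
      (finrank_span_eq_card hli).symm
    _ ≤ _ := by
      refine Submodule.finrank_mono (Submodule.span_mono ?_)
      rintro _ ⟨e, rfl⟩
      refine ⟨⟨e.1.mapDomain σ, by rw [Finsupp.degree_mapDomain, e.2]⟩, ?_⟩
      dsimp only
      rw [Finsupp.prod_mapDomain_index (fun _ => pow_zero _) (fun _ _ _ => pow_add _ _ _)]
      simp only [hσ]

/-! ### Linear spans under field extension -/

theorem finrank_span_le_of_subset_span {k : Type*} {V : Type*} [Field k] [AddCommGroup V]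
    [Module k V] {B X : Set V} (hB : B.Finite) (h : X ⊆ Submodule.span k B) :
    Module.finrank k (Submodule.span k X) ≤ B.ncard := by
  have := hB.fintype
  have hfin : Module.Finite k (Submodule.span k B) := Module.Finite.span_of_finite _ hB
  refine (Submodule.finrank_mono (Submodule.span_le.2 h)).trans ?_
  rw [Set.ncard_eq_toFinset_card']
  exact finrank_span_le_card B

theorem finrank_span_le_of_le {k L : IntermediateField ℚ ℂ} (hkL : k ≤ L) {X : Set ℂ}
    (hX : X.Finite) :
    Module.finrank L (Submodule.span L X) ≤ Module.finrank k (Submodule.span k X) := by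
  obtain ⟨B, hBX, hBs, hBli⟩ := exists_linearIndependent k X
  have hBf := hX.subset hBX
  have hcard : B.ncard = Module.finrank k (Submodule.span k X) := by
    have := hBf.fintype
    rw [← hBs, finrank_span_set_eq_card hBli, Set.ncard_eq_toFinset_card']
  rw [← hcard]
  refine finrank_span_le_of_subset_span hBf fun x hx => ?_
  have hx' : x ∈ Submodule.span k B := by rw [hBs]; exact Submodule.subset_span hx
  refine Submodule.span_induction (p := fun z _ => z ∈ Submodule.span L B)
    (fun x hx => Submodule.subset_span hx) (zero_mem _) (fun _ _ _ _ => add_mem) ?_ hx'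
  intro a x _ hx
  exact Submodule.smul_mem _ (⟨a, hkL a.2⟩ : L) hx

/-- These are affine coordinates on a Grassmannian. A basis over the small field has w elements, f
of which form a basis over the large field; the other w - f are recovered from f coordinates each.
-/
theorem exists_extension_finrank_span_le {S T X : Set ℂ} (hST : S ⊆ T) (hX : X.Finite) {f w : ℕ}
    (hf : Module.finrank (ratClosure T) (Submodule.span (ratClosure T) X) = f)
    (hw : Module.finrank (ratClosure S) (Submodule.span (ratClosure S) X) = w) :
    ∃ Λ : Set ℂ, Λ.Finite ∧ Λ ⊆ ratClosure T ∧ Λ.ncard ≤ (w - f) * f ∧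
      Module.finrank (ratClosure (S ∪ Λ)) (Submodule.span (ratClosure (S ∪ Λ)) X) ≤ f := by
  classical
  obtain ⟨A, hAX, hAs, hAli⟩ := exists_linearIndependent (ratClosure S) X
  obtain ⟨B, hBA, hBs, hBli⟩ := exists_linearIndependent (ratClosure T) A
  have hAf := hX.subset hAX
  have hBf := hAf.subset hBA
  have hAcard : A.ncard = w := by
    have := hAf.fintype
    rw [← hw, ← hAs, finrank_span_set_eq_card hAli, Set.ncard_eq_toFinset_card']
  have hXA : X ⊆ Submodule.span (ratClosure T) A := by
    intro x hx
    have hx' : x ∈ Submodule.span (ratClosure S) A := by rw [hAs]; exact Submodule.subset_span hx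
    refine Submodule.span_induction (p := fun z _ => z ∈ Submodule.span (ratClosure T) A)
      (fun x hx => Submodule.subset_span hx) (zero_mem _) (fun _ _ _ _ => add_mem) ?_ hx'
    intro a x _ hx
    exact Submodule.smul_mem _ (⟨a, ratClosure_mono hST a.2⟩ : ratClosure T) hx
  have hBcard : B.ncard = f := by
    have := hBf.fintype
    rw [← hf, ← (Submodule.span_eq_span hXA (hAX.trans Submodule.subset_span)).symm, ← hBs,
      finrank_span_set_eq_card hBli, Set.ncard_eq_toFinset_card']
  have hex : ∀ a : ↥(A \ B), ∃ g : ℂ → ratClosure T, ∑ b ∈ hBf.toFinset, g b • b = (a : ℂ) := by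
    intro a
    have ha : (a : ℂ) ∈ Submodule.span (ratClosure T) (hBf.toFinset : Set ℂ) := by
      rw [hBf.coe_toFinset, hBs]; exact Submodule.subset_span a.2.1
    obtain ⟨g, -, hg⟩ := Submodule.mem_span_finset.1 ha
    exact ⟨g, hg⟩
  choose g hg using hex
  have := (hAf.subset (Set.sdiff_subset (t := B))).to_subtype
  have := hBf.to_subtype
  let c : ↥(A \ B) × B → ℂ := fun p => g p.1 p.2
  refine ⟨Set.range c, Set.finite_range c, ?_, ?_, ?_⟩
  · rintro _ ⟨p, rfl⟩
    exact (g p.1 p.2).2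
  · rw [← hAcard, ← hBcard, ← Set.ncard_sdiff hBA hBf, ← Nat.card_coe_set_eq,
      ← Nat.card_coe_set_eq B, ← Nat.card_coe_set_eq, ← Nat.card_prod]
    exact Finite.card_range_le c
  · rw [← hBcard]
    set K := ratClosure (S ∪ Set.range c)
    refine finrank_span_le_of_subset_span hBf fun x hx => ?_
    have hx' : x ∈ Submodule.span (ratClosure S) A := by rw [hAs]; exact Submodule.subset_span hx
    refine Submodule.span_induction (p := fun z _ => z ∈ Submodule.span K B)
      ?_ (zero_mem _) (fun _ _ _ _ => add_mem) ?_ hx'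
    · intro a ha
      by_cases haB : a ∈ B
      · exact Submodule.subset_span haB
      · rw [show a = _ from (hg ⟨a, ha, haB⟩).symm]
        refine Submodule.sum_mem _ fun b hb => ?_
        have hb' : b ∈ B := hBf.mem_toFinset.1 hb
        exact Submodule.smul_mem _ (⟨g ⟨a, ha, haB⟩ b, subset_ratClosure _
          (Or.inr ⟨(⟨a, ha, haB⟩, ⟨b, hb'⟩), rfl⟩)⟩ : K) (Submodule.subset_span hb')
    · intro a x _ hx
      exact Submodule.smul_mem _ (⟨a, ratClosure_mono Set.subset_union_left a.2⟩ : K) hx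

theorem Nat.choose_two_le_choose {N k : ℕ} (hk : 2 ≤ k) (hkN : k + 2 ≤ N) :
    N.choose 2 ≤ N.choose k := by
  induction N generalizing k with
  | zero => omega
  | succ N ih =>
    obtain ⟨k, rfl⟩ : ∃ k', k = k' + 1 := ⟨k - 1, by omega⟩
    have h1 : N ≤ N.choose k := by
      rcases Nat.lt_or_ge (k + 2) N with h | h
      · rcases Nat.lt_or_ge k 2 with hk1 | hk1
        · obtain rfl : k = 1 := by omega
          simp
        · have h3 := ih hk1 (by omega)
          refine le_trans ?_ h3
          rw [Nat.choose_two_right, Nat.le_div_iff_mul_le (by norm_num)]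
          exact Nat.mul_le_mul_left _ (by omega)
      · rcases Nat.lt_or_ge k 2 with hk1 | hk1
        · obtain rfl : k = 1 := by omega
          simp
        · obtain rfl : N = k + 2 := by omega
          have h3 := ih hk1 le_rfl
          refine le_trans ?_ h3
          rw [Nat.choose_two_right, Nat.le_div_iff_mul_le (by norm_num)]
          exact Nat.mul_le_mul_left _ (by omega)
    rcases Nat.lt_or_ge (k + 2) N with h | h
    · have h2 := ih (k := k + 1) hk (by omega)
      rw [Nat.choose_succ_succ' N k, Nat.choose_succ_succ' N 1, Nat.choose_one_right]
      exact add_le_add h1 h2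
    · obtain rfl : N = k + 2 := by omega
      rw [← Nat.choose_symm_of_eq_add (a := k + 1) (b := 2) (by omega)]

/-! ### Adjoining the forms degree by degree -/

section Stages

variable {ι : Type*}

/-- The set `B` together with the coefficients `c j` of forms of degrees `2, …, t + 1`. -/
def coeffStage (B : Set ℂ) (c : (j : ℕ) → Expts ι j → ℂ) : ℕ → Set ℂ
  | 0 => B
  | t + 1 => coeffStage B c t ∪ Set.range (c (t + 2))

theorem finite_coeffStage [Finite ι] {B : Set ℂ} (hB : B.Finite)
    (c : (j : ℕ) → Expts ι j → ℂ) (t : ℕ) :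
    (coeffStage B c t).Finite := by
  induction t with
  | zero => exact hB
  | succ t ih => exact ih.union (Set.finite_range _)

theorem coeffStage_mono (B : Set ℂ) (c : (j : ℕ) → Expts ι j → ℂ) : Monotone (coeffStage B c) :=
  monotone_nat_of_le_succ fun _ => Set.subset_union_left

theorem coeffStage_union (B Λ : Set ℂ) (c : (j : ℕ) → Expts ι j → ℂ) (t : ℕ) :
    coeffStage (B ∪ Λ) c t = coeffStage B c t ∪ Λ := by
  induction t with
  | zero => rfl
  | succ t ih => rw [coeffStage, ih, coeffStage, Set.union_right_comm]

theorem transRank_coeffStage_succ_le [Finite ι] {B : Set ℂ} (hB : B.Finite)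
    (c : (j : ℕ) → Expts ι j → ℂ)
    (t : ℕ) : transRank (coeffStage B c (t + 1)) ≤
      transRank (coeffStage B c t) + Nat.card (Expts ι (t + 2)) := by
  refine (transRank_union_le (finite_coeffStage hB c t) (Set.finite_range _)).trans ?_
  gcongr
  rw [← Nat.card_coe_set_eq]
  exact Finite.card_range_le _

/-- The hypothesis `h` says that the transcendence degree of `ξ` does not drop when the form of
degree t + 2 is adjoined. -/
theorem transRank_coeffStage_succ_add_le [Finite ι] {B : Set ℂ} (hB : B.Finite)
    (c : (j : ℕ) → Expts ι j → ℂ) (ξ : ι → ℂ) {t : ℕ}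
    (h0 : ∑ᶠ e, c (t + 2) e * e.1.prod (fun i n => ξ i ^ n) = 0)
    (h : transRank (coeffStage B c (t + 1)) + transRank (coeffStage B c t ∪ Set.range ξ) ≤
      transRank (coeffStage B c (t + 1) ∪ Set.range ξ) + transRank (coeffStage B c t)) :
    transRank (coeffStage B c (t + 1)) + Module.finrank (ratClosure (coeffStage B c t))
      (Submodule.span (ratClosure (coeffStage B c t))
        (Set.range fun e : Expts ι (t + 2) => e.1.prod (fun i n => ξ i ^ n))) ≤
      transRank (coeffStage B c t) + Nat.card (Expts ι (t + 2)) := by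
  have := Fintype.ofFinite (Expts ι (t + 2))
  rw [finsum_eq_sum_of_fintype] at h0
  rw [Nat.card_eq_fintype_card]
  exact transRank_union_range_add_finrank_le (finite_coeffStage hB c t) (c (t + 2)) ξ
    (fun e => e.1) h0 h

/-- If `R` grows by at most `N t` at the step `t`, and by less when `D` does not drop there. -/
theorem add_sum_le_of_antitone_steps {b : ℕ} {R D N : ℕ → ℕ} {n : ℕ}
    (hR : ∀ t < n, R (t + 1) ≤ R t + N t) (hD : ∀ t < n, D (t + 1) ≤ D t)
    (hRD : ∀ t < n, D (t + 1) = D t → R (t + 1) + (b * (t + 2) + 1) ≤ R t + N t) :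
    R n + ∑ i ∈ Finset.range (n + D n - D 0), (b * (i + 2) + 1) ≤
      R 0 + ∑ i ∈ Finset.range n, N i := by
  have hD0 : ∀ t ≤ n, D t ≤ D 0 := by
    intro t ht
    induction t with
    | zero => exact le_rfl
    | succ t ih => exact (hD t ht).trans (ih (by omega))
  -- At least t + D t - D 0 of the first t steps are without a drop. The saving grows with the step,
  -- so the worst case puts those steps first; truncated subtraction leaves an empty sum when
  -- nothing is guaranteed.
  suffices ∀ t ≤ n, R t + ∑ i ∈ Finset.range (t + D t - D 0), (b * (i + 2) + 1) ≤
      R 0 + ∑ i ∈ Finset.range t, N i from this n le_rfl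
  intro t ht
  induction t with
  | zero => simp
  | succ t ih =>
    have ih := ih (by omega)
    rw [Finset.sum_range_succ N]
    have h0 := hD0 t (by omega)
    rcases (hD t ht).eq_or_lt with h | h
    · have h1 := hRD t ht h
      rw [h]
      rcases Nat.lt_or_ge (t + D t) (D 0) with h2 | h2
      · rw [show t + 1 + D t - D 0 = 0 by omega]
        rw [show t + D t - D 0 = 0 by omega] at ih
        simp only [Finset.range_zero, Finset.sum_empty] at ih ⊢
        omega
      · rw [show t + 1 + D t - D 0 = (t + D t - D 0) + 1 by omega, Finset.sum_range_succ]
        have h3 : b * (t + D t - D 0 + 2) ≤ b * (t + 2) := Nat.mul_le_mul_left _ (by omega)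
        omega
    · have h1 := hR t ht
      have h2 : ∑ i ∈ Finset.range (t + 1 + D (t + 1) - D 0), (b * (i + 2) + 1) ≤
          ∑ i ∈ Finset.range (t + D t - D 0), (b * (i + 2) + 1) :=
        Finset.sum_le_sum_of_subset (Finset.range_mono (by omega))
      omega

theorem two_mul_sum_range_linear (b m : ℕ) :
    2 * ∑ i ∈ Finset.range m, (b * (i + 2) + 1) = b * m * (m + 3) + 2 * m := by
  induction m with
  | zero => simp
  | succ m ih => rw [Finset.sum_range_succ, mul_add, ih]; ring

/-- The term 2(n - b)(b + 1) pays for the choice of the linear span. With n = 2b + 1 + s, b = a + 1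
and the least admissible m, the difference of the two sides is a polynomial in a and s with
nonnegative coefficients. -/
theorem linear_savings_bound {b n : ℕ} (hb : 1 ≤ b) (h : 2 * b < n) {m : ℕ} (hm : n + 1 ≤ m + b) :
    n * n + 6 + 2 * ((n - b) * (b + 1)) ≤
      2 * ∑ i ∈ Finset.range m, (b * (i + 2) + 1) + n := by
  obtain ⟨s, rfl⟩ : ∃ s, n = 2 * b + 1 + s := ⟨n - (2 * b + 1), by omega⟩
  have h1 : ∑ i ∈ Finset.range (b + 2 + s), (b * (i + 2) + 1) ≤
      ∑ i ∈ Finset.range m, (b * (i + 2) + 1) :=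
    Finset.sum_le_sum_of_subset (Finset.range_mono (by omega))
  have h2 := two_mul_sum_range_linear b (b + 2 + s)
  have h3 : 2 * b + 1 + s - b = b + 1 + s := by omega
  rw [h3]
  refine le_trans ?_ (Nat.add_le_add_right (Nat.mul_le_mul_left 2 h1) _)
  rw [h2]
  obtain ⟨a, rfl⟩ : ∃ a, b = a + 1 := ⟨b - 1, by omega⟩
  have ha := Nat.zero_le (a ^ 3 + s * a ^ 2 + s ^ 2 * a)
  nlinarith [Nat.zero_le (a ^ 3), Nat.zero_le (s * a ^ 2), Nat.zero_le (s ^ 2 * a),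
    Nat.zero_le (s * a), Nat.zero_le (a ^ 2)]

/-- The saving is C(n,2) + 3, doubled to avoid division. Let b + 1 be the dimension of the span of
`ξ` over the final field. For 2b < n the span is fixed in advance and the linear bounds bj + 1 are
summed; otherwise a single step is used. -/
theorem two_mul_transRank_coeffStage_le [Finite ι] {n : ℕ} (hn : 3 ≤ n) {B : Set ℂ} (hB : B.Finite)
    (c : (j : ℕ) → Expts ι j → ℂ) {ξ : ι → ℂ} (hξ : ξ ≠ 0)
    (h0 : ∀ t < n, ∑ᶠ e, c (t + 2) e * e.1.prod (fun i n => ξ i ^ n) = 0)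
    (hw : Module.finrank (ratClosure B) (Submodule.span (ratClosure B) (Set.range ξ)) ≤ n + 1)
    (h2 : transRank (coeffStage B c n) + 2 ≤ transRank (coeffStage B c n ∪ Set.range ξ)) :
    2 * transRank (coeffStage B c n) + n * n + 6 ≤
      2 * (transRank B + ∑ t ∈ Finset.range n, Nat.card (Expts ι (t + 2))) + n := by
  have hξf := Set.finite_range ξ
  set N : ℕ → ℕ := fun t => Nat.card (Expts ι (t + 2)) with hN
  set f := Module.finrank (ratClosure (coeffStage B c n))
    (Submodule.span (ratClosure (coeffStage B c n)) (Set.range ξ)) with hf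
  have hf2 : 2 ≤ f := by
    have := transRank_union_range_le_finrank (finite_coeffStage hB c n) ξ
    omega
  obtain ⟨b, hb⟩ : ∃ b, f = b + 1 := ⟨f - 1, by omega⟩
  have hfin : ∀ {B' : Set ℂ}, B'.Finite → ∀ t, (coeffStage B' c t).Finite :=
    fun h t => finite_coeffStage h c t
  have hsub : ∀ {B' : Set ℂ}, B'.Finite → ∀ t,
      transRank (coeffStage B' c (t + 1) ∪ Set.range ξ) + transRank (coeffStage B' c t) ≤
      transRank (coeffStage B' c t ∪ Set.range ξ) + transRank (coeffStage B' c (t + 1)) :=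
    fun h t => transRank_submodular (hfin h _) hξf (coeffStage_mono _ _ (Nat.le_succ t))
  have hle : ∀ {B' : Set ℂ}, B'.Finite → ∀ t,
      transRank (coeffStage B' c t) ≤ transRank (coeffStage B' c t ∪ Set.range ξ) :=
    fun h t => transRank_mono ((hfin h t).union hξf) Set.subset_union_left
  rcases Nat.lt_or_ge (2 * b) n with hbn | hbn
  -- Adjoining Λ makes the span of `ξ` have dimension at most b + 1 from the start, so the
  -- transcendence degree of `ξ` falls from at most b + 1 to at least 2. At least n + 1 - b steps
  -- are thus without a drop. As Λ lies in the final closure, the final ranks are unchanged.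
  · obtain ⟨Λ, hΛf, hΛ, hΛc, hΛw⟩ := exists_extension_finrank_span_le (X := Set.range ξ)
      (coeffStage_mono B c (Nat.zero_le n)) hξf hf.symm rfl
    have hB' : (B ∪ Λ).Finite := hB.union hΛf
    have hΛc' : Λ.ncard ≤ (n - b) * (b + 1) := by
      refine hΛc.trans ?_
      rw [hb]
      have hw' : Module.finrank (ratClosure (coeffStage B c 0))
        (Submodule.span (ratClosure (coeffStage B c 0)) (Set.range ξ)) ≤ n + 1 := hw
      exact Nat.mul_le_mul_right _ (by omega)
    have hRn : transRank (coeffStage (B ∪ Λ) c n) = transRank (coeffStage B c n) := by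
      rw [coeffStage_union]
      exact transRank_union_of_subset hΛ
    have hXn : transRank (coeffStage (B ∪ Λ) c n ∪ Set.range ξ) =
        transRank (coeffStage B c n ∪ Set.range ξ) := by
      rw [coeffStage_union, Set.union_right_comm]
      exact transRank_union_of_subset (hΛ.trans (ratClosure_mono Set.subset_union_left))
    have hR0 : transRank (B ∪ Λ) ≤ transRank B + Λ.ncard := transRank_union_le hB hΛf
    have hD0 : transRank (B ∪ Λ ∪ Set.range ξ) ≤ transRank (B ∪ Λ) + (b + 1) := by
      refine (transRank_union_range_le_finrank hB' ξ).trans ?_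
      gcongr
      rw [← hb]
      exact hΛw
    have key := add_sum_le_of_antitone_steps (b := b) (n := n) (N := N)
      (R := fun t => transRank (coeffStage (B ∪ Λ) c t))
      (D := fun t => transRank (coeffStage (B ∪ Λ) c t ∪ Set.range ξ) -
        transRank (coeffStage (B ∪ Λ) c t))
      (fun t _ => transRank_coeffStage_succ_le hB' c t)
      (fun t _ => by
        have h1 := hsub hB' t
        have h2 := hle hB' t
        omega)
      (fun t ht hDt => by
        have h1 := hle hB' t
        have h3 := hle hB' (t + 1)
        have h4 := transRank_coeffStage_succ_add_le hB' c ξ (h0 t ht) (by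
          omega)
        refine le_trans ?_ h4
        gcongr
        refine mul_finrank_le_finrank_span_monomials (hfin hB' t) hξ ?_ _
        rw [← hb, hf]
        refine finrank_span_le_of_le (ratClosure_le ?_) hξf
        refine (coeffStage_mono _ _ ht.le).trans ?_
        rw [coeffStage_union]
        exact Set.union_subset (subset_ratClosure _) hΛ)
    have hlin := linear_savings_bound (b := b) (n := n) (by omega) hbn
      (m := n + (transRank (coeffStage (B ∪ Λ) c n ∪ Set.range ξ) -
        transRank (coeffStage (B ∪ Λ) c n)) - (transRank (coeffStage (B ∪ Λ) c 0 ∪ Set.range ξ) -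
        transRank (coeffStage (B ∪ Λ) c 0)))
      (by rw [hRn, hXn]; simp only [coeffStage]; omega)
    set Sg := ∑ i ∈ Finset.range (n + (transRank (coeffStage (B ∪ Λ) c n ∪ Set.range ξ) -
        transRank (coeffStage (B ∪ Λ) c n)) - (transRank (coeffStage (B ∪ Λ) c 0 ∪ Set.range ξ) -
        transRank (coeffStage (B ∪ Λ) c 0))), (b * (i + 2) + 1)
    simp only [coeffStage] at key
    rw [hRn] at key
    change 2 * transRank (coeffStage B c n) + n * n + 6 ≤
      2 * (transRank B + ∑ i ∈ Finset.range n, N i) + n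
    omega
  · set R : ℕ → ℕ := fun t => transRank (coeffStage B c t) with hR
    set X : ℕ → ℕ := fun t => transRank (coeffStage B c t ∪ Set.range ξ) with hX
    have hRs : ∀ t, R (t + 1) ≤ R t + N t := fun t => transRank_coeffStage_succ_le hB c t
    have hXs : ∀ t, X (t + 1) + R t ≤ X t + R (t + 1) := hsub hB
    have hRX : ∀ t, R t ≤ X t := hle hB
    have hX0 : X 0 ≤ R 0 + (n + 1) :=
      (transRank_union_range_le_finrank hB ξ).trans (Nat.add_le_add_left hw _)
    have hsum : ∀ s u, R (s + u) ≤ R s + ∑ i ∈ Finset.range u, N (s + i) := by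
      intro s u
      induction u with
      | zero => simp
      | succ u ih =>
        rw [Finset.sum_range_succ]
        have := hRs (s + u)
        rw [← add_assoc s u 1]
        omega
    -- If every step at which `ξ` keeps its transcendence degree started below n + 1 - z, then going
    -- back from the final value, which is at least 2, each step would have to be a drop. The
    -- initial value would be at least n + 2, whereas `ξ` spans at most n + 1 dimensions.
    obtain ⟨z, hzn, hz, hDz⟩ : ∃ z < n, X z + R (z + 1) ≤ X (z + 1) + R z ∧
        R z + (n + 1 - z) ≤ X z := by
      by_contra! hcon
      have : ∀ u ≤ n, R (n - u) + (u + 2) ≤ X (n - u) := by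
        intro u hu
        induction u with
        | zero => simpa [hR, hX] using h2
        | succ u ih =>
          have ih := ih (by omega)
          have h3 := hcon (n - (u + 1)) (by omega)
          rw [show n - (u + 1) + 1 = n - u by omega] at h3
          have h4 := hXs (n - (u + 1))
          rw [show n - (u + 1) + 1 = n - u by omega] at h4
          have h5 := hRX (n - (u + 1))
          have h6 := hRX (n - u)
          by_contra hlt
          have := h3 (by omega)
          omega
      have h3 := this n le_rfl
      rw [Nat.sub_self] at h3
      omega
    have h4 := transRank_coeffStage_succ_add_le hB c ξ (h0 z hzn) (by
      have := hz
      simp only [hR, hX] at this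
      omega)
    set H := Module.finrank (ratClosure (coeffStage B c z))
      (Submodule.span (ratClosure (coeffStage B c z))
        (Set.range fun e : Expts ι (z + 2) => e.1.prod (fun i n => ξ i ^ n)))
    have hH : n * n + 6 ≤ 2 * H + n := by
      -- For z + 1 < n the monomial count C(n+2, z+2) is at least C(n+2, 2). For z = n - 1 that
      -- count is too small, and the linear bound b(n + 1) + 1 with 2b ≥ n is used.
      rcases Nat.lt_or_ge (z + 1) n with hz1 | hz1
      · have h5 : (n + 1 - z).multichoose (z + 2) ≤ H :=
          multichoose_le_finrank_span_monomials (hfin hB z) hDz (z + 2)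
        rw [Nat.multichoose_eq, show n + 1 - z + (z + 2) - 1 = n + 2 by omega] at h5
        have h6 := (Nat.choose_two_le_choose (N := n + 2) (k := z + 2) (by omega)
          (by omega)).trans h5
        rw [Nat.choose_two_right, Nat.div_le_iff_le_mul_add_pred (by norm_num)] at h6
        rw [show n + 2 - 1 = n + 1 by omega] at h6
        nlinarith
      · obtain rfl : n = z + 1 := by omega
        have h5 : b * (z + 2) + 1 ≤ H := by
          refine mul_finrank_le_finrank_span_monomials (hfin hB z) hξ ?_ _
          rw [← hb, hf]
          exact finrank_span_le_of_le (ratClosure_mono (coeffStage_mono _ _ hzn.le)) hξf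
        nlinarith
    have h5 := hsum 0 z
    have h6 := hsum (z + 1) (n - (z + 1))
    have h7 : ∑ i ∈ Finset.range n, N i = ∑ i ∈ Finset.range z, N i + N z +
        ∑ i ∈ Finset.range (n - (z + 1)), N (z + 1 + i) := by
      rw [← Finset.sum_range_succ, ← Finset.sum_range_add]
      congr 2
      omega
    rw [show z + 1 + (n - (z + 1)) = n by omega] at h6
    simp only [zero_add] at h5
    have h8 : R (z + 1) + H ≤ R z + N z := h4
    have h9 : R 0 = transRank B := rfl
    have h10 : R n = transRank (coeffStage B c n) := rfl
    change 2 * R n + n * n + 6 ≤ 2 * (transRank B + ∑ i ∈ Finset.range n, N i) + n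
    omega

end Stages

/-! ### Transcendence degree of degenerate local equations -/

theorem eval_homogeneousComponent_eq_finsum {ι : Type*} [Finite ι] (g : MvPolynomial ι ℂ) (j : ℕ)
    (ξ : ι → ℂ) : MvPolynomial.eval ξ (MvPolynomial.homogeneousComponent j g) =
      ∑ᶠ e : Expts ι j, g.coeff e.1 * e.1.prod (fun i n => ξ i ^ n) := by
  classical
  have := Fintype.ofFinite (Expts ι j)
  have := Fintype.ofFinite ι
  rw [finsum_eq_sum_of_fintype, MvPolynomial.homogeneousComponent_apply, map_sum]
  simp only [MvPolynomial.eval_monomial]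
  have h1 : ∑ d ∈ g.support with d.degree = j, g.coeff d * d.prod (fun i n => ξ i ^ n) =
      ∑ d ∈ (Finset.univ : Finset (Expts ι j)).map ⟨Subtype.val, Subtype.val_injective⟩,
        g.coeff d * d.prod (fun i n => ξ i ^ n) := by
    refine Finset.sum_subset (fun d hd => ?_) (fun d hd hd' => ?_)
    · simp only [Finset.mem_filter] at hd
      simp [hd.2]
    · have hdj : d.degree = j := by
        obtain ⟨e, -, rfl⟩ := Finset.mem_map.1 hd
        exact e.2
      have : g.coeff d = 0 := by
        by_contra h
        exact hd' (Finset.mem_filter.2 ⟨MvPolynomial.mem_support_iff.2 h, hdj⟩)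
      rw [this, zero_mul]
  rw [h1, Finset.sum_map]
  rfl

theorem MvPolynomial.IsHomogeneous.eval_smul {σ R : Type*} [CommSemiring R] {F : MvPolynomial σ R}
    {n : ℕ} (hF : F.IsHomogeneous n) (t : R) (x : σ → R) :
    MvPolynomial.eval (t • x) F = t ^ n * MvPolynomial.eval x F := by
  rw [MvPolynomial.eval_eq, MvPolynomial.eval_eq, Finset.mul_sum]
  refine Finset.sum_congr rfl fun d hd => ?_
  have hdn : d.degree = n := by
    rw [Finsupp.degree_eq_weight_one]
    exact hF (MvPolynomial.mem_support_iff.1 hd)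
  simp only [Pi.smul_apply, smul_eq_mul, mul_pow]
  rw [Finset.prod_mul_distrib, Finset.prod_pow_eq_pow_sum, ← Finsupp.degree_apply, hdn]
  ring

/-- A hyperplane with coefficients linearly independent over `ratClosure S` contains no nonzero
vector whose coordinate ratios all lie in that field. So one ratio is transcendental over `S`, and a
generic rescaling, allowed on a cone, adds a second independent element. -/
theorem exists_zero_transRank_add_two_le {ι : Type*} [Fintype ι] {S : Set ℂ} (hS : S.Finite)
    {Z : (ι → ℂ) → Prop} (hZ : ∀ ξ, Z ξ → ∀ t : ℂ, Z (t • ξ))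
    (h : ∀ l : ι → ℂ, ∃ ξ, ξ ≠ 0 ∧ ∑ i, l i * ξ i = 0 ∧ Z ξ) :
    ∃ ξ, ξ ≠ 0 ∧ Z ξ ∧ transRank S + 2 ≤ transRank (S ∪ Set.range ξ) := by
  obtain ⟨l', hl'⟩ := exists_linearIndependent_ratClosure hS (Fintype.card ι)
  obtain ⟨l, hl⟩ : ∃ l : ι → ℂ, LinearIndependent (ratClosure S) l :=
    ⟨_, hl'.comp _ (Fintype.equivFin ι).injective⟩
  obtain ⟨ξ, hξ, hlξ, hZξ⟩ := h l
  obtain ⟨i, hi⟩ := Function.ne_iff.1 hξ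
  have hi : ξ i ≠ 0 := hi
  obtain ⟨m, hm⟩ : ∃ m, (ξ i)⁻¹ * ξ m ∉ ratClosure S := by
    by_contra! hcon
    rw [Fintype.linearIndependent_iff] at hl
    have h1 := hl (fun k => ⟨_, hcon k⟩) (by
      have : ∑ k, (ξ i)⁻¹ * (l k * ξ k) = 0 := by rw [← Finset.mul_sum, hlξ, mul_zero]
      rw [← this]
      refine Finset.sum_congr rfl fun k _ => ?_
      change (ξ i)⁻¹ * ξ k * l k = _
      ring) i
    have h2 := congrArg Subtype.val h1
    simp [hi] at h2
  obtain ⟨t, ht⟩ := exists_notMem_ratClosure (hS.insert ((ξ i)⁻¹ * ξ m))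
  have ht0 : t ≠ 0 := fun h0 => ht (h0 ▸ zero_mem _)
  refine ⟨(t * (ξ i)⁻¹) • ξ, ?_, hZ _ hZξ _, ?_⟩
  · exact smul_ne_zero (mul_ne_zero ht0 (inv_ne_zero hi)) hξ
  · rw [show transRank S + 2 = transRank S + 1 + 1 from rfl, ← transRank_insert hS hm,
      ← transRank_insert (hS.insert _) ht]
    have ht' : t ∈ ratClosure (S ∪ Set.range ((t * (ξ i)⁻¹) • ξ)) := by
      refine subset_ratClosure _ (Or.inr ⟨i, ?_⟩)
      simp [hi]
    refine transRank_le_of_subset_ratClosure (hS.union (Set.finite_range _))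
      ((hS.insert _).insert _) ?_
    refine Set.insert_subset ht' (Set.insert_subset ?_
      (Set.subset_union_left.trans (subset_ratClosure _)))
    have h1 : (t * (ξ i)⁻¹) * ξ m ∈ ratClosure (S ∪ Set.range ((t * (ξ i)⁻¹) • ξ)) :=
      subset_ratClosure _ (Or.inr ⟨m, rfl⟩)
    have h2 := mul_mem (inv_mem ht') h1
    rwa [mul_assoc, inv_mul_cancel_left₀ ht0] at h2

/-- The forms `q_j`, `lo ≤ j ≤ hi`, among the homogeneous components of `g` have a nontrivial
common zero on every hyperplane. -/
def ZerosMeetHyperplanes {ι : Type*} [Fintype ι] (lo hi : ℕ) (g : MvPolynomial ι ℂ) : Prop :=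
  ∀ l : ι → ℂ, ∃ ξ, ξ ≠ 0 ∧ ∑ i, l i * ξ i = 0 ∧
    ∀ j, lo ≤ j → j ≤ hi → MvPolynomial.eval ξ (MvPolynomial.homogeneousComponent j g) = 0

theorem ZerosMeetHyperplanes.exists_zero {ι : Type*} [Fintype ι] {lo hi : ℕ}
    {g : MvPolynomial ι ℂ} (h : ZerosMeetHyperplanes lo hi g) {S : Set ℂ} (hS : S.Finite) :
    ∃ ξ : ι → ℂ, ξ ≠ 0 ∧
      (∀ j, lo ≤ j → j ≤ hi → MvPolynomial.eval ξ (MvPolynomial.homogeneousComponent j g) = 0) ∧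
      transRank S + 2 ≤ transRank (S ∪ Set.range ξ) := by
  refine exists_zero_transRank_add_two_le hS (Z := fun ξ => ∀ j, lo ≤ j → j ≤ hi →
    MvPolynomial.eval ξ (MvPolynomial.homogeneousComponent j g) = 0) (fun ξ hξ t j h1 h2 => ?_) h
  rw [(MvPolynomial.homogeneousComponent_isHomogeneous j g).eval_smul, hξ j h1 h2, mul_zero]

/-- The exponents of degree at most `M` in `M` variables. -/
abbrev LocalIndex (M : ℕ) : Type := {d : Fin M →₀ ℕ // d.degree ≤ M}

/-- The exponents of degree at most `M`, sorted by degree. -/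
noncomputable def localIndexEquiv (M : ℕ) : LocalIndex M ≃ Σ j : Fin (M + 1), Expts (Fin M) j where
  toFun d := ⟨⟨d.1.degree, Nat.lt_succ_of_le d.2⟩, ⟨d.1, rfl⟩⟩
  invFun p := ⟨p.2.1, p.2.2.trans_le (Nat.le_of_lt_succ p.1.2)⟩
  left_inv _ := rfl
  right_inv := by
    rintro ⟨⟨j, hj⟩, ⟨d, hd⟩⟩
    obtain rfl : d.degree = j := hd
    rfl

instance (M : ℕ) : Finite (LocalIndex M) := Finite.of_equiv _ (localIndexEquiv M).symm

theorem natCard_localIndex (M : ℕ) : Nat.card (LocalIndex M) =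
    ∑ j ∈ Finset.range (M + 1), Nat.card (Expts (Fin M) j) := by
  rw [Nat.card_congr (localIndexEquiv M), Nat.card_sigma, Finset.sum_range]

/-- The coefficients of degree at most `M` of a polynomial in `M` variables. -/
def localCoeffs {M : ℕ} (g : MvPolynomial (Fin M) ℂ) : Set ℂ :=
  Set.range fun d : LocalIndex M => g.coeff d.1

theorem finite_localCoeffs {M : ℕ} (g : MvPolynomial (Fin M) ℂ) : (localCoeffs g).Finite :=
  Set.finite_range _

theorem range_subset_coeffStage {ι : Type*} (B : Set ℂ) (c : (j : ℕ) → Expts ι j → ℂ) {t n : ℕ}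
    (h : t < n) : Set.range (c (t + 2)) ⊆ coeffStage B c n :=
  Set.subset_union_right.trans (coeffStage_mono B c (Nat.succ_le_of_lt h))

theorem mem_coeffStage_of_degree {M : ℕ} (B : Set ℂ) (g : MvPolynomial (Fin M) ℂ) {n : ℕ}
    {d : Fin M →₀ ℕ} (h2 : 2 ≤ d.degree) (hn : d.degree < n + 2) :
    g.coeff d ∈ coeffStage B (fun _ e => g.coeff e.1) n :=
  range_subset_coeffStage B (fun _ e => g.coeff e.1) (t := d.degree - 2) (by omega)
    ⟨⟨d, by omega⟩, rfl⟩

theorem sum_range_card_expts (M n : ℕ) : ∑ j ∈ Finset.range (n + 2), Nat.card (Expts (Fin M) j) =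
    1 + M + ∑ t ∈ Finset.range n, Nat.card (Expts (Fin M) (t + 2)) := by
  rw [Finset.sum_range_succ', Finset.sum_range_succ']
  simp only [natCard_expts, Nat.card_eq_fintype_card, Fintype.card_fin]
  simp [Nat.multichoose_one_right]
  ring

/-- The vanishing of q_0 and q_1 saves 1 + M, and the stage count with n = M - 1 saves C(M-1,2) + 3.
-/
theorem transRank_localCoeffs_add_le_of_zerosMeetHyperplanes_two {M : ℕ} (hM : 5 ≤ M)
    {g : MvPolynomial (Fin M) ℂ} (h0 : ∀ d : Fin M →₀ ℕ, d.degree ≤ 1 → g.coeff d = 0)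
    (h : ZerosMeetHyperplanes 2 M g) :
    transRank (localCoeffs g) + ((M - 3).choose 2 + 1 + M) ≤ Nat.card (LocalIndex M) := by
  obtain ⟨n, rfl⟩ : ∃ n, M = n + 1 := ⟨M - 1, by omega⟩
  set c : (j : ℕ) → Expts (Fin (n + 1)) j → ℂ := fun _ e => g.coeff e.1 with hc
  have hSf := finite_coeffStage Set.finite_empty c n
  obtain ⟨ξ, hξ, hz, htr⟩ := h.exists_zero hSf
  have key := two_mul_transRank_coeffStage_le (n := n) (by omega) Set.finite_empty c hξ
    (fun t ht => by rw [← hz (t + 2) (by omega) (by omega), eval_homogeneousComponent_eq_finsum])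
    ((finrank_range_le_card ξ).trans (by simp)) htr
  have h1 : transRank (localCoeffs g) ≤ transRank (coeffStage ∅ c n) := by
    refine transRank_le_of_subset_ratClosure hSf (finite_localCoeffs g) ?_
    rintro _ ⟨d, rfl⟩
    rcases Nat.lt_or_ge d.1.degree 2 with hd | hd
    · dsimp only
      rw [h0 _ (by omega)]
      exact zero_mem _
    · exact subset_ratClosure _ (mem_coeffStage_of_degree ∅ g hd (by have := d.2; omega))
  have h2 : transRank ∅ = 0 := by simpa using transRank_le_ncard Set.finite_empty
  rw [natCard_localIndex, show n + 1 + 1 = n + 2 from rfl, sum_range_card_expts]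
  obtain ⟨m, rfl⟩ : ∃ m, n = m + 2 := ⟨n - 2, by omega⟩
  have h3 : 2 * m.choose 2 ≤ m * m := by
    rw [Nat.choose_two_right]
    have := Nat.div_mul_le_self (m * (m - 1)) 2
    have h4 : m * (m - 1) ≤ m * m := Nat.mul_le_mul_left _ (by omega)
    omega
  rw [show m + 2 + 1 - 3 = m by omega]
  nlinarith

/-- The stage count runs with n = M - 2 on the hyperplane q_1 = 0, leaving q_M free. With q_0 = 0
the saving is 1 + C(M-2,2) + 3, exactly C(M-3,2) + 1 + M. -/
theorem transRank_localCoeffs_add_le_of_zerosMeetHyperplanes_one {M : ℕ} (hM : 5 ≤ M)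
    {g : MvPolynomial (Fin M) ℂ} (h0 : g.coeff 0 = 0) {i : Fin M}
    (hi : g.coeff (Finsupp.single i 1) ≠ 0) (h : ZerosMeetHyperplanes 1 (M - 1) g) :
    transRank (localCoeffs g) + ((M - 3).choose 2 + 1 + M) ≤ Nat.card (LocalIndex M) := by
  classical
  obtain ⟨n, rfl⟩ : ∃ n, M = n + 2 := ⟨M - 2, by omega⟩
  set c : (j : ℕ) → Expts (Fin (n + 2)) j → ℂ := fun _ e => g.coeff e.1 with hc
  set B : Set ℂ := Set.range (c 1) with hB
  have hBf : B.Finite := Set.finite_range _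
  have hSf := finite_coeffStage hBf c n
  obtain ⟨ξ, hξ, hz, htr⟩ := h.exists_zero hSf
  have hcB : ∀ k, g.coeff (Finsupp.single k 1) ∈ ratClosure B := fun k =>
    subset_ratClosure _ ⟨⟨Finsupp.single k 1, by simp⟩, rfl⟩
  have hlin : ∑ k, g.coeff (Finsupp.single k 1) * ξ k = 0 := by
    rw [← hz 1 le_rfl (by omega), eval_homogeneousComponent_eq_finsum]
    rw [← finsum_eq_sum_of_fintype]
    refine finsum_eq_of_bijective
      (fun k => (⟨Finsupp.single k 1, by simp⟩ : Expts (Fin (n + 2)) 1))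
      ⟨fun a b hab => Finsupp.single_left_injective one_ne_zero (congrArg Subtype.val hab),
        fun d => ?_⟩ fun k => ?_
    · obtain ⟨k, hk⟩ : d.1 ∈ Set.range fun a => Finsupp.single a 1 := by
        rw [Finsupp.range_single_one]; exact d.2
      exact ⟨k, Subtype.ext hk⟩
    · simp
  -- The nonzero linear coefficient solves for ξ_i in terms of the other coordinates, over the field
  -- generated by q_1.
  have hw : Module.finrank (ratClosure B) (Submodule.span (ratClosure B) (Set.range ξ)) ≤
      n + 1 := by
    refine (finrank_span_le_of_subset_span (B := ξ '' {i}ᶜ) ((Set.toFinite _).image _) ?_).trans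
      ((Set.ncard_image_le (Set.toFinite _)).trans ?_)
    · rintro _ ⟨k, rfl⟩
      by_cases hk : k = i
      · subst hk
        have h1 : ξ k = ∑ m ∈ Finset.univ.erase k,
            (-(g.coeff (Finsupp.single k 1))⁻¹ * g.coeff (Finsupp.single m 1)) * ξ m := by
          rw [← Finset.add_sum_erase _ _ (Finset.mem_univ k)] at hlin
          simp_rw [mul_assoc, ← Finset.mul_sum]
          rw [eq_neg_of_add_eq_zero_right hlin]
          field_simp
        rw [h1]
        refine Submodule.sum_mem _ fun m hm => ?_
        exact Submodule.smul_mem _ (⟨_, mul_mem (neg_mem (inv_mem (hcB k))) (hcB m)⟩ : ratClosure B)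
          (Submodule.subset_span ⟨m, by simpa using hm, rfl⟩)
      · exact Submodule.subset_span ⟨k, hk, rfl⟩
    · rw [Set.ncard_compl]
      simp
  have key := two_mul_transRank_coeffStage_le (n := n) (by omega) hBf c hξ
    (fun t ht => by rw [← hz (t + 2) (by omega) (by omega), eval_homogeneousComponent_eq_finsum])
    hw htr
  have hMf := Set.finite_range (c (n + 2))
  have h1 : transRank (localCoeffs g) ≤ transRank (coeffStage B c n) +
      Nat.card (Expts (Fin (n + 2)) (n + 2)) := by
    refine (transRank_le_of_subset_ratClosure (hSf.union hMf) (finite_localCoeffs g) ?_).trans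
      ((transRank_union_le hSf hMf).trans ?_)
    · rintro _ ⟨d, rfl⟩
      dsimp only
      rcases Nat.lt_or_ge d.1.degree 2 with hd | hd
      · rcases Nat.eq_zero_or_pos d.1.degree with hd0 | hd0
        · rw [(Finsupp.degree_eq_zero_iff d.1).1 hd0, h0]
          exact zero_mem _
        · exact subset_ratClosure _ (Or.inl (coeffStage_mono B c (Nat.zero_le n)
            ⟨⟨d.1, by omega⟩, rfl⟩))
      · rcases Nat.lt_or_ge d.1.degree (n + 2) with hn | hn
        · exact subset_ratClosure _ (Or.inl (mem_coeffStage_of_degree B g hd hn))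
        · exact subset_ratClosure _ (Or.inr ⟨⟨d.1, by have := d.2; omega⟩, rfl⟩)
    · gcongr
      rw [← Nat.card_coe_set_eq]
      exact Finite.card_range_le _
  have h2 : transRank B ≤ n + 2 := by
    refine (transRank_le_ncard hBf).trans ?_
    rw [← Nat.card_coe_set_eq]
    refine (Finite.card_range_le _).trans ?_
    rw [natCard_expts]
    simp
  rw [natCard_localIndex, Finset.sum_range_succ, sum_range_card_expts]
  obtain ⟨m, rfl⟩ : ∃ m, n = m + 1 := ⟨n - 1, by omega⟩
  rw [show m + 1 + 2 - 3 = m by omega]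
  have h3 : 2 * m.choose 2 + m = m * m := by
    rw [Nat.choose_two_right, Nat.mul_div_cancel' (Nat.even_mul_pred_self m).two_dvd]
    cases m
    · rfl
    · simp only [Nat.add_sub_cancel]; ring
  nlinarith

theorem Matrix.exists_row_dependence {ι : Type*} [Fintype ι] {A : Matrix ι ι ℂ} {r : ℕ}
    (hA : A.rank ≤ r) (hr : r ≤ Fintype.card ι) :
    ∃ (I : Finset ι) (T : ι → ι → ℂ), I.card = r ∧ ∀ k l, A k l = ∑ i ∈ I, T k i * A i l := by
  classical
  obtain ⟨κ, a, ha, hs, hli⟩ := exists_linearIndependent' ℂ A.row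
  have : Finite κ := hli.finite
  have := Fintype.ofFinite κ
  have hc : (Finset.univ.map ⟨a, ha⟩).card ≤ r := by
    rw [Finset.card_map, Finset.card_univ, ← finrank_span_eq_card hli, hs,
      ← Matrix.rank_eq_finrank_span_row]
    exact hA
  obtain ⟨I, hI, hIc⟩ := Finset.exists_superset_card_eq hc hr
  have h : ∀ k, ∃ T : ι → ℂ, ∑ i ∈ I, T i • A.row i = A.row k := by
    intro k
    have hk : A.row k ∈ Submodule.span ℂ (A.row '' (I : Set ι)) := by
      refine Submodule.span_mono ?_ (hs.symm ▸ Submodule.subset_span (Set.mem_range_self k) :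
        A.row k ∈ Submodule.span ℂ (Set.range (A.row ∘ a)))
      rintro _ ⟨x, rfl⟩
      exact ⟨a x, hI (by simp), rfl⟩
    obtain ⟨c, hc⟩ := (Submodule.mem_span_image_finset_iff_exists_fun ℂ).1 hk
    refine ⟨fun i => if h : i ∈ I then c ⟨i, h⟩ else 0, ?_⟩
    rw [← hc, ← Finset.sum_coe_sort]
    exact Finset.sum_congr rfl fun i _ => by simp
  choose T hT using h
  refine ⟨I, T, hIc, fun k l => ?_⟩
  have := congrFun (hT k) l
  simpa using this.symm

/-- With r rows spanning the row space, the matrix is determined by its symmetric r × r block and by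
the r coefficients expressing each remaining row. -/
theorem transRank_symmetric_le {ι : Type*} [Fintype ι] {A : Matrix ι ι ℂ} (hs : A.IsSymm) {r : ℕ}
    (hA : A.rank ≤ r) (hr : r ≤ Fintype.card ι) :
    transRank (Set.range fun p : ι × ι => A p.1 p.2) ≤
      (r + 1).choose 2 + r * (Fintype.card ι - r) := by
  classical
  obtain ⟨I, T, hI, hT⟩ := A.exists_row_dependence hA hr
  let u : Sym2 I ⊕ (↥Iᶜ × I) → ℂ := Sum.elim
    (Sym2.lift ⟨fun i j => A i j, fun i j => hs.apply _ _⟩) (fun p => T p.1 p.2)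
  have hsym : ∀ i j : I, A i j ∈ ratClosure (Set.range u) := fun i j =>
    subset_ratClosure _ ⟨Sum.inl s(i, j), rfl⟩
  have hTm : ∀ k ∉ I, ∀ i : I, T k i ∈ ratClosure (Set.range u) := fun k hk i =>
    subset_ratClosure _ ⟨Sum.inr (⟨k, by simpa using hk⟩, i), rfl⟩
  have hrow : ∀ k, ∀ i : I, A k i ∈ ratClosure (Set.range u) := by
    intro k i
    by_cases hk : k ∈ I
    · exact hsym ⟨k, hk⟩ i
    · rw [hT]
      exact sum_mem fun j hj => mul_mem (hTm k hk ⟨j, hj⟩) (hsym ⟨j, hj⟩ i)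
  have hall : ∀ k l, A k l ∈ ratClosure (Set.range u) := by
    intro k l
    by_cases hk : k ∈ I
    · rw [← hs.apply]
      exact hrow l ⟨k, hk⟩
    · rw [hT]
      refine sum_mem fun j hj => mul_mem (hTm k hk ⟨j, hj⟩) ?_
      rw [← hs.apply]
      exact hrow l ⟨j, hj⟩
  have huf := Set.finite_range u
  refine (transRank_le_of_subset_ratClosure huf (Set.finite_range _) ?_).trans
    ((transRank_le_ncard huf).trans ?_)
  · rintro _ ⟨p, rfl⟩
    exact hall _ _
  · rw [← Nat.card_coe_set_eq]
    refine (Finite.card_range_le u).trans ?_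
    rw [Nat.card_eq_fintype_card, Fintype.card_sum, Sym2.card, Fintype.card_prod,
      Fintype.card_coe, Fintype.card_coe, Finset.card_compl, hI, mul_comm r]

/-- The symmetric matrix of the quadratic part of a polynomial. -/
noncomputable def quadraticMatrix {ι : Type*} [DecidableEq ι] {R : Type*} [Field R]
    (g : MvPolynomial ι R) : Matrix ι ι R :=
  fun i j => if i = j then g.coeff (Finsupp.single i 2)
    else g.coeff (Finsupp.single i 1 + Finsupp.single j 1) / 2

theorem quadraticMatrix_isSymm {ι : Type*} [DecidableEq ι] {R : Type*} [Field R]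
    (g : MvPolynomial ι R) : (quadraticMatrix g).IsSymm := by
  refine Matrix.IsSymm.ext fun i j => ?_
  unfold quadraticMatrix
  by_cases h : i = j
  · subst h; simp
  · rw [if_neg h, if_neg (Ne.symm h), add_comm]

theorem Finsupp.exists_eq_single_add_single {ι : Type*} (d : ι →₀ ℕ) (hd : d.degree = 2) :
    ∃ i j, d = Finsupp.single i 1 + Finsupp.single j 1 := by
  obtain ⟨g, hg, hg1⟩ := Finsupp.exists_le_degree_eq d 1 (by omega)
  obtain ⟨h, rfl⟩ := le_iff_exists_add.1 hg
  rw [map_add] at hd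
  have hh : h.degree = 1 := by omega
  obtain ⟨i, rfl⟩ : g ∈ Set.range fun a => Finsupp.single a 1 := by
    rw [Finsupp.range_single_one]; exact hg1
  obtain ⟨j, rfl⟩ : h ∈ Set.range fun a => Finsupp.single a 1 := by
    rw [Finsupp.range_single_one]; exact hh
  exact ⟨i, j, rfl⟩

/-- The saving is 1 + M from the vanishing of q_0 and q_1, plus C(M+1,2) - 10 - 4(M-4) = C(M-3,2)
from q_2, so the bound has no slack. -/
theorem transRank_localCoeffs_add_le_of_rank_le {M : ℕ} (hM : 5 ≤ M)
    {g : MvPolynomial (Fin M) ℂ} (h0 : ∀ d : Fin M →₀ ℕ, d.degree ≤ 1 → g.coeff d = 0)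
    (h : (quadraticMatrix g).rank ≤ 4) :
    transRank (localCoeffs g) + ((M - 3).choose 2 + 1 + M) ≤ Nat.card (LocalIndex M) := by
  obtain ⟨n, rfl⟩ : ∃ n, M = n + 1 + 1 := ⟨M - 2, by omega⟩
  set c : (j : ℕ) → Expts (Fin (n + 2)) j → ℂ := fun _ e => g.coeff e.1 with hc
  have hSf := finite_coeffStage Set.finite_empty c (n + 1)
  have h1 : transRank (localCoeffs g) ≤ transRank (coeffStage ∅ c (n + 1)) := by
    refine transRank_le_of_subset_ratClosure hSf (finite_localCoeffs g) ?_
    rintro _ ⟨d, rfl⟩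
    rcases Nat.lt_or_ge d.1.degree 2 with hd | hd
    · dsimp only
      rw [h0 _ (by omega)]
      exact zero_mem _
    · exact subset_ratClosure _ (mem_coeffStage_of_degree ∅ g hd (by have := d.2; omega))
  have h2 : transRank (coeffStage ∅ c 1) ≤ (4 + 1).choose 2 + 4 * (n + 2 - 4) := by
    have := transRank_symmetric_le (quadraticMatrix_isSymm g) h (by simp; omega)
    rw [Fintype.card_fin] at this
    refine le_trans (transRank_le_of_subset_ratClosure (Set.finite_range _)
      (finite_coeffStage Set.finite_empty c 1) ?_) this
    simp only [coeffStage, Set.empty_union]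
    rintro _ ⟨d, rfl⟩
    obtain ⟨i, j, hij⟩ := Finsupp.exists_eq_single_add_single d.1 d.2
    have hmem := subset_ratClosure (Set.range fun p : Fin (n + 2) × Fin (n + 2) =>
      quadraticMatrix g p.1 p.2) ⟨(i, j), rfl⟩
    simp only [hc, hij]
    simp only [quadraticMatrix] at hmem
    split_ifs at hmem with hij'
    · subst hij'
      rwa [← Finsupp.single_add]
    · have := add_mem hmem hmem
      rwa [add_halves] at this
  have h3 : ∀ u, transRank (coeffStage ∅ c (1 + u)) ≤ transRank (coeffStage ∅ c 1) +
      ∑ t ∈ Finset.range u, Nat.card (Expts (Fin (n + 2)) (t + 3)) := by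
    intro u
    induction u with
    | zero => simp
    | succ u ih =>
      have := transRank_coeffStage_succ_le Set.finite_empty c (1 + u)
      rw [Finset.sum_range_succ, ← add_assoc 1 u 1]
      rw [show 1 + u + 2 = u + 3 by omega] at this
      omega
  have h4 := h3 n
  rw [natCard_localIndex, show n + 1 + 1 + 1 = (n + 1) + 2 from rfl, sum_range_card_expts,
    Finset.sum_range_succ']
  rw [add_comm 1 n] at h4
  have h5 : Nat.card (Expts (Fin (n + 1 + 1)) (0 + 2)) = (n + 3).choose 2 := by
    rw [natCard_expts, Nat.card_eq_fintype_card, Fintype.card_fin, Nat.multichoose_eq]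
    rfl
  rw [h5]
  obtain ⟨m, rfl⟩ : ∃ m, n = m + 2 := ⟨n - 2, by omega⟩
  have h6 : (m + 2 + 3).choose 2 = m.choose 2 + 5 * m + 10 := by
    simp only [Nat.choose_succ_succ' _ 1, Nat.choose_one_right, Nat.reduceAdd]
    omega
  have h7 : (m + 2 + 1 + 1 - 3).choose 2 = m.choose 2 + m := by
    rw [show m + 2 + 1 + 1 - 3 = m + 1 by omega, Nat.choose_succ_succ' _ 1, Nat.choose_one_right,
      add_comm]
  rw [h6, h7]
  have h8 : (4 + 1).choose 2 = 10 := rfl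
  rw [h8, show m + 2 + 2 - 4 = m by omega] at h2
  have h9 : ∀ t, Nat.card (Expts (Fin (m + 2 + 1 + 1)) (t + 1 + 2)) =
    Nat.card (Expts (Fin (m + 2 + 2)) (t + 3)) := fun t => rfl
  simp only [h9]
  omega

/-! ### From pointwise dependence to a uniform relation -/

/-- For transcendental z the uncountably many elements 1/(z - a), with a in ℂ, are linearly
independent. -/
theorem Algebra.isAlgebraic_of_rank_le_aleph0 {K : Type} [Field K] [Algebra ℂ K]
    (h : Module.rank ℂ K ≤ Cardinal.aleph0) : Algebra.IsAlgebraic ℂ K := by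
  refine ⟨fun z => ?_⟩
  by_contra hz
  have hli := Transcendental.linearIndependent_sub_inv (F := ℂ) (E := K) hz
  have := hli.cardinal_le_rank.trans h
  rw [Cardinal.mk_complex] at this
  exact absurd this (not_le.2 Cardinal.aleph0_lt_continuum)

/-- A Nullstellensatz avoiding countably many hypersurfaces: the localization at `T` has countable
dimension over ℂ, so its residue fields are ℂ itself. -/
theorem exists_point_of_disjoint {σ : Type} [Finite σ] (I : Ideal (MvPolynomial σ ℂ))
    (T : Submonoid (MvPolynomial σ ℂ)) (hT : (T : Set (MvPolynomial σ ℂ)).Countable)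
    (hd : Disjoint (T : Set (MvPolynomial σ ℂ)) I) :
    ∃ x : σ → ℂ, (∀ F ∈ I, MvPolynomial.eval x F = 0) ∧ ∀ F ∈ T, MvPolynomial.eval x F ≠ 0 := by
  obtain ⟨m, hm, hIm⟩ := Ideal.exists_le_maximal _
    ((IsLocalization.map_algebraMap_ne_top_iff_disjoint T (Localization T) I).2 hd)
  let _ : Field (Localization T ⧸ m) := Ideal.Quotient.field m
  set ψ : MvPolynomial σ ℂ →ₐ[ℂ] Localization T ⧸ m :=
    (Ideal.Quotient.mkₐ ℂ m).comp (IsScalarTower.toAlgHom ℂ (MvPolynomial σ ℂ) (Localization T))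
    with hψ
  have hψI : ∀ F ∈ I, ψ F = 0 := fun F hF =>
    Ideal.Quotient.eq_zero_iff_mem.2 (hIm (Ideal.mem_map_of_mem _ hF))
  have hψT : ∀ F ∈ T, ψ F ≠ 0 := fun F hF =>
    ((IsLocalization.map_units (Localization T) ⟨F, hF⟩).map (Ideal.Quotient.mk m)).ne_zero
  have hrank : Module.rank ℂ (Localization T ⧸ m) ≤ Cardinal.aleph0 := by
    have := hT.to_subtype
    set v : (σ →₀ ℕ) × T → Localization T ⧸ m :=
      fun p => ψ (MvPolynomial.monomial p.1 1) * (ψ p.2)⁻¹ with hv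
    have hspan : Submodule.span ℂ (Set.range v) = ⊤ := by
      rw [eq_top_iff]
      rintro z -
      obtain ⟨y, rfl⟩ := Ideal.Quotient.mk_surjective z
      obtain ⟨⟨r, t⟩, hrt⟩ := IsLocalization.surj T y
      have hy : Ideal.Quotient.mk m y = ψ r * (ψ t)⁻¹ := by
        rw [eq_mul_inv_iff_mul_eq₀ (hψT _ t.2)]
        change Ideal.Quotient.mk m y * Ideal.Quotient.mk m (algebraMap _ _ (t : MvPolynomial σ ℂ)) =
          Ideal.Quotient.mk m (algebraMap _ _ r)
        rw [← map_mul, hrt]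
      rw [hy, r.as_sum, map_sum, Finset.sum_mul]
      refine Submodule.sum_mem _ fun d _ => ?_
      have : ψ (MvPolynomial.monomial d (r.coeff d)) * (ψ t)⁻¹ = r.coeff d • v (d, t) := by
        rw [hv, ← smul_mul_assoc, ← map_smul, MvPolynomial.smul_monomial, smul_eq_mul, mul_one]
      rw [this]
      exact Submodule.smul_mem _ _ (Submodule.subset_span ⟨_, rfl⟩)
    rw [← rank_top, ← hspan]
    refine (rank_span_le _).trans ?_
    exact Cardinal.mk_le_aleph0_iff.2 (Set.countable_range v).to_subtype
  have := Algebra.isAlgebraic_of_rank_le_aleph0 hrank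
  have hbij := IsAlgClosed.algebraMap_bijective_of_isIntegral (k := ℂ) (K := Localization T ⧸ m)
  choose x hx using fun i => hbij.2 (ψ (MvPolynomial.X i))
  have hev : ∀ F, algebraMap ℂ _ (MvPolynomial.eval x F) = ψ F := by
    intro F
    have : ((Algebra.ofId ℂ (Localization T ⧸ m)).comp (MvPolynomial.aeval x)) = ψ := by
      ext i
      simpa using hx i
    rw [← this]
    simp
  refine ⟨x, fun F hF => hbij.1 ?_, fun F hF h0 => hψT F hF ?_⟩
  · rw [hev, hψI F hF, map_zero]
  · rw [← hev, h0, map_zero]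

/-- If every nonzero rational polynomial failed somewhere on `S`, the ideal of `S` would miss the
countable multiplicative set generated by `h` and these polynomials. A point of its zero locus
avoiding that set would lie in `S`, which is closed where h ≠ 0, and would have algebraically
independent values of `u`. -/
theorem exists_relation_of_forall_not_algebraicIndependent {σ κ : Type} [Finite σ] [Finite κ]
    (S : Set (σ → ℂ)) (h : MvPolynomial σ ℂ) (hS : ∀ x ∈ S, MvPolynomial.eval x h ≠ 0)
    (hcl : ∀ x ∉ S, MvPolynomial.eval x h ≠ 0 →
      ∃ F : MvPolynomial σ ℂ, (∀ y ∈ S, MvPolynomial.eval y F = 0) ∧ MvPolynomial.eval x F ≠ 0)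
    (u : κ → MvPolynomial σ ℚ)
    (hu : ∀ x ∈ S, ¬ AlgebraicIndependent ℚ (fun a => MvPolynomial.aeval x (u a))) :
    ∃ P : MvPolynomial κ ℚ, P ≠ 0 ∧
      ∀ x ∈ S, MvPolynomial.aeval (fun a => MvPolynomial.aeval x (u a)) P = 0 := by
  by_contra! H
  set φ : MvPolynomial κ ℚ →+* MvPolynomial σ ℂ :=
    (MvPolynomial.map (algebraMap ℚ ℂ)).comp
      (MvPolynomial.aeval u : MvPolynomial κ ℚ →ₐ[ℚ] MvPolynomial σ ℚ) with hφ
  have hev : ∀ x P, MvPolynomial.eval x (φ P) =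
      MvPolynomial.aeval (fun a => MvPolynomial.aeval x (u a)) P := by
    intro x P
    rw [hφ, RingHom.comp_apply, MvPolynomial.eval_map, ← MvPolynomial.aeval_def, RingHom.coe_coe,
      ← AlgHom.comp_apply, MvPolynomial.comp_aeval]
  set I : Ideal (MvPolynomial σ ℂ) := ⨅ x ∈ S, RingHom.ker (MvPolynomial.eval x) with hI
  have hImem : ∀ F, F ∈ I ↔ ∀ x ∈ S, MvPolynomial.eval x F = 0 := by
    intro F
    simp [hI, RingHom.mem_ker]
  let T : Submonoid (MvPolynomial σ ℂ) :=
    { carrier := Set.range fun p : ℕ × {P : MvPolynomial κ ℚ // P ≠ 0} => h ^ p.1 * φ p.2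
      one_mem' := ⟨(0, ⟨1, one_ne_zero⟩), by simp⟩
      mul_mem' := by
        rintro _ _ ⟨p, rfl⟩ ⟨q, rfl⟩
        refine ⟨(p.1 + q.1, ⟨p.2 * q.2, mul_ne_zero p.2.2 q.2.2⟩), ?_⟩
        simp only [map_mul, pow_add]
        ring }
  have := countable_mvPolynomial_rat κ
  obtain ⟨x, hxI, hxT⟩ := exists_point_of_disjoint I T (Set.countable_range _) (by
    rw [Set.disjoint_left]
    rintro _ ⟨⟨k, P, hP⟩, rfl⟩ hmem
    obtain ⟨x, hx, hPx⟩ := H P hP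
    have := (hImem _).1 hmem x hx
    rw [map_mul, map_pow, hev] at this
    exact mul_ne_zero (pow_ne_zero _ (hS x hx)) hPx this)
  have hhx : MvPolynomial.eval x h ≠ 0 := by
    simpa using hxT _ ⟨(1, ⟨1, one_ne_zero⟩), rfl⟩
  have hxS : x ∈ S := by
    by_contra hxS
    obtain ⟨F, hF, hFx⟩ := hcl x hxS hhx
    exact hFx (hxI F ((hImem F).2 hF))
  refine hu x hxS ((injective_iff_map_eq_zero _).2 fun P hP => ?_)
  by_contra hP0
  refine hxT _ ⟨(0, ⟨P, hP0⟩), rfl⟩ ?_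
  dsimp only
  rw [pow_zero, one_mul, hev]
  exact hP

/-! ### Elimination: closed conditions and finiteness of zeros -/

/-- The restriction of a polynomial to the line through the origin and `ξ`. -/
noncomputable def radial {ι : Type*} (ξ : ι → ℂ) : MvPolynomial ι ℂ →ₐ[ℂ] Polynomial ℂ :=
  MvPolynomial.aeval fun i => Polynomial.C (ξ i) * Polynomial.X

theorem radial_monomial {ι : Type*} (ξ : ι → ℂ) (d : ι →₀ ℕ) (a : ℂ) :
    radial ξ (MvPolynomial.monomial d a) =
      Polynomial.C (a * d.prod fun i n => ξ i ^ n) * Polynomial.X ^ d.degree := by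
  rw [radial, MvPolynomial.aeval_monomial, Polynomial.algebraMap_eq, Polynomial.C_mul, mul_assoc]
  congr 1
  simp only [Finsupp.prod, mul_pow, Finset.prod_mul_distrib, map_prod, map_pow]
  rw [Finset.prod_pow_eq_pow_sum, Finsupp.degree_apply]

theorem coeff_radial {ι : Type*} (ξ : ι → ℂ) (W : MvPolynomial ι ℂ) (k : ℕ) :
    (radial ξ W).coeff k = MvPolynomial.eval ξ (MvPolynomial.homogeneousComponent k W) := by
  induction W using MvPolynomial.induction_on' with
  | monomial d a =>
    rw [radial_monomial, Polynomial.coeff_C_mul, Polynomial.coeff_X_pow,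
      MvPolynomial.homogeneousComponent_of_mem (MvPolynomial.isHomogeneous_monomial a rfl)]
    split_ifs with h
    · rw [MvPolynomial.eval_monomial, mul_one]
    · rw [mul_zero, map_zero]
  | add p q hp hq => rw [map_add, Polynomial.coeff_add, hp, hq, map_add, map_add]

theorem radial_of_isHomogeneous {ι : Type*} (ξ : ι → ℂ) {F : MvPolynomial ι ℂ} {n : ℕ}
    (hF : F.IsHomogeneous n) :
    radial ξ F = Polynomial.C (MvPolynomial.eval ξ F) * Polynomial.X ^ n := by
  ext k
  rw [coeff_radial, Polynomial.coeff_C_mul, Polynomial.coeff_X_pow,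
    MvPolynomial.homogeneousComponent_of_mem hF]
  split_ifs with h
  · rw [mul_one]
  · rw [mul_zero, map_zero]

/-- The linear form with coefficients `l`. -/
noncomputable def linForm {ι R : Type*} [Fintype ι] [CommSemiring R] (l : ι → R) :
    MvPolynomial ι R :=
  ∑ i, MvPolynomial.C (l i) * MvPolynomial.X i

theorem eval_linForm {ι R : Type*} [Fintype ι] [CommSemiring R] (l ξ : ι → R) :
    MvPolynomial.eval ξ (linForm l) = ∑ i, l i * ξ i := by
  simp [linForm]

theorem linForm_isHomogeneous {ι R : Type*} [Fintype ι] [CommSemiring R] (l : ι → R) :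
    (linForm l).IsHomogeneous 1 :=
  MvPolynomial.IsHomogeneous.sum _ _ _ fun i _ => by
    simpa using (MvPolynomial.isHomogeneous_C ι (l i)).mul (MvPolynomial.isHomogeneous_X R i)

/-- If the only common zero of the elements of an ideal is the origin, then the ideal contains all
forms of large degree. -/
theorem exists_isHomogeneous_mem {ι : Type*} [Finite ι] {I : Ideal (MvPolynomial ι ℂ)}
    (h : ∀ ξ : ι → ℂ, (∀ F ∈ I, MvPolynomial.eval ξ F = 0) → ξ = 0) :
    ∃ D : ℕ, ∀ d, D ≤ d → ∀ F : MvPolynomial ι ℂ, F.IsHomogeneous d → F ∈ I := by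
  have hle : MvPolynomial.idealOfVars ι ℂ ≤ I.radical := by
    rw [MvPolynomial.idealOfVars, Ideal.span_le]
    rintro _ ⟨i, rfl⟩
    rw [SetLike.mem_coe, ← MvPolynomial.vanishingIdeal_zeroLocus_eq_radical (K := ℂ)]
    intro ξ hξ
    have : ξ = 0 := h ξ fun F hF => hξ F hF
    simp [this]
  obtain ⟨D, hD⟩ := Ideal.exists_pow_le_of_le_radical_of_fg hle (MvPolynomial.idealOfVars_fg _ _)
  refine ⟨D, fun d hd F hF => hD ?_⟩
  rw [MvPolynomial.mem_pow_idealOfVars_iff']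
  intro e he
  by_contra h0
  have := hF h0
  have hdeg : e.degree = d := by rw [Finsupp.degree_eq_weight_one]; exact this
  omega

/-- The forms `q_j`, `lo ≤ j ≤ hi`, together with the linear form `l`. -/
noncomputable def formsWithLinear {ι R : Type*} [Fintype ι] [CommSemiring R] (lo hi : ℕ)
    (g : MvPolynomial ι R) (l : ι → R) : Option (Set.Icc lo hi) → MvPolynomial ι R
  | none => linForm l
  | some j => MvPolynomial.homogeneousComponent j g

theorem exists_representation {ι : Type*} [Fintype ι] {lo hi : ℕ}
    {g : MvPolynomial ι ℂ} {l : ι → ℂ}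
    (h : ∀ ξ : ι → ℂ, ∑ i, l i * ξ i = 0 → (∀ j, lo ≤ j → j ≤ hi →
      MvPolynomial.eval ξ (MvPolynomial.homogeneousComponent j g) = 0) → ξ = 0) :
    ∃ D : ℕ, ∀ d, D ≤ d → ∀ F : MvPolynomial ι ℂ, F.IsHomogeneous d →
      ∃ c : Option (Set.Icc lo hi) → MvPolynomial ι ℂ,
        ∑ i, c i * formsWithLinear lo hi g l i = F := by
  obtain ⟨D, hD⟩ := exists_isHomogeneous_mem
    (I := Ideal.span (Set.range (formsWithLinear lo hi g l))) (fun ξ hξ => by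
      refine h ξ ?_ fun j h1 h2 => ?_
      · rw [← eval_linForm]
        exact hξ _ (Ideal.subset_span ⟨none, rfl⟩)
      · exact hξ _ (Ideal.subset_span ⟨some ⟨j, h1, h2⟩, rfl⟩))
  exact ⟨D, fun d hd F hF => Ideal.mem_span_range_iff_exists_fun.1 (hD d hd F hF)⟩

theorem exists_linear_of_not_zerosMeetHyperplanes {ι : Type*} [Fintype ι] {lo hi : ℕ}
    {g : MvPolynomial ι ℂ} (h : ¬ ZerosMeetHyperplanes lo hi g) :
    ∃ l : ι → ℂ, ∀ ξ : ι → ℂ, ∑ i, l i * ξ i = 0 → (∀ j, lo ≤ j → j ≤ hi →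
      MvPolynomial.eval ξ (MvPolynomial.homogeneousComponent j g) = 0) → ξ = 0 := by
  simp only [ZerosMeetHyperplanes, not_forall, not_exists] at h
  obtain ⟨l, hl⟩ := h
  refine ⟨l, fun ξ h1 h2 => ?_⟩
  by_contra hξ
  exact hl ξ ⟨hξ, h1, h2⟩

theorem map_homogeneousComponent {ι R S : Type*} [CommSemiring R] [CommSemiring S] (f : R →+* S)
    (j : ℕ) (G : MvPolynomial ι R) :
    MvPolynomial.map f (MvPolynomial.homogeneousComponent j G) =
      MvPolynomial.homogeneousComponent j (MvPolynomial.map f G) := by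
  ext d
  rw [MvPolynomial.coeff_map, MvPolynomial.coeff_homogeneousComponent,
    MvPolynomial.coeff_homogeneousComponent, MvPolynomial.coeff_map]
  split_ifs <;> simp

theorem map_formsWithLinear {ι R S : Type*} [Fintype ι] [CommSemiring R] [CommSemiring S]
    (f : R →+* S) (lo hi : ℕ) (G : MvPolynomial ι R) (l : ι → R) (i : Option (Set.Icc lo hi)) :
    MvPolynomial.map f (formsWithLinear lo hi G l i) =
      formsWithLinear lo hi (MvPolynomial.map f G) (fun k => f (l k)) i := by
  cases i with
  | none => simp [formsWithLinear, linForm]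
  | some j => exact map_homogeneousComponent f j G

/-- Elimination with a fixed hyperplane and fixed cofactors. At `x` the cofactors express all
monomials of degree D through the forms. With indeterminate coefficients, the degree-D parts of the
same combinations give a square matrix that is the identity at `x`; whenever a common zero ξ on that
hyperplane exists, the monomials of ξ are a kernel vector and the determinant vanishes. -/
theorem exists_separating_zerosMeetHyperplanes {ι τ : Type*} [Fintype ι] {lo hi : ℕ}
    (G : MvPolynomial ι (MvPolynomial τ ℂ)) {x : τ → ℂ}
    (hx : ¬ ZerosMeetHyperplanes lo hi (MvPolynomial.map (MvPolynomial.eval x) G)) :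
    ∃ F : MvPolynomial τ ℂ, (∀ y, ZerosMeetHyperplanes lo hi
      (MvPolynomial.map (MvPolynomial.eval y) G) → MvPolynomial.eval y F = 0) ∧
      MvPolynomial.eval x F ≠ 0 := by
  classical
  obtain ⟨l, hl⟩ := exists_linear_of_not_zerosMeetHyperplanes hx
  obtain ⟨D, hD⟩ := exists_representation hl
  have := Fintype.ofFinite (Expts ι D)
  choose c hc using fun e : Expts ι D => hD D le_rfl (MvPolynomial.monomial e.1 1)
    (MvPolynomial.isHomogeneous_monomial 1 e.2)
  let W : Expts ι D → MvPolynomial ι (MvPolynomial τ ℂ) := fun e =>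
    ∑ i, MvPolynomial.map MvPolynomial.C (c e i) *
      formsWithLinear lo hi G (fun k => MvPolynomial.C (l k)) i
  have hCev : ∀ y : τ → ℂ, (MvPolynomial.eval y).comp MvPolynomial.C = RingHom.id ℂ := fun y => by
    ext; simp
  have hW : ∀ y e, MvPolynomial.map (MvPolynomial.eval y) (W e) =
      ∑ i, c e i * formsWithLinear lo hi (MvPolynomial.map (MvPolynomial.eval y) G) l i := by
    intro y e
    simp only [W, map_sum, map_mul, map_formsWithLinear, MvPolynomial.map_map, hCev,
      MvPolynomial.map_id, MvPolynomial.eval_C]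
  let E : Matrix (Expts ι D) (Expts ι D) (MvPolynomial τ ℂ) := fun e e' => (W e).coeff e'.1
  have hE : ∀ y, MvPolynomial.eval y E.det = Matrix.det (Matrix.of fun e e' : Expts ι D =>
      (MvPolynomial.map (MvPolynomial.eval y) (W e)).coeff e'.1) := by
    intro y
    rw [RingHom.map_det]
    congr 1
  refine ⟨E.det, fun y hy => ?_, ?_⟩
  · obtain ⟨ξ, hξ, h1, h2⟩ := hy l
    rw [hE, ← Matrix.exists_mulVec_eq_zero_iff]
    refine ⟨fun e => e.1.prod fun i n => ξ i ^ n, ?_, ?_⟩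
    · obtain ⟨i, hi⟩ := Function.ne_iff.1 hξ
      refine Function.ne_iff.2 ⟨⟨Finsupp.single i D, by simp⟩, ?_⟩
      simpa using pow_ne_zero D hi
    · ext e
      have h3 : radial ξ (MvPolynomial.map (MvPolynomial.eval y) (W e)) = 0 := by
        rw [hW, map_sum]
        refine Finset.sum_eq_zero fun i _ => ?_
        rw [map_mul]
        refine mul_eq_zero_of_right _ ?_
        cases i with
        | none =>
          rw [formsWithLinear, radial_of_isHomogeneous ξ (linForm_isHomogeneous l), eval_linForm,
            h1, map_zero, zero_mul]
        | some j =>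
          rw [formsWithLinear, radial_of_isHomogeneous ξ
            (MvPolynomial.homogeneousComponent_isHomogeneous _ _), h2 _ j.2.1 j.2.2, map_zero,
            zero_mul]
      have h4 := coeff_radial ξ (MvPolynomial.map (MvPolynomial.eval y) (W e)) D
      rw [h3, Polynomial.coeff_zero, eval_homogeneousComponent_eq_finsum,
        finsum_eq_sum_of_fintype] at h4
      exact h4.symm
  · rw [hE]
    have : (Matrix.of fun e e' : Expts ι D =>
        (MvPolynomial.map (MvPolynomial.eval x) (W e)).coeff e'.1) =
        (1 : Matrix (Expts ι D) (Expts ι D) ℂ) := by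
      ext e e'
      rw [Matrix.of_apply, hW, hc, MvPolynomial.coeff_monomial, Matrix.one_apply]
      simp only [Subtype.ext_iff]
    rw [this, Matrix.det_one]
    exact one_ne_zero

theorem Matrix.exists_mul_mul_eq_one {ι : Type*} [Fintype ι] [DecidableEq ι] {A : Matrix ι ι ℂ}
    {r : ℕ} (h : r ≤ A.rank) :
    ∃ (U : Matrix (Fin r) ι ℂ) (W : Matrix ι (Fin r) ℂ), U * A * W = 1 := by
  obtain ⟨b, hb⟩ := exists_linearIndependent_of_le_finrank (R := ℂ)
    (M := LinearMap.range A.mulVecLin) h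
  choose w hw using fun i => LinearMap.mem_range.1 (b i).2
  have hli : LinearIndependent ℂ (fun i => A.mulVec (w i)) := by
    have h1 : (fun i => A.mulVec (w i)) = (LinearMap.range A.mulVecLin).subtype ∘ b :=
      funext fun i => hw i
    rw [h1]
    exact hb.map' (LinearMap.range A.mulVecLin).subtype (Submodule.ker_subtype _)
  let W : Matrix ι (Fin r) ℂ := Matrix.of fun i j => w j i
  have hinj : Function.Injective (A * W).mulVecLin := by
    rw [Matrix.coe_mulVecLin, Matrix.mulVec_injective_iff]
    exact hli
  obtain ⟨L, hL⟩ := LinearMap.exists_leftInverse_of_injective _ (LinearMap.ker_eq_bot.2 hinj)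
  refine ⟨LinearMap.toMatrix' L, W, ?_⟩
  rw [Matrix.mul_assoc]
  have := congrArg LinearMap.toMatrix' hL
  rw [LinearMap.toMatrix'_comp, ← Matrix.toLin'_apply', LinearMap.toMatrix'_toLin',
    LinearMap.toMatrix'_id] at this
  exact this

/-- The constant matrices normalizing U A W to 1 at `x` play the role of a nonzero minor: det (U A
W) vanishes wherever the rank is at most r. -/
theorem exists_separating_rank {ι τ : Type*} [Fintype ι] [DecidableEq ι]
    (A : Matrix ι ι (MvPolynomial τ ℂ)) {r : ℕ} {x : τ → ℂ}
    (hx : ¬ (A.map (MvPolynomial.eval x)).rank ≤ r) :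
    ∃ F : MvPolynomial τ ℂ, (∀ y, (A.map (MvPolynomial.eval y)).rank ≤ r →
      MvPolynomial.eval y F = 0) ∧ MvPolynomial.eval x F ≠ 0 := by
  obtain ⟨U, W, hUW⟩ := Matrix.exists_mul_mul_eq_one (r := r + 1) (not_le.1 hx)
  let U' : Matrix (Fin (r + 1)) ι (MvPolynomial τ ℂ) := U.map MvPolynomial.C
  let W' : Matrix ι (Fin (r + 1)) (MvPolynomial τ ℂ) := W.map MvPolynomial.C
  have hev : ∀ y, MvPolynomial.eval y (U' * A * W').det =
      (U * A.map (MvPolynomial.eval y) * W).det := by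
    intro y
    rw [RingHom.map_det, RingHom.mapMatrix_apply, Matrix.map_mul, Matrix.map_mul, Matrix.map_map,
      Matrix.map_map]
    congr 3 <;> · ext; simp
  refine ⟨(U' * A * W').det, fun y hy => ?_, ?_⟩
  · rw [hev]
    by_contra hdet
    have h1 := Matrix.rank_of_isUnit _ ((Matrix.isUnit_iff_isUnit_det _).2
      (isUnit_iff_ne_zero.2 hdet))
    have h2 := (Matrix.rank_mul_le_left (U * A.map (MvPolynomial.eval y)) W).trans
      (Matrix.rank_mul_le_right U _)
    rw [h1, Fintype.card_fin] at h2
    omega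
  · rw [hev, hUW, Matrix.det_one]
    exact one_ne_zero

/-- Where the linear form equals 1 and the forms vanish, a monomial of degree above D reduces to
monomials of smaller degree. The polynomial functions on this set form a finite-dimensional space,
so powers of each coordinate are dependent and it takes finitely many values. -/
theorem finite_zeros_affine_hyperplane {ι : Type*} [Fintype ι] {lo hi : ℕ}
    {g : MvPolynomial ι ℂ} {l : ι → ℂ}
    (h : ∀ ξ : ι → ℂ, ∑ i, l i * ξ i = 0 → (∀ j, lo ≤ j → j ≤ hi →
      MvPolynomial.eval ξ (MvPolynomial.homogeneousComponent j g) = 0) → ξ = 0) :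
    {ξ : ι → ℂ | ∑ i, l i * ξ i = 1 ∧ ∀ j, lo ≤ j → j ≤ hi →
      MvPolynomial.eval ξ (MvPolynomial.homogeneousComponent j g) = 0}.Finite := by
  classical
  obtain ⟨D, hD⟩ := exists_representation h
  set Z := {ξ : ι → ℂ | ∑ i, l i * ξ i = 1 ∧ ∀ j, lo ≤ j → j ≤ hi →
      MvPolynomial.eval ξ (MvPolynomial.homogeneousComponent j g) = 0} with hZ
  let mon : (ι →₀ ℕ) → Z → ℂ := fun e ξ => e.prod fun i n => ξ.1 i ^ n
  set V : Submodule ℂ (Z → ℂ) := Submodule.span ℂ (mon '' {e | e.degree ≤ D}) with hV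
  have : Module.Finite ℂ V := Module.Finite.span_of_finite _
    ((Finsupp.finite_of_degree_le D).image _)
  have hmon : ∀ n (e : ι →₀ ℕ), e.degree ≤ D + n → mon e ∈ V := by
    intro n
    induction n with
    | zero => exact fun e he => Submodule.subset_span ⟨e, he, rfl⟩
    | succ n ih =>
      intro e he
      rcases Nat.lt_or_ge (D + n) e.degree with he' | he'
      · obtain ⟨c, hc⟩ := hD e.degree (by omega) (MvPolynomial.monomial e 1)
          (MvPolynomial.isHomogeneous_monomial 1 rfl)
        set F := MvPolynomial.homogeneousComponent (D + n) (c none) with hF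
        have heq : mon e = ∑ d ∈ F.support, F.coeff d • mon d := by
          ext ξ
          have h1 := congrArg (radial ξ.1) hc
          rw [radial_monomial, one_mul, map_sum, Fintype.sum_option] at h1
          rw [Finset.sum_eq_zero (fun j _ => by
            rw [map_mul, formsWithLinear, radial_of_isHomogeneous ξ.1
              (MvPolynomial.homogeneousComponent_isHomogeneous _ _), ξ.2.2 _ j.2.1 j.2.2,
              map_zero, zero_mul, mul_zero]), add_zero, map_mul, formsWithLinear,
            radial_of_isHomogeneous ξ.1 (linForm_isHomogeneous l), eval_linForm, ξ.2.1,
            Polynomial.C_1, one_mul, pow_one, show e.degree = D + n + 1 by omega] at h1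
          have h2 := congrArg (fun p => Polynomial.coeff p (D + n + 1)) h1
          simp only [Polynomial.coeff_mul_X, Polynomial.coeff_C_mul, Polynomial.coeff_X_pow,
            if_true, mul_one] at h2
          rw [coeff_radial, MvPolynomial.eval_eq'] at h2
          rw [Finset.sum_apply]
          simp only [Pi.smul_apply, smul_eq_mul, mon]
          rw [← h2]
          refine Finset.sum_congr rfl fun d _ => ?_
          rw [Finsupp.prod_fintype _ _ (fun _ => pow_zero _)]
        rw [heq]
        refine Submodule.sum_mem _ fun d hd => Submodule.smul_mem _ _ (ih d ?_)
        have h3 := MvPolynomial.mem_support_iff.1 hd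
        rw [hF, MvPolynomial.coeff_homogeneousComponent] at h3
        by_contra h4
        exact h3 (if_neg (by omega))
      · exact ih e he'
  have hval : ∀ i, ((fun ξ : ι → ℂ => ξ i) '' Z).Finite := by
    intro i
    have hdep := Module.Finite.not_linearIndependent_of_infinite (R := ℂ)
      (fun n : ℕ => (⟨mon (Finsupp.single i n), hmon n _ (by simp)⟩ : V))
    rw [linearIndependent_iff] at hdep
    push Not at hdep
    obtain ⟨a, ha, ha0⟩ := hdep
    let P : Polynomial ℂ := ∑ n ∈ a.support, Polynomial.monomial n (a n)
    have hP : P ≠ 0 := by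
      obtain ⟨n, hn⟩ := Finsupp.ne_iff.1 ha0
      intro h0
      have := congrArg (fun p => Polynomial.coeff p n) h0
      simp [P, Polynomial.coeff_monomial] at this
      exact hn this
    refine (P.rootSet_finite ℂ).subset ?_
    rintro _ ⟨ξ, hξ, rfl⟩
    rw [Polynomial.mem_rootSet]
    refine ⟨hP, ?_⟩
    have h1 := congrFun (congrArg Subtype.val ha) ⟨ξ, hξ⟩
    rw [Finsupp.linearCombination_apply, Finsupp.sum] at h1
    have h2 : ∀ n, mon (Finsupp.single i n) ⟨ξ, hξ⟩ = ξ i ^ n := fun n =>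
      Finsupp.prod_single_index (pow_zero _)
    simpa [P, h2, Polynomial.aeval_monomial] using h1
  refine (Set.Finite.pi' hval).subset fun ξ hξ i => ⟨ξ, hξ, rfl⟩

/-! ### Depth and dimension over a Noetherian local ring -/

section LocalDepth

open RingTheory.Sequence IsLocalRing
open scoped Pointwise

universe u

variable {R : Type u} [CommRing R] [IsLocalRing R]

/-- Dividing by a regular element lowers the maximal length of a regular sequence by one. -/
theorem exists_isRegular_quotSMulTop [IsNoetherianRing R] (M : Type u)
    [AddCommGroup M] [Module R M] [Module.Finite R M]
    {rs : List R} (hrs : IsRegular M rs) (hmem : ∀ r ∈ rs, r ∈ maximalIdeal R) {n : ℕ}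
    (hn : rs.length = n + 1) {x : R} (hx : IsSMulRegular M x) (hxm : x ∈ maximalIdeal R) :
    ∃ rs' : List R, rs'.length = n ∧ (∀ r ∈ rs', r ∈ maximalIdeal R) ∧
      IsRegular (QuotSMulTop x M) rs' := by
  have := hrs.nontrivial
  have hsmul : ∀ (L : Type u) [AddCommGroup L] [Module R L] [Module.Finite R L] [Nontrivial L],
      maximalIdeal R • (⊤ : Submodule R L) < ⊤ := fun L _ _ _ _ =>
    (Submodule.top_ne_ideal_smul_of_le_jacobson_annihilator
      (maximalIdeal_le_jacobson _)).symm.lt_top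
  have hnt : Nontrivial (QuotSMulTop x M) := nontrivial_quotSMulTop_of_mem_maximalIdeal M hxm
  -- Regular sequences of a given length are detected by the vanishing of Ext, which passes to the
  -- quotient by `x` through the long exact sequence with a shift of one degree.
  let M' : ModuleCat.{u} R := ModuleCat.of R M
  have h1 := (ModuleCat.exists_isRegular_tfae (maximalIdeal R) (n + 1) M' (hsmul M)).out 3 1
  have hext := h1.1 ⟨rs, hn, hmem, hrs⟩
  have h2 := (ModuleCat.exists_isRegular_tfae (maximalIdeal R) n
    (ModuleCat.of R (QuotSMulTop x M)) (hsmul _)).out 1 3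
  refine h2.1 fun i hi => ?_
  have zero1 := AddCommGrpCat.isZero_of_iff_subsingleton.mpr (hext i (by omega))
  have zero2 := AddCommGrpCat.isZero_of_iff_subsingleton.mpr (hext (i + 1) (by omega))
  have hx' : IsSMulRegular M' x := hx
  exact AddCommGrpCat.subsingleton_of_isZero <|
    CategoryTheory.ShortComplex.Exact.isZero_of_both_zeros
    ((CategoryTheory.Abelian.Ext.covariant_sequence_exact₃' _ hx'.smulShortComplex_shortExact)
      i (i + 1) rfl)
    (zero1.eq_zero_of_src _) (zero2.eq_zero_of_tgt _)

/-- The dimension of an associated prime is at least the length of a regular sequence. -/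
theorem length_le_ringKrullDim_quotient_of_isAssociatedPrime [IsNoetherianRing R] (rs : List R)
    (M : Type u)
    [AddCommGroup M] [Module R M] [Module.Finite R M] (hrs : IsRegular M rs)
    (hmem : ∀ r ∈ rs, r ∈ maximalIdeal R) {P : Ideal R} (hP : IsAssociatedPrime P M) :
    ((rs.length : ℕ) : WithBot ℕ∞) ≤ ringKrullDim (R ⧸ P) := by
  induction rs generalizing M P with
  | nil =>
    have := hP.isPrime
    exact ringKrullDim_nonneg_of_nontrivial
  | cons y rs ih =>
    have hPp := hP.isPrime
    obtain ⟨-, u, hu⟩ := isAssociatedPrime_iff.1 hP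
    have hmemP : ∀ {p : R}, p ∈ P ↔ p • u = 0 := by
      intro p
      rw [hu, Submodule.mem_colon_singleton, Submodule.mem_bot]
    have hu0 : u ≠ 0 := by
      rintro rfl
      exact hPp.ne_top (eq_top_iff.2 fun p _ => hmemP.2 (smul_zero p))
    obtain ⟨hy, hrs'⟩ := (isRegular_cons_iff M y rs).1 hrs
    have hym : y ∈ maximalIdeal R := hmem y (by simp)
    have hyP : y ∉ P := fun h => hu0 (hy (by simpa using hmemP.1 h))
    -- Let N be the submodule killed by `P`. If N lay inside yM, regularity of `y` would give N =
    -- yN, so N = 0 by Nakayama, although `u` lies in N. The class of `v` in M/yM leads to an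
    -- associated prime containing both `P` and `y`, hence of strictly smaller dimension.
    obtain ⟨v, hv, hvy⟩ : ∃ v : M, (∀ p ∈ P, p • v = 0) ∧ v ∉ y • (⊤ : Submodule R M) := by
      by_contra! hcon
      let N : Submodule R M :=
        { carrier := {v | ∀ p ∈ P, p • v = 0}
          zero_mem' := fun p _ => smul_zero p
          add_mem' := fun {a b} ha hb p hp => by rw [smul_add, ha p hp, hb p hp, add_zero]
          smul_mem' := fun c a ha p hp => by rw [smul_comm, ha p hp, smul_zero] }
      have hN : N ≤ Ideal.span {y} • N := by
        intro v hv
        obtain ⟨w, -, rfl⟩ := hcon v hv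
        rw [Submodule.ideal_span_singleton_smul]
        refine Submodule.smul_mem_pointwise_smul _ _ _ fun p hp => hy ?_
        have := hv p hp
        change p • y • w = 0 at this
        change y • p • w = y • 0
        rw [smul_comm, this, smul_zero]
      have hbot := Submodule.eq_bot_of_le_smul_of_le_jacobson_bot _ N
        (IsNoetherian.noetherian N) hN ((Ideal.span_singleton_le_iff_mem _).2
          (maximalIdeal_le_jacobson _ hym))
      have : u ∈ N := fun p hp => hmemP.1 hp
      rw [hbot] at this
      exact hu0 this
    obtain ⟨Q, hQ, hvQ⟩ := exists_le_isAssociatedPrime_of_isNoetherianRing R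
      (Submodule.Quotient.mk v : QuotSMulTop y M)
      (by rwa [Ne, Submodule.Quotient.mk_eq_zero])
    have hle : P ≤ Q := fun p hp => hvQ (by
      rw [Submodule.mem_colon_singleton, ← Submodule.Quotient.mk_smul, hv p hp,
        Submodule.Quotient.mk_zero]
      exact zero_mem _)
    have hyQ : y ∈ Q := hvQ (by
      rw [Submodule.mem_colon_singleton, ← Submodule.Quotient.mk_smul, Submodule.mem_bot,
        Submodule.Quotient.mk_eq_zero]
      exact Submodule.smul_mem_pointwise_smul _ _ _ trivial)
    have h1 := ih _ hrs' (fun r hr => hmem r (by simp [hr])) hQ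
    have hdom : IsDomain (R ⧸ P) := Ideal.Quotient.isDomain P
    have h2 := ringKrullDim_succ_le_of_surjective (Ideal.Quotient.factor hle)
      (Ideal.Quotient.factor_surjective hle) (r := Ideal.Quotient.mk P y)
      (mem_nonZeroDivisors_of_ne_zero (by rwa [Ne, Ideal.Quotient.eq_zero_iff_mem]))
      (by rw [Ideal.Quotient.factor_mk, Ideal.Quotient.eq_zero_iff_mem]; exact hyQ)
    refine le_trans ?_ h2
    rw [List.length_cons, Nat.cast_add, Nat.cast_one]
    gcongr

/-- Killing `xs` leaves dimension zero, and each element lowers the dimension by at most one. -/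
theorem ringKrullDim_quotient_le_length [IsNoetherianRing R] {P : Ideal R} [P.IsPrime] (xs : List R)
    (hxs : ∀ x ∈ xs, x ∈ maximalIdeal R)
    (h : maximalIdeal R ≤ (P ⊔ Ideal.ofList xs).radical) :
    ringKrullDim (R ⧸ P) ≤ ((xs.length : ℕ) : WithBot ℕ∞) := by
  classical
  have : IsLocalRing (R ⧸ P) := .of_surjective' _ Ideal.Quotient.mk_surjective
  have hmk : ∀ x ∈ maximalIdeal R, Ideal.Quotient.mk P x ∈ maximalIdeal (R ⧸ P) := by
    intro x hx
    refine (mem_maximalIdeal _).2 fun hu => ?_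
    obtain ⟨a, ha⟩ := hu.exists_right_inv
    obtain ⟨a, rfl⟩ := Ideal.Quotient.mk_surjective a
    rw [← map_mul, ← map_one (Ideal.Quotient.mk P), Ideal.Quotient.eq] at ha
    have h1 := sub_mem (Ideal.mul_mem_right a _ hx) (le_maximalIdeal (Ideal.IsPrime.ne_top ‹_›) ha)
    rw [sub_sub_cancel] at h1
    exact (Ideal.ne_top_iff_one _).1 (maximalIdeal.isMaximal R).ne_top h1
  let s : Finset (R ⧸ P) := (xs.map (Ideal.Quotient.mk P)).toFinset
  have hs : (s : Set (R ⧸ P)) ⊆ Ring.jacobson (R ⧸ P) := by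
    intro z hz
    rw [SetLike.mem_coe, IsLocalRing.ringJacobson_eq_maximalIdeal]
    obtain ⟨x, hx, rfl⟩ := List.mem_map.1 (List.mem_toFinset.1 hz)
    exact hmk x (hxs x hx)
  have hdim : ringKrullDim ((R ⧸ P) ⧸ Ideal.span (s : Set (R ⧸ P))) ≤ (0 : ℕ) := by
    rw [← Ring.krullDimLE_iff, Ideal.krullDimLE_zero_quotient_iff_forall_minimalPrimes_isMaximal]
    intro J hJ
    have hJp : J.IsPrime := hJ.1.1
    have hmJ : maximalIdeal R ≤ J.comap (Ideal.Quotient.mk P) := by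
      refine h.trans ((Ideal.IsPrime.radical_le_iff (Ideal.comap_isPrime _ _)).2 (sup_le ?_ ?_))
      · intro p hp
        rw [Ideal.mem_comap, Ideal.Quotient.eq_zero_iff_mem.2 hp]
        exact zero_mem _
      · refine Ideal.span_le.2 fun x hx => hJ.1.2 (Ideal.subset_span ?_)
        exact List.mem_toFinset.2 (List.mem_map_of_mem hx)
    have heq : maximalIdeal (R ⧸ P) = J := by
      refine (maximalIdeal.isMaximal (R ⧸ P)).eq_of_le hJp.ne_top fun a ha => ?_
      obtain ⟨r, rfl⟩ := Ideal.Quotient.mk_surjective a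
      refine hmJ ((mem_maximalIdeal r).2 fun hr => ?_)
      exact (mem_maximalIdeal _).1 ha (hr.map (Ideal.Quotient.mk P))
    rw [← heq]
    exact maximalIdeal.isMaximal _
  refine (ringKrullDim_le_ringKrullDim_quotient_add_card s hs).trans ?_
  refine (add_le_add_left hdim _).trans ?_
  rw [Nat.cast_zero, zero_add]
  exact_mod_cast (List.toFinset_card_le _).trans (List.length_map _).le

/-- The Cohen–Macaulay argument: a zero divisor x lies in an associated prime P. Then R/P has
dimension at most the number of remaining elements, which is less than the depth and contradicts the
bound for associated primes. -/
theorem isWeaklyRegular_of_maximalIdeal_le_radical [IsNoetherianRing R] (xs : List R)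
    (M : Type u) [AddCommGroup M]
    [Module R M] [Module.Finite R M] {rs : List R} (hrs : IsRegular M rs)
    (hmem : ∀ r ∈ rs, r ∈ maximalIdeal R) (hlen : rs.length = xs.length)
    (hxs : ∀ x ∈ xs, x ∈ maximalIdeal R)
    (h : maximalIdeal R ≤ (Module.annihilator R M ⊔ Ideal.ofList xs).radical) :
    IsWeaklyRegular M xs := by
  induction xs generalizing M rs with
  | nil => exact IsWeaklyRegular.nil R M
  | cons x xs ih =>
    have hxm : x ∈ maximalIdeal R := hxs x (by simp)
    have hxr : IsSMulRegular M x := by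
      rw [isSMulRegular_iff_right_eq_zero_of_smul]
      intro u hu
      by_contra hu0
      obtain ⟨P, hP, hxP⟩ : ∃ P, IsAssociatedPrime P M ∧ x ∈ P := by
        obtain ⟨P, hP, hle⟩ := exists_le_isAssociatedPrime_of_isNoetherianRing R u hu0
        exact ⟨P, hP, hle (by rw [Submodule.mem_colon_singleton, hu]; exact zero_mem _)⟩
      have := hP.isPrime
      have h1 := length_le_ringKrullDim_quotient_of_isAssociatedPrime rs M hrs hmem hP
      have h2 := ringKrullDim_quotient_le_length (P := P) xs (fun z hz => hxs z (by simp [hz]))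
        (h.trans (Ideal.radical_mono (sup_le (le_sup_of_le_left ?_) ?_)))
      · have h3 := h1.trans h2
        rw [hlen, List.length_cons] at h3
        have h4 : xs.length + 1 ≤ xs.length := by exact_mod_cast h3
        omega
      · rw [← Submodule.annihilator_top]
        exact hP.annihilator_le
      · rw [Ideal.ofList_cons]
        exact sup_le (le_sup_of_le_left ((Ideal.span_singleton_le_iff_mem _).2 hxP)) le_sup_right
    obtain ⟨rs', hlen', hmem', hrs'⟩ := exists_isRegular_quotSMulTop M hrs hmem
      (n := xs.length) (by rw [hlen, List.length_cons]) hxr hxm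
    refine IsWeaklyRegular.cons hxr (ih _ hrs' hmem' hlen' (fun z hz => hxs z (by simp [hz])) ?_)
    refine h.trans (Ideal.radical_mono ?_)
    rw [Ideal.ofList_cons]
    refine sup_le (le_sup_of_le_left ?_) (sup_le (le_sup_of_le_left ?_) le_sup_right)
    · intro a ha
      rw [Module.mem_annihilator] at ha ⊢
      intro z
      obtain ⟨z, rfl⟩ := Submodule.Quotient.mk_surjective _ z
      rw [← Submodule.Quotient.mk_smul, ha, Submodule.Quotient.mk_zero]
    · rw [Ideal.span_singleton_le_iff_mem, Module.mem_annihilator]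
      intro z
      obtain ⟨z, rfl⟩ := Submodule.Quotient.mk_surjective _ z
      rw [← Submodule.Quotient.mk_smul, Submodule.Quotient.mk_eq_zero]
      exact Submodule.smul_mem_pointwise_smul _ _ _ trivial

end LocalDepth

/-! ### Forms with only the trivial common zero -/

section PolynomialRegular

open RingTheory.Sequence IsLocalRing

variable {n : ℕ}

theorem isWeaklyRegular_X (k : Type*) [Field k] :
    IsWeaklyRegular (MvPolynomial (Fin n) k)
      (List.ofFn fun i : Fin n => (MvPolynomial.X i : MvPolynomial (Fin n) k)) := by
  rw [isWeaklyRegular_iff]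
  intro i hi
  rw [List.length_ofFn] at hi
  rw [isSMulRegular_iff_right_eq_zero_of_smul]
  intro z hz
  obtain ⟨g, rfl⟩ := Submodule.Quotient.mk_surjective _ z
  have hI : (Ideal.ofList ((List.ofFn fun i : Fin n => (MvPolynomial.X i :
      MvPolynomial (Fin n) k)).take i) • ⊤ : Submodule (MvPolynomial (Fin n) k) _) =
      Ideal.span (MvPolynomial.X '' {j : Fin n | (j : ℕ) < i}) := by
    rw [smul_eq_mul, Ideal.mul_top, Ideal.ofList]
    congr 1
    ext f
    simp only [Set.mem_ofPred_eq, List.mem_take_iff_getElem, List.getElem_ofFn, List.length_ofFn,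
      Set.mem_image]
    constructor
    · rintro ⟨j, hj, rfl⟩
      exact ⟨⟨j, by omega⟩, by simp only; omega, rfl⟩
    · rintro ⟨j, hj, rfl⟩
      exact ⟨j, by omega, rfl⟩
  rw [← Submodule.Quotient.mk_smul, Submodule.Quotient.mk_eq_zero, hI, List.getElem_ofFn,
    smul_eq_mul, MvPolynomial.mem_ideal_span_X_image] at hz
  rw [Submodule.Quotient.mk_eq_zero, hI, MvPolynomial.mem_ideal_span_X_image]
  intro m hm
  obtain ⟨j, hj, hjm⟩ := hz (m + Finsupp.single ⟨i, hi⟩ 1) (by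
    rw [MvPolynomial.mem_support_iff] at hm ⊢
    rwa [mul_comm, MvPolynomial.coeff_mul_X])
  refine ⟨j, hj, ?_⟩
  rw [Finsupp.add_apply, Finsupp.single_apply, if_neg, add_zero] at hjm
  · exact hjm
  · rintro rfl
    exact absurd (show i < i from hj) (lt_irrefl _)

attribute [local instance] MvPolynomial.gradedAlgebra

/-- After scaling, s = 1 - a with `a` without constant term, so g is congruent to a^N g modulo `I`
for every N. For N > j the component of degree j of a^N g is zero, and `I` is homogeneous. -/
theorem mem_of_mul_mem_of_constantCoeff_ne_zero {ι k : Type*} [Field k]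
    {I : Ideal (MvPolynomial ι k)} (hI : I.IsHomogeneous (MvPolynomial.homogeneousSubmodule ι k))
    {s g : MvPolynomial ι k} (hs : MvPolynomial.constantCoeff s ≠ 0) (h : s * g ∈ I) : g ∈ I := by
  rw [MvPolynomial.mem_iff_homogeneousComponent_mem hI]
  intro j
  set a : MvPolynomial ι k := 1 - MvPolynomial.C (MvPolynomial.constantCoeff s)⁻¹ * s with ha
  have ha1 : a ∈ MvPolynomial.idealOfVars ι k := by
    rw [← pow_one (MvPolynomial.idealOfVars ι k), MvPolynomial.mem_pow_idealOfVars_iff']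
    intro e he
    have : e = 0 := (Finsupp.degree_eq_zero_iff e).1 (by omega)
    rw [this, ← MvPolynomial.constantCoeff_eq, ha]
    simp [hs]
  have hag : ∀ N : ℕ, g - a ^ N * g ∈ I := by
    intro N
    induction N with
    | zero => simp
    | succ N ih =>
      have : g - a ^ (N + 1) * g = (g - a ^ N * g) +
          a ^ N * MvPolynomial.C (MvPolynomial.constantCoeff s)⁻¹ * (s * g) := by
        rw [pow_succ, ha]; ring
      rw [this]
      exact add_mem ih (Ideal.mul_mem_left _ _ h)
  have hz : MvPolynomial.homogeneousComponent j (a ^ (j + 1) * g) = 0 := by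
    have hmem : a ^ (j + 1) * g ∈ MvPolynomial.idealOfVars ι k ^ (j + 1) :=
      Ideal.mul_mem_right _ _ (Ideal.pow_mem_pow ha1 _)
    rw [MvPolynomial.mem_pow_idealOfVars_iff'] at hmem
    ext e
    rw [MvPolynomial.coeff_homogeneousComponent, MvPolynomial.coeff_zero]
    split_ifs with he
    · exact hmem e (by omega)
    · rfl
  have := MvPolynomial.homogeneousComponent_mem_of_mem hI (hag (j + 1)) j
  rwa [map_sub, hz, sub_zero] at this

/-- Forms of positive degree in `n` variables, `n` in number, whose only common zero is the origin
form a regular sequence. -/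
theorem isWeaklyRegular_of_forall_zero {xs : List (MvPolynomial (Fin n) ℂ)} (hlen : xs.length = n)
    (hhom : ∀ f ∈ xs, ∃ d, 0 < d ∧ f.IsHomogeneous d)
    (h : ∀ ξ : Fin n → ℂ, (∀ f ∈ xs, MvPolynomial.eval ξ f = 0) → ξ = 0) :
    IsWeaklyRegular (MvPolynomial (Fin n) ℂ) xs := by
  let p : Ideal (MvPolynomial (Fin n) ℂ) := RingHom.ker MvPolynomial.constantCoeff
  have hp : p.IsPrime := RingHom.ker_isPrime _
  have hpvars : p ≤ MvPolynomial.idealOfVars (Fin n) ℂ := by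
    intro f hf
    rw [← pow_one (MvPolynomial.idealOfVars (Fin n) ℂ), MvPolynomial.mem_pow_idealOfVars_iff']
    intro e he
    rw [(Finsupp.degree_eq_zero_iff e).1 (by omega), ← MvPolynomial.constantCoeff_eq]
    exact hf
  have hxp : ∀ f ∈ xs, f ∈ p := by
    intro f hf
    obtain ⟨d, hd, hfd⟩ := hhom f hf
    rw [RingHom.mem_ker, MvPolynomial.constantCoeff_eq]
    exact hfd.coeff_eq_zero (by simpa using hd.ne)
  let R := Localization.AtPrime p
  have hmax : maximalIdeal R = p.map (algebraMap _ R) :=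
    (Localization.AtPrime.map_eq_maximalIdeal).symm
  have hmaxmem : ∀ f ∈ p, algebraMap _ R f ∈ maximalIdeal R := fun f hf => by
    rw [hmax]; exact Ideal.mem_map_of_mem _ hf
  have hX : IsRegular R ((List.ofFn fun i : Fin n =>
      (MvPolynomial.X i : MvPolynomial (Fin n) ℂ)).map (algebraMap _ R)) := by
    refine (isWeaklyRegular_X ℂ).isRegular_of_isLocalization_of_mem R p fun r hr => ?_
    obtain ⟨i, rfl⟩ := (List.mem_ofFn' _ _).1 hr
    exact MvPolynomial.constantCoeff_X _ i
  have hrad : p ≤ (Ideal.ofList xs).radical := by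
    obtain ⟨D, hD⟩ := exists_isHomogeneous_mem (I := Ideal.ofList xs)
      (fun ξ hξ => h ξ fun f hf => hξ f (Ideal.subset_span hf))
    refine hpvars.trans (Ideal.span_le.2 ?_)
    rintro _ ⟨i, rfl⟩
    exact ⟨D, hD D le_rfl _ (by simpa using (MvPolynomial.isHomogeneous_X ℂ i).pow D)⟩
  have hloc : IsWeaklyRegular R (xs.map (algebraMap _ R)) := by
    refine isWeaklyRegular_of_maximalIdeal_le_radical _ R hX ?_ (by simp [hlen]) ?_ ?_
    · intro r hr
      obtain ⟨f, hf, rfl⟩ := List.mem_map.1 hr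
      obtain ⟨i, rfl⟩ := (List.mem_ofFn' _ _).1 hf
      exact hmaxmem _ (MvPolynomial.constantCoeff_X _ i)
    · intro r hr
      obtain ⟨f, hf, rfl⟩ := List.mem_map.1 hr
      exact hmaxmem _ (hxp f hf)
    · refine le_trans ?_ (Ideal.radical_mono le_sup_right)
      rw [hmax, ← Ideal.map_ofList]
      exact (Ideal.map_mono hrad).trans (Ideal.map_radical_le _)
  rw [isWeaklyRegular_iff] at hloc ⊢
  intro i hi
  have hloc' := hloc i (by simpa using hi)
  rw [isSMulRegular_iff_right_eq_zero_of_smul] at hloc' ⊢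
  intro z hz
  obtain ⟨g, rfl⟩ := Submodule.Quotient.mk_surjective _ z
  rw [← Submodule.Quotient.mk_smul, Submodule.Quotient.mk_eq_zero, smul_eq_mul, smul_eq_mul,
    Ideal.mul_top] at hz
  have h1 := hloc' (Submodule.Quotient.mk (algebraMap _ R g)) (by
    rw [← Submodule.Quotient.mk_smul, Submodule.Quotient.mk_eq_zero, smul_eq_mul, smul_eq_mul,
      Ideal.mul_top, ← List.map_take, ← Ideal.map_ofList, List.getElem_map, ← map_mul]
    exact Ideal.mem_map_of_mem _ hz)
  rw [Submodule.Quotient.mk_eq_zero, smul_eq_mul, Ideal.mul_top, ← List.map_take,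
    ← Ideal.map_ofList, IsLocalization.algebraMap_mem_map_algebraMap_iff p.primeCompl] at h1
  obtain ⟨s, hs, hsg⟩ := h1
  rw [Submodule.Quotient.mk_eq_zero, smul_eq_mul, Ideal.mul_top]
  -- Localization at the origin loses nothing for homogeneous ideals: a denominator is nonzero there
  -- and can be cancelled.
  refine mem_of_mul_mem_of_constantCoeff_ne_zero ?_ hs hsg
  refine Ideal.homogeneous_span _ _ fun f hf => ?_
  obtain ⟨d, -, hfd⟩ := hhom f (List.mem_of_mem_take hf)
  exact ⟨d, hfd⟩

end PolynomialRegular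

/-! ### Affine charts and local equations -/

noncomputable instance (M : ℕ) : Fintype (LocalIndex M) := Fintype.ofFinite _

/-- The polynomial with coefficients `a`. -/
noncomputable def localPoly {M : ℕ} {R : Type*} [CommRing R] (a : LocalIndex M → R) :
    MvPolynomial (Fin M) R :=
  ∑ d, MvPolynomial.monomial d.1 (a d)

theorem coeff_localPoly {M : ℕ} {R : Type*} [CommRing R] (a : LocalIndex M → R)
    (d : Fin M →₀ ℕ) : (localPoly a).coeff d = if h : d.degree ≤ M then a ⟨d, h⟩ else 0 := by
  classical
  rw [localPoly, MvPolynomial.coeff_sum]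
  simp only [MvPolynomial.coeff_monomial]
  split_ifs with h
  · rw [Finset.sum_eq_single ⟨d, h⟩]
    · simp
    · intro e _ he
      rw [if_neg fun h => he (Subtype.ext h)]
    · simp
  · refine Finset.sum_eq_zero fun e _ => if_neg ?_
    rintro rfl
    exact h e.2

theorem map_localPoly {M : ℕ} {R S : Type*} [CommRing R] [CommRing S] (φ : R →+* S)
    (a : LocalIndex M → R) : MvPolynomial.map φ (localPoly a) = localPoly fun d => φ (a d) := by
  simp [localPoly]

theorem localPoly_coeff {M : ℕ} {R : Type*} [CommRing R] {g : MvPolynomial (Fin M) R}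
    (hg : g.totalDegree ≤ M) : localPoly (fun d => g.coeff d.1) = g := by
  ext d
  rw [coeff_localPoly]
  split_ifs with h
  · rfl
  · symm
    refine MvPolynomial.coeff_eq_zero_of_totalDegree_lt ?_
    rw [← Finsupp.degree_apply]
    omega

theorem localCoeffs_localPoly {M : ℕ} (a : LocalIndex M → ℂ) :
    localCoeffs (localPoly a) = Set.range a := by
  unfold localCoeffs
  congr 1
  ext d
  rw [coeff_localPoly, dif_pos d.2]

/-- The form of degree `M` whose expansion at the point with affine coordinates `y` in the chart
`X_i = 1` has coefficients `a`. -/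
noncomputable def globalForm {M : ℕ} {R : Type*} [CommRing R] (i : Fin (M + 1)) (y : Fin M → R)
    (a : LocalIndex M → R) : MvPolynomial (Fin (M + 1)) R :=
  ∑ d, MvPolynomial.C (a d) * MvPolynomial.X i ^ (M - d.1.degree) *
    ∏ k, (MvPolynomial.X (i.succAbove k) - MvPolynomial.C (y k) * MvPolynomial.X i) ^ d.1 k

theorem map_globalForm {M : ℕ} {R S : Type*} [CommRing R] [CommRing S] (φ : R →+* S)
    (i : Fin (M + 1)) (y : Fin M → R) (a : LocalIndex M → R) :
    MvPolynomial.map φ (globalForm i y a) =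
      globalForm i (fun k => φ (y k)) (fun d => φ (a d)) := by
  simp [globalForm]

/-- The universal coefficients of `globalForm`. -/
noncomputable def universalCoeff {M : ℕ} (i : Fin (M + 1)) (c : Fin (M + 1) →₀ ℕ) :
    MvPolynomial (Fin M ⊕ LocalIndex M) ℚ :=
  (globalForm i (fun k => MvPolynomial.X (Sum.inl k)) (fun d => MvPolynomial.X (Sum.inr d))).coeff c

theorem aeval_universalCoeff {M : ℕ} (i : Fin (M + 1)) (c : Fin (M + 1) →₀ ℕ)
    (x : Fin M ⊕ LocalIndex M → ℂ) : MvPolynomial.aeval x (universalCoeff i c) =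
      (globalForm i (fun k => x (Sum.inl k)) (fun d => x (Sum.inr d))).coeff c := by
  have h := map_globalForm ((MvPolynomial.aeval x : _ →ₐ[ℚ] ℂ) :
    MvPolynomial (Fin M ⊕ LocalIndex M) ℚ →+* ℂ) i
    (fun k => MvPolynomial.X (Sum.inl k)) (fun d => MvPolynomial.X (Sum.inr d))
  simp only [RingHom.coe_coe, MvPolynomial.aeval_X] at h
  rw [← h, MvPolynomial.coeff_map]
  rfl

theorem eval_localEquation {M : ℕ} (f : MvPolynomial (Fin (M + 1)) ℂ) (p : Fin (M + 1) → ℂ)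
    (b : Fin M → Fin (M + 1) → ℂ) (z : Fin M → ℂ) :
    MvPolynomial.eval z (localEquation f p b) = MvPolynomial.eval (p + ∑ k, z k • b k) f := by
  have h : (MvPolynomial.aeval z).comp (MvPolynomial.aeval (R := ℂ) (fun j =>
      (MvPolynomial.C (p j) +
      ∑ k, MvPolynomial.C (b k j) * MvPolynomial.X k : MvPolynomial (Fin M) ℂ))) =
      MvPolynomial.aeval (R := ℂ) (p + ∑ k, z k • b k) := by
    ext j
    simp [mul_comm]
  exact congrArg (fun φ => φ f) h

theorem totalDegree_localEquation_le {M : ℕ} {f : MvPolynomial (Fin (M + 1)) ℂ}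
    (hf : f.IsHomogeneous M) (p : Fin (M + 1) → ℂ) (b : Fin M → Fin (M + 1) → ℂ) :
    (localEquation f p b).totalDegree ≤ M := by
  have hlin : ∀ j, (MvPolynomial.C (p j) + ∑ k, MvPolynomial.C (b k j) * MvPolynomial.X k :
      MvPolynomial (Fin M) ℂ).totalDegree ≤ 1 := by
    intro j
    refine (MvPolynomial.totalDegree_add _ _).trans (max_le (by simp) ?_)
    refine MvPolynomial.totalDegree_finsetSum_le fun k _ => ?_
    refine (MvPolynomial.totalDegree_mul _ _).trans ?_
    simp
  rw [localEquation, MvPolynomial.aeval_def, MvPolynomial.eval₂_eq]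
  refine MvPolynomial.totalDegree_finsetSum_le fun d hd => ?_
  refine (MvPolynomial.totalDegree_mul _ _).trans ?_
  rw [MvPolynomial.algebraMap_eq, MvPolynomial.totalDegree_C, zero_add]
  refine (MvPolynomial.totalDegree_finsetProd _ _).trans ?_
  have hdeg : d.degree = M := by
    rw [Finsupp.degree_eq_weight_one]; exact hf (MvPolynomial.mem_support_iff.1 hd)
  refine le_trans ?_ ((Finsupp.degree_apply d).symm.trans hdeg).le
  refine Finset.sum_le_sum fun j _ => (MvPolynomial.totalDegree_pow _ _).trans ?_
  exact (Nat.mul_le_mul_left _ (hlin j)).trans (mul_one _).le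

theorem coeff_single_eq_eval_pderiv {ι : Type*} (k : ι) (g : MvPolynomial ι ℂ) :
    g.coeff (Finsupp.single k 1) = MvPolynomial.eval 0 (MvPolynomial.pderiv k g) := by
  rw [MvPolynomial.eval_zero, MvPolynomial.constantCoeff_eq, MvPolynomial.coeff_pderiv]
  simp

theorem eval_zero_pderiv_localEquation {M : ℕ} (f : MvPolynomial (Fin (M + 1)) ℂ)
    (p : Fin (M + 1) → ℂ) (b : Fin M → Fin (M + 1) → ℂ) (k : Fin M) :
    MvPolynomial.eval 0 (MvPolynomial.pderiv k (localEquation f p b)) =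
      ∑ j, b k j * MvPolynomial.eval p (MvPolynomial.pderiv j f) := by
  classical
  have h0 : ∀ f, MvPolynomial.eval 0 (localEquation f p b) = MvPolynomial.eval p f := by
    intro f; rw [eval_localEquation]; simp
  induction f using MvPolynomial.induction_on with
  | C a => simp [localEquation]
  | add f g hf hg =>
    have : localEquation (f + g) p b = localEquation f p b + localEquation g p b := map_add _ _ _
    simp only [this, map_add, hf, hg, mul_add, Finset.sum_add_distrib]
  | mul_X f j hf =>
    have h1 : localEquation (f * MvPolynomial.X j) p b = localEquation f p b *
        localEquation (MvPolynomial.X j) p b := map_mul _ _ _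
    have h2 : MvPolynomial.eval 0 (MvPolynomial.pderiv k (localEquation (MvPolynomial.X j) p b)) =
        b k j := by
      simp [localEquation, MvPolynomial.pderiv_X, Pi.single_apply]
    rw [h1, Derivation.leibniz]
    simp only [smul_eq_mul, map_add, map_mul, hf, h0, h2, Derivation.leibniz, MvPolynomial.eval_X,
      MvPolynomial.pderiv_X, mul_add, Finset.sum_add_distrib, Finset.mul_sum]
    simp only [Pi.single_apply, apply_ite (MvPolynomial.eval p), map_one, map_zero]
    simp only [mul_ite, mul_one, mul_zero, Finset.sum_ite_eq, Finset.mem_univ, if_true]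
    rw [mul_comm (b k j)]
    congr 1
    exact Finset.sum_congr rfl fun _ _ => by ring

/-- The basis of the chart `X_i ≠ 0` adapted to the point `p`. -/
noncomputable def chartBasis {M : ℕ} (p : Fin (M + 1) → ℂ) (i : Fin (M + 1)) :
    Fin M → Fin (M + 1) → ℂ :=
  fun k => p i • Pi.single (i.succAbove k) 1

theorem sum_chartBasis_apply_self {M : ℕ} (p : Fin (M + 1) → ℂ) (i : Fin (M + 1)) (z : Fin M → ℂ) :
    (∑ k, z k • chartBasis p i k) i = 0 := by
  simp [chartBasis, Finset.sum_apply, (Fin.succAbove_ne i _).symm]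

theorem sum_chartBasis_apply_succAbove {M : ℕ} (p : Fin (M + 1) → ℂ) (i : Fin (M + 1))
    (z : Fin M → ℂ) (m : Fin M) :
    (∑ k, z k • chartBasis p i k) (i.succAbove m) = z m * p i := by
  simp [chartBasis, Finset.sum_apply, Pi.single_apply]

theorem eval_globalForm {M : ℕ} (i : Fin (M + 1)) (y : Fin M → ℂ) (a : LocalIndex M → ℂ)
    (w : Fin (M + 1) → ℂ) (z : Fin M → ℂ) (hz : ∀ k, z k * w i = w (i.succAbove k) - y k * w i) :
    MvPolynomial.eval w (globalForm i y a) = w i ^ M * MvPolynomial.eval z (localPoly a) := by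
  rw [globalForm, localPoly, map_sum, map_sum, Finset.mul_sum]
  refine Finset.sum_congr rfl fun d _ => ?_
  simp only [map_mul, map_pow, map_prod, map_sub, MvPolynomial.eval_C, MvPolynomial.eval_X,
    MvPolynomial.eval_monomial, ← hz, mul_pow, Finset.prod_mul_distrib, Finset.prod_pow_eq_pow_sum]
  rw [Finsupp.prod_fintype _ _ (fun _ => pow_zero _), ← Finsupp.degree_eq_sum]
  have : w i ^ M = w i ^ (M - d.1.degree) * w i ^ d.1.degree := by
    rw [← pow_add, Nat.sub_add_cancel d.2]
  rw [this]
  ring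

/-- A form is recovered, up to a factor, from the affine coordinates of a point and its local
coefficients there. The factor p_i^M appears because `chartBasis` consists of p_i times standard
basis vectors. -/
theorem globalForm_eq {M : ℕ} {f : MvPolynomial (Fin (M + 1)) ℂ} (hf : f.IsHomogeneous M)
    {p : Fin (M + 1) → ℂ} {i : Fin (M + 1)} (hp : p i ≠ 0) (c : ℂ) :
    globalForm i (fun k => p (i.succAbove k) / p i)
      (fun d => c * (localEquation f p (chartBasis p i)).coeff d.1) =
      MvPolynomial.C (c * p i ^ M) * f := by
  set G := localEquation f p (chartBasis p i) with hG
  have hloc : localPoly (fun d : LocalIndex M => c * G.coeff d.1) = MvPolynomial.C c * G := by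
    conv_rhs => rw [← localPoly_coeff (g := G)
      (totalDegree_localEquation_le hf p (chartBasis p i))]
    rw [localPoly, localPoly, Finset.mul_sum]
    exact Finset.sum_congr rfl fun d _ => (MvPolynomial.C_mul_monomial ..).symm
  have hX : (MvPolynomial.X i : MvPolynomial (Fin (M + 1)) ℂ) ≠ 0 := MvPolynomial.X_ne_zero i
  refine mul_left_cancel₀ hX (MvPolynomial.funext fun w => ?_)
  rw [map_mul, map_mul, MvPolynomial.eval_X]
  by_cases hw : w i = 0
  · rw [hw, zero_mul, zero_mul]
  congr 1
  let z : Fin M → ℂ := fun k => w (i.succAbove k) / w i - p (i.succAbove k) / p i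
  rw [eval_globalForm i _ _ w z (fun k => by simp only [z]; field_simp), hloc, map_mul, map_mul,
    MvPolynomial.eval_C, MvPolynomial.eval_C, hG, eval_localEquation]
  have hwz : w = (w i / p i) • (p + ∑ k, z k • chartBasis p i k) := by
    ext j
    rw [Pi.smul_apply, Pi.add_apply]
    rcases Fin.eq_self_or_eq_succAbove i j with rfl | ⟨m, rfl⟩
    · rw [sum_chartBasis_apply_self, add_zero, smul_eq_mul, div_mul_cancel₀ _ hp]
    · rw [sum_chartBasis_apply_succAbove, smul_eq_mul]
      simp only [z]
      field_simp
      ring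
  have hev := hf.eval_smul (w i / p i) (p + ∑ k, z k • chartBasis p i k)
  rw [← hwz] at hev
  rw [hev, div_pow]
  field_simp

/-- Euler's formula shows that the derivative in the direction X_i vanishes once f and all other
derivatives do. -/
theorem isSmoothPoint_iff {M : ℕ} {f : MvPolynomial (Fin (M + 1)) ℂ} (hf : f.IsHomogeneous M)
    {p : Fin (M + 1) → ℂ} {i : Fin (M + 1)} (hp : p i ≠ 0) (hfp : MvPolynomial.eval p f = 0) :
    IsSmoothPoint f p ↔
      ∃ k, (localEquation f p (chartBasis p i)).coeff (Finsupp.single k 1) ≠ 0 := by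
  have hco : ∀ k, (localEquation f p (chartBasis p i)).coeff (Finsupp.single k 1) =
      p i * MvPolynomial.eval p (MvPolynomial.pderiv (i.succAbove k) f) := by
    intro k
    rw [coeff_single_eq_eval_pderiv, eval_zero_pderiv_localEquation]
    simp [chartBasis, Pi.single_apply]
  constructor
  · rintro ⟨j, hj⟩
    by_contra! hcon
    have hz : ∀ k, MvPolynomial.eval p (MvPolynomial.pderiv (i.succAbove k) f) = 0 := fun k => by
      have := hcon k
      rw [hco] at this
      exact (mul_eq_zero.1 this).resolve_left hp
    have heuler := congrArg (MvPolynomial.eval p) hf.sum_X_mul_pderiv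
    rw [map_sum, Fin.sum_univ_succAbove _ i] at heuler
    simp only [map_mul, MvPolynomial.eval_X, hz, mul_zero, Finset.sum_const_zero, add_zero,
      map_nsmul, hfp, nsmul_zero] at heuler
    have hi := (mul_eq_zero.1 heuler).resolve_left hp
    rcases Fin.eq_self_or_eq_succAbove i j with rfl | ⟨m, rfl⟩
    · exact hj hi
    · exact hj (hz m)
  · rintro ⟨k, hk⟩
    rw [hco] at hk
    exact ⟨_, right_ne_zero_of_mul hk⟩

theorem eq_add_sum_chartBasis {M : ℕ} {p : Fin (M + 1) → ℂ} {i : Fin (M + 1)} (hp : p i ≠ 0)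
    (w : Fin (M + 1) → ℂ) : w = (w i / p i) • p +
      ∑ k, ((w - (w i / p i) • p) (i.succAbove k) / p i) • chartBasis p i k := by
  ext j
  rw [Pi.add_apply]
  rcases Fin.eq_self_or_eq_succAbove i j with rfl | ⟨m, rfl⟩
  · rw [sum_chartBasis_apply_self]
    simp [hp]
  · rw [sum_chartBasis_apply_succAbove]
    simp only [Pi.sub_apply, Pi.smul_apply, smul_eq_mul]
    field_simp
    ring

theorem linearIndependent_cons_chartBasis {M : ℕ} {p : Fin (M + 1) → ℂ} {i : Fin (M + 1)}
    (hp : p i ≠ 0) :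
    LinearIndependent ℂ (Fin.cons p (chartBasis p i) : Fin (M + 1) → Fin (M + 1) → ℂ) := by
  rw [linearIndependent_finCons]
  constructor
  · rw [Fintype.linearIndependent_iff]
    intro z hz m
    have := congrFun hz (i.succAbove m)
    rw [sum_chartBasis_apply_succAbove, Pi.zero_apply] at this
    exact (mul_eq_zero.1 this).resolve_right hp
  · intro hmem
    obtain ⟨z, hz⟩ := (Submodule.mem_span_range_iff_exists_fun ℂ).1 hmem
    have := congrFun hz i
    rw [sum_chartBasis_apply_self] at this
    exact hp this.symm

/-- Together with a linear form that avoids their common zeros, the M - 1 forms become M forms with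
only the trivial zero; an initial part of a regular sequence is weakly regular. -/
theorem isRegularPoint_of_not_zerosMeetHyperplanes {M : ℕ} (hM : 1 ≤ M)
    {f : MvPolynomial (Fin (M + 1)) ℂ} {p : Fin (M + 1) → ℂ} {i : Fin (M + 1)} (hp : p i ≠ 0)
    (h : ¬ ZerosMeetHyperplanes 1 (M - 1) (localEquation f p (chartBasis p i))) :
    IsRegularPoint f p := by
  set G := localEquation f p (chartBasis p i) with hG
  refine ⟨chartBasis p i, linearIndependent_cons_chartBasis hp, ?_⟩
  rw [← hG]
  obtain ⟨l, hl⟩ := exists_linear_of_not_zerosMeetHyperplanes h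
  set xs := List.ofFn fun j : Fin (M - 1) => MvPolynomial.homogeneousComponent ((j : ℕ) + 1) G
  have hxs : ∀ x ∈ xs, ∃ j, x = MvPolynomial.homogeneousComponent (j + 1) G := by
    intro x hx
    obtain ⟨j, rfl⟩ := (List.mem_ofFn' _ _).1 hx
    exact ⟨j, rfl⟩
  have hreg : RingTheory.Sequence.IsWeaklyRegular (MvPolynomial (Fin M) ℂ) (xs ++ [linForm l]) := by
    refine isWeaklyRegular_of_forall_zero ?_ ?_ ?_
    · simp only [xs, List.length_append, List.length_ofFn, List.length_singleton]
      omega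
    · intro x hx
      rcases List.mem_append.1 hx with hx | hx
      · obtain ⟨j, rfl⟩ := hxs x hx
        exact ⟨j + 1, by omega, MvPolynomial.homogeneousComponent_isHomogeneous _ _⟩
      · rw [List.mem_singleton.1 hx]
        exact ⟨1, one_pos, linForm_isHomogeneous l⟩
    · intro ξ hξ
      refine hl ξ ?_ fun j h1 h2 => hξ _ (List.mem_append_left _ ?_)
      · rw [← eval_linForm]
        exact hξ _ (by simp)
      · refine (List.mem_ofFn' _ _).2 ⟨⟨j - 1, by omega⟩, ?_⟩
        simp only [Nat.sub_add_cancel h1]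
  refine ⟨((RingTheory.Sequence.isWeaklyRegular_append_iff _ _ _).1 hreg).1, fun htop => ?_⟩
  rw [smul_eq_mul, Ideal.mul_top] at htop
  have hle : Ideal.ofList xs ≤ RingHom.ker (MvPolynomial.eval (0 : Fin M → ℂ)) := by
    refine Ideal.span_le.2 fun x hx => ?_
    obtain ⟨j, rfl⟩ := hxs x hx
    have := (MvPolynomial.homogeneousComponent_isHomogeneous (j + 1) G).eval_smul 0 0
    rw [smul_zero, zero_pow (Nat.succ_ne_zero j), zero_mul] at this
    exact this
  rw [← htop] at hle
  exact RingHom.ker_ne_top _ (top_le_iff.1 hle)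

theorem quadraticMatrix_monomial {ι : Type*} [Fintype ι] [DecidableEq ι] (z : ι → ℂ) (i j : ι)
    (a : ℂ) : z ⬝ᵥ (quadraticMatrix (MvPolynomial.monomial
      (Finsupp.single i 1 + Finsupp.single j 1) a)).mulVec z = a * (z i * z j) := by
  have h2 : ∀ m : ι, Finsupp.single m 2 = Finsupp.single m 1 + Finsupp.single m 1 := fun m => by
    rw [← Finsupp.single_add]
  have hA : quadraticMatrix (MvPolynomial.monomial (Finsupp.single i 1 + Finsupp.single j 1) a) =
      Matrix.single i j (a / 2) + Matrix.single j i (a / 2) := by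
    have hiff : ∀ m n : ι, Finsupp.single i 1 + Finsupp.single j 1 =
        (Finsupp.single m 1 + Finsupp.single n 1 : ι →₀ ℕ) ↔ i = m ∧ j = n ∨ i = n ∧ j = m := by
      intro m n
      rw [Finsupp.single_add_single_eq_single_add_single one_ne_zero one_ne_zero]
      simp
    ext m n
    simp only [quadraticMatrix, MvPolynomial.coeff_monomial, h2, Matrix.add_apply,
      Matrix.single_apply, hiff]
    split_ifs <;> grind
  rw [hA, Matrix.add_mulVec, dotProduct_add, Matrix.single_mulVec, Matrix.single_mulVec]
  have hsingle : ∀ k c, z ⬝ᵥ Function.update 0 k c = z k * c := fun k c => dotProduct_single z c k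
  rw [hsingle, hsingle]
  ring

theorem dotProduct_quadraticMatrix {ι : Type*} [Fintype ι] [DecidableEq ι]
    (g : MvPolynomial ι ℂ) (z : ι → ℂ) : z ⬝ᵥ (quadraticMatrix g).mulVec z =
      MvPolynomial.eval z (MvPolynomial.homogeneousComponent 2 g) := by
  induction g using MvPolynomial.induction_on' with
  | monomial d a =>
    rw [MvPolynomial.homogeneousComponent_of_mem (MvPolynomial.isHomogeneous_monomial a rfl)]
    split_ifs with hd
    · obtain ⟨i, j, rfl⟩ := Finsupp.exists_eq_single_add_single d hd.symm
      rw [quadraticMatrix_monomial, MvPolynomial.eval_monomial,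
        Finsupp.prod_add_index' (fun _ => pow_zero _) (fun _ _ _ => pow_add _ _ _),
        Finsupp.prod_single_index (h := fun m n => z m ^ n) (pow_zero _),
        Finsupp.prod_single_index (h := fun m n => z m ^ n) (pow_zero _), pow_one, pow_one]
    · have : quadraticMatrix (MvPolynomial.monomial d a) = 0 := by
        ext m n
        have h1 : d ≠ Finsupp.single m 2 := by rintro rfl; simp at hd
        have h2 : d ≠ Finsupp.single m 1 + Finsupp.single n 1 := by rintro rfl; simp at hd
        simp [quadraticMatrix, MvPolynomial.coeff_monomial, h1, h2]
      rw [this, Matrix.zero_mulVec, dotProduct_zero, map_zero]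
  | add g h hg hh =>
    have : quadraticMatrix (g + h) = quadraticMatrix g + quadraticMatrix h := by
      ext m n
      simp only [quadraticMatrix, MvPolynomial.coeff_add, Matrix.add_apply]
      split_ifs
      · rfl
      · ring
    rw [this, Matrix.add_mulVec, dotProduct_add, hg, hh, map_add, map_add]

theorem isBigO_eval_of_coeff_eq_zero {n : ℕ} {g : MvPolynomial (Fin n) ℂ} {r : ℕ}
    (h : ∀ d : Fin n →₀ ℕ, d.degree < r → g.coeff d = 0) :
    (fun z => MvPolynomial.eval z g) =O[nhds (0 : Fin n → ℂ)] (fun z => ‖z‖ ^ r) := by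
  simp only [MvPolynomial.eval_eq']
  suffices hmon : ∀ d ∈ g.support, (fun z : Fin n → ℂ => g.coeff d * ∏ i, z i ^ d i)
      =O[nhds (0 : Fin n → ℂ)] (fun z => ‖z‖ ^ r) from
    Asymptotics.IsBigO.fun_sum hmon
  intro d hd
  have hdr : r ≤ d.degree := by
    by_contra hlt
    exact MvPolynomial.mem_support_iff.1 hd (h d (by omega))
  refine Asymptotics.IsBigO.const_mul_left ?_ _
  refine Asymptotics.IsBigO.of_bound 1 ?_
  filter_upwards [Metric.ball_mem_nhds (0 : Fin n → ℂ) one_pos] with z hz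
  rw [mem_ball_zero_iff] at hz
  rw [one_mul, norm_pow, norm_norm, norm_prod]
  calc ∏ i, ‖z i ^ d i‖ ≤ ∏ i, ‖z‖ ^ d i := by
        refine Finset.prod_le_prod (fun _ _ => norm_nonneg _) fun i _ => ?_
        rw [norm_pow]
        exact pow_le_pow_left₀ (norm_nonneg _) (norm_le_pi_norm z i) _
    _ = ‖z‖ ^ d.degree := by rw [Finset.prod_pow_eq_pow_sum, Finsupp.degree_eq_sum]
    _ ≤ ‖z‖ ^ r := pow_le_pow_of_le_one (norm_nonneg _) hz.le hdr

theorem isQuadraticPoint_chart {M : ℕ} {f : MvPolynomial (Fin (M + 1)) ℂ} {p : Fin (M + 1) → ℂ}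
    {i : Fin (M + 1)} (hp : p i ≠ 0)
    (h0 : ∀ d : Fin M →₀ ℕ, d.degree ≤ 1 → (localEquation f p (chartBasis p i)).coeff d = 0) :
    IsQuadraticPoint f p (quadraticMatrix (localEquation f p (chartBasis p i))).rank := by
  set G := localEquation f p (chartBasis p i) with hG
  let L : (Fin M → ℂ) →L[ℂ] (Fin (M + 1) → ℂ) :=
    LinearMap.toContinuousLinearMap (Fintype.linearCombination ℂ (chartBasis p i))
  have hL : ∀ z, L z = ∑ k, z k • chartBasis p i k := fun z =>
    Fintype.linearCombination_apply ℂ (chartBasis p i) z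
  have hfd : fderiv ℂ (fun z => p + L z) 0 = L := by
    rw [fderiv_const_add]
    exact L.fderiv
  refine ⟨fun z => p + L z, quadraticMatrix G, analyticAt_const.add (L.analyticAt 0), by simp, ?_,
    quadraticMatrix_isSymm G, rfl, ?_⟩
  · rw [hfd]
    constructor
    · rw [Submodule.disjoint_def]
      intro w hw hwp
      obtain ⟨z, rfl⟩ := hw
      obtain ⟨t, ht⟩ := Submodule.mem_span_singleton.1 hwp
      have h1 := congrFun ht i
      change t * p i = L z i at h1
      rw [hL, sum_chartBasis_apply_self] at h1
      rw [← ht, (mul_eq_zero.1 h1).resolve_right hp, zero_smul]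
    · rw [codisjoint_iff_le_sup]
      intro w _
      refine (eq_add_sum_chartBasis hp w).trans (add_comm _ _) ▸ ?_
      exact Submodule.add_mem_sup ⟨_, hL _⟩ (Submodule.smul_mem _ _
        (Submodule.mem_span_singleton_self p))
  · have h1 : (fun z => MvPolynomial.eval (p + L z) f - z ⬝ᵥ (quadraticMatrix G).mulVec z) =
        fun z => MvPolynomial.eval z (G - MvPolynomial.homogeneousComponent 2 G) := by
      ext z
      rw [map_sub, dotProduct_quadraticMatrix, hG, eval_localEquation, hL]
    rw [h1]
    refine isBigO_eval_of_coeff_eq_zero fun d hd => ?_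
    rw [MvPolynomial.coeff_sub, MvPolynomial.coeff_homogeneousComponent]
    split_ifs with h2
    · rw [sub_self]
    · rw [h0 d (by omega), sub_zero]

theorem eval_radial {ι : Type*} (ξ : ι → ℂ) (g : MvPolynomial ι ℂ) (t : ℂ) :
    (radial ξ g).eval t = MvPolynomial.eval (t • ξ) g := by
  have h : (Polynomial.aeval t).comp (radial ξ) = MvPolynomial.aeval (R := ℂ) (t • ξ) := by
    refine MvPolynomial.algHom_ext fun j => ?_
    rw [AlgHom.comp_apply, radial, MvPolynomial.aeval_X, MvPolynomial.aeval_X]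
    simp
    ring
  have := congrArg (fun φ => φ g) h
  simpa [MvPolynomial.aeval_eq_eval] using this

/-- A line through p inside the hypersurface has a direction killed by all q_j, and it can be
normalized to lie on an affine hyperplane that contains finitely many common zeros. -/
theorem finite_linesThrough {M : ℕ} {f : MvPolynomial (Fin (M + 1)) ℂ} {p : Fin (M + 1) → ℂ}
    {i : Fin (M + 1)} (hp : p i ≠ 0)
    (h : ¬ ZerosMeetHyperplanes 2 M (localEquation f p (chartBasis p i))) :
    (linesThrough f p).Finite := by
  set G := localEquation f p (chartBasis p i) with hG
  obtain ⟨l, hl⟩ := exists_linear_of_not_zerosMeetHyperplanes h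
  refine ((finite_zeros_affine_hyperplane hl).image
    fun ξ => Submodule.span ℂ {p, ∑ k, ξ k • chartBasis p i k}).subset ?_
  rintro L ⟨hL2, hpL, hLf⟩
  obtain ⟨v, hvL, hv⟩ : ∃ v ∈ L, v ∉ Submodule.span ℂ {p} := by
    by_contra! hcon
    have h1 := Submodule.finrank_mono (show L ≤ Submodule.span ℂ {p} from hcon)
    have h2 := finrank_span_le_card (R := ℂ) ({p} : Set (Fin (M + 1) → ℂ))
    simp only [Set.toFinset_singleton, Finset.card_singleton] at h2
    omega
  obtain ⟨η, hη⟩ : ∃ η : Fin M → ℂ, v = (v i / p i) • p + ∑ k, η k • chartBasis p i k :=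
    ⟨_, eq_add_sum_chartBasis hp v⟩
  set B : (Fin M → ℂ) → Fin (M + 1) → ℂ := fun ξ => ∑ k, ξ k • chartBasis p i k with hB
  have hBs : ∀ (t : ℂ) ξ, B (t • ξ) = t • B ξ := fun t ξ => by
    simp [hB, Finset.smul_sum, mul_smul]
  have hBη : B η ∈ L := by
    have : B η = v - (v i / p i) • p := eq_sub_of_add_eq' hη.symm
    rw [this]
    exact L.sub_mem hvL (L.smul_mem _ hpL)
  have hη0 : η ≠ 0 := by
    rintro rfl
    refine hv ?_
    rw [hη]
    simp only [Pi.zero_apply, zero_smul, Finset.sum_const_zero, add_zero]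
    exact Submodule.smul_mem _ _ (Submodule.mem_span_singleton_self p)
  have hrad : radial η G = 0 := by
    refine Polynomial.funext fun t => ?_
    rw [eval_radial, hG, eval_localEquation, Polynomial.eval_zero]
    refine hLf _ (L.add_mem hpL ?_)
    have : B (t • η) ∈ L := by rw [hBs]; exact L.smul_mem _ hBη
    exact this
  have hq : ∀ j, MvPolynomial.eval η (MvPolynomial.homogeneousComponent j G) = 0 := fun j => by
    rw [← coeff_radial, hrad, Polynomial.coeff_zero]
  have hlη : ∑ k, l k * η k ≠ 0 := fun h0 => hη0 (hl η h0 fun j _ _ => hq j)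
  set s := (∑ k, l k * η k)⁻¹ with hs
  have hs0 : s ≠ 0 := inv_ne_zero hlη
  refine ⟨s • η, ⟨?_, fun j _ _ => ?_⟩, ?_⟩
  · simp only [Pi.smul_apply, smul_eq_mul, mul_left_comm _ s, ← Finset.mul_sum]
    exact inv_mul_cancel₀ hlη
  · rw [(MvPolynomial.homogeneousComponent_isHomogeneous j G).eval_smul, hq, mul_zero]
  · change Submodule.span ℂ {p, B (s • η)} = L
    have hle : Submodule.span ℂ {p, B (s • η)} ≤ L := by
      rw [Submodule.span_le, Set.insert_subset_iff, Set.singleton_subset_iff, hBs]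
      exact ⟨hpL, L.smul_mem _ hBη⟩
    refine Submodule.eq_of_le_of_finrank_eq hle ?_
    have hli : LinearIndependent ℂ ![p, B (s • η)] := by
      rw [LinearIndependent.pair_iff]
      intro a c hac
      have h1 := congrFun hac i
      simp only [Pi.add_apply, Pi.smul_apply, hB, sum_chartBasis_apply_self, add_zero,
        smul_eq_mul, Pi.zero_apply, mul_zero] at h1
      have ha : a = 0 := (mul_eq_zero.1 h1).resolve_right hp
      refine ⟨ha, ?_⟩
      by_contra hc
      rw [ha, zero_smul, zero_add] at hac
      have hB0 := (smul_eq_zero.1 hac).resolve_left hc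
      refine hη0 (funext fun m => ?_)
      have h2 := congrFun hB0 (i.succAbove m)
      change (∑ k, (s • η) k • chartBasis p i k) (i.succAbove m) = 0 at h2
      rw [sum_chartBasis_apply_succAbove] at h2
      simpa [hs0, hp] using h2
    have := finrank_span_eq_card hli
    rw [Matrix.range_cons_cons_empty] at this
    rw [this, hL2, Fintype.card_fin]

/-! ### Degenerate points and relations between coefficients -/

/-- The polynomial `g` is the local equation of a hypersurface of degree `M` at a point violating
one of the conditions which define `regQsing M 5`. -/
def IsDegenerate {M : ℕ} (g : MvPolynomial (Fin M) ℂ) : Prop :=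
  ((∀ d : Fin M →₀ ℕ, d.degree ≤ 1 → g.coeff d = 0) ∧ (quadraticMatrix g).rank ≤ 4) ∨
  ((∀ d : Fin M →₀ ℕ, d.degree ≤ 1 → g.coeff d = 0) ∧ ZerosMeetHyperplanes 2 M g) ∨
  ∃ k, g.coeff (Finsupp.single k 1) ≠ 0 ∧ g.coeff 0 = 0 ∧ ZerosMeetHyperplanes 1 (M - 1) g

theorem ZerosMeetHyperplanes.C_mul {ι : Type*} [Fintype ι] {lo hi : ℕ} {g : MvPolynomial ι ℂ}
    (h : ZerosMeetHyperplanes lo hi g) (c : ℂ) :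
    ZerosMeetHyperplanes lo hi (MvPolynomial.C c * g) := by
  intro l
  obtain ⟨ξ, h0, h1, h2⟩ := h l
  refine ⟨ξ, h0, h1, fun j hj hj' => ?_⟩
  rw [MvPolynomial.homogeneousComponent_C_mul, map_mul, h2 j hj hj', mul_zero]

theorem rank_quadraticMatrix_C_mul_le {ι : Type*} [Fintype ι] [DecidableEq ι]
    (g : MvPolynomial ι ℂ) (c : ℂ) :
    (quadraticMatrix (MvPolynomial.C c * g)).rank ≤ (quadraticMatrix g).rank := by
  have : quadraticMatrix (MvPolynomial.C c * g) = (c • 1 : Matrix ι ι ℂ) * quadraticMatrix g := by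
    rw [Matrix.smul_mul, one_mul]
    ext m n
    simp only [quadraticMatrix, MvPolynomial.coeff_C_mul, Matrix.smul_apply, smul_eq_mul]
    split_ifs
    · rfl
    · ring
  rw [this]
  exact Matrix.rank_mul_le_right _ _

theorem IsDegenerate.C_mul {M : ℕ} {g : MvPolynomial (Fin M) ℂ} (h : IsDegenerate g) {c : ℂ}
    (hc : c ≠ 0) : IsDegenerate (MvPolynomial.C c * g) := by
  have h0 : (∀ d : Fin M →₀ ℕ, d.degree ≤ 1 → g.coeff d = 0) →
      ∀ d : Fin M →₀ ℕ, d.degree ≤ 1 → (MvPolynomial.C c * g).coeff d = 0 := fun h d hd => by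
    rw [MvPolynomial.coeff_C_mul, h d hd, mul_zero]
  rcases h with ⟨h1, h2⟩ | ⟨h1, h2⟩ | ⟨k, h1, h2, h3⟩
  · exact Or.inl ⟨h0 h1, (rank_quadraticMatrix_C_mul_le g c).trans h2⟩
  · exact Or.inr (Or.inl ⟨h0 h1, h2.C_mul c⟩)
  · refine Or.inr (Or.inr ⟨k, ?_, ?_, h3.C_mul c⟩)
    · rw [MvPolynomial.coeff_C_mul]
      exact mul_ne_zero hc h1
    · rw [MvPolynomial.coeff_C_mul, h2, mul_zero]

theorem conditions_of_not_isDegenerate {M : ℕ} (hM : 1 ≤ M) {f : MvPolynomial (Fin (M + 1)) ℂ}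
    (hf : f.IsHomogeneous M) {p : Fin (M + 1) → ℂ} {i : Fin (M + 1)} (hp : p i ≠ 0)
    (hfp : MvPolynomial.eval p f = 0)
    (h : ¬ IsDegenerate (localEquation f p (chartBasis p i))) :
    (IsSmoothPoint f p ∨ ∃ s, 5 ≤ s ∧ IsQuadraticPoint f p s) ∧
      (IsSmoothPoint f p → IsRegularPoint f p) ∧
      (¬ IsSmoothPoint f p → (linesThrough f p).Finite) := by
  simp only [IsDegenerate, not_or, not_and, not_exists] at h
  obtain ⟨hrank, hlines, hreg⟩ := h
  have h00 : (localEquation f p (chartBasis p i)).coeff 0 = 0 := by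
    rw [← MvPolynomial.constantCoeff_eq, ← MvPolynomial.eval_zero, eval_localEquation]
    simpa using hfp
  have h0 : ¬ IsSmoothPoint f p →
      ∀ d : Fin M →₀ ℕ, d.degree ≤ 1 → (localEquation f p (chartBasis p i)).coeff d = 0 := by
    intro hs d hd
    rw [isSmoothPoint_iff hf hp hfp] at hs
    push Not at hs
    rcases Nat.le_one_iff_eq_zero_or_eq_one.1 hd with hd | hd
    · rw [(Finsupp.degree_eq_zero_iff d).1 hd, h00]
    · obtain ⟨k, rfl⟩ := (Finsupp.sum_eq_one_iff d).1 hd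
      exact hs k
  refine ⟨?_, fun hs => ?_, fun hs => ?_⟩
  · by_cases hs : IsSmoothPoint f p
    · exact Or.inl hs
    · exact Or.inr ⟨_, not_le.1 (hrank (h0 hs)), isQuadraticPoint_chart hp (h0 hs)⟩
  · obtain ⟨k, hk⟩ := (isSmoothPoint_iff hf hp hfp).1 hs
    exact isRegularPoint_of_not_zerosMeetHyperplanes hM hp (hreg k hk h00)
  · exact finite_linesThrough hp (hlines (h0 hs))

/-- The polynomial with indeterminate coefficients. -/
noncomputable def genericLocalPoly (M : ℕ) :
    MvPolynomial (Fin M) (MvPolynomial (Fin M ⊕ LocalIndex M) ℂ) :=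
  localPoly fun d => MvPolynomial.X (Sum.inr d)

theorem map_genericLocalPoly {M : ℕ} (x : Fin M ⊕ LocalIndex M → ℂ) :
    MvPolynomial.map (MvPolynomial.eval x) (genericLocalPoly M) =
      localPoly fun d => x (Sum.inr d) := by
  simp [genericLocalPoly, map_localPoly]

theorem eval_coeff_genericLocalPoly {M : ℕ} (x : Fin M ⊕ LocalIndex M → ℂ) (d : Fin M →₀ ℕ) :
    MvPolynomial.eval x ((genericLocalPoly M).coeff d) =
      (localPoly fun d => x (Sum.inr d)).coeff d := by
  rw [← map_genericLocalPoly, MvPolynomial.coeff_map]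

/-- The coefficients of the form are rational polynomials in the local coefficients and the M
coordinates of the point, so their transcendence degree is at most the sum of the two contributions.
-/
theorem not_algebraicIndependent_universalCoeff {M n : ℕ} (i : Fin (M + 1))
    (x : Fin M ⊕ LocalIndex M → ℂ) (sel : Fin n → CoeffIndex M)
    (h : transRank (localCoeffs (localPoly fun d => x (Sum.inr d))) + M < n) :
    ¬ AlgebraicIndependent ℚ
      (fun a => MvPolynomial.aeval x (universalCoeff i (sel a).1)) := by
  intro hind
  set v := fun a => MvPolynomial.aeval x (universalCoeff i (sel a).1) with hv
  have hx : (Set.range x).Finite := Set.finite_range x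
  have h1 : (Set.range v).ncard = n := by
    rw [← Set.image_univ, Set.ncard_image_of_injective _ hind.injective, Set.ncard_univ,
      Nat.card_fin]
  have h2 : transRank (Set.range v) = n := by
    rw [transRank,
      Matroid.Indep.eRk_eq_encard (AlgebraicIndependent.matroid_indep_iff.2 hind.coe_range),
      ← (Set.finite_range v).cast_ncard_eq, h1]
    rfl
  have h3 : Set.range v ⊆ ratClosure (Set.range x) := by
    rintro _ ⟨a, rfl⟩
    have hle : Algebra.adjoin ℚ (Set.range x) ≤ (ratClosure (Set.range x)).toSubalgebra :=
      Algebra.adjoin_le (subset_ratClosure _)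
    refine hle ?_
    rw [Algebra.adjoin_range_eq_range_aeval]
    exact ⟨_, rfl⟩
  have h4 := transRank_le_of_subset_ratClosure hx (Set.finite_range v) h3
  have h5 : Set.range x =
      (Set.range fun d => x (Sum.inr d)) ∪ Set.range fun k => x (Sum.inl k) := by
    rw [Set.union_comm]
    exact (Set.Sum.elim_range _ _).symm.trans (by rw [← Sum.elim_comp_inl_inr x]; rfl) |>.symm
  have h6 := transRank_union_le (Set.finite_range fun d => x (Sum.inr d))
    (Set.finite_range fun k => x (Sum.inl k))
  have h7 : (Set.range fun k => x (Sum.inl k)).ncard ≤ M := by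
    rw [← Set.image_univ]
    refine (Set.ncard_image_le Set.finite_univ).trans ?_
    rw [Set.ncard_univ, Nat.card_fin]
  rw [localCoeffs_localPoly] at h
  rw [← h5] at h6
  omega

theorem exists_relation_of_isDegenerate {M n : ℕ} (hM : 5 ≤ M)
    (hn : Nat.card (LocalIndex M) < n + ((M - 3).choose 2 + 1)) (i : Fin (M + 1))
    (sel : Fin n → CoeffIndex M) :
    ∃ P : MvPolynomial (Fin n) ℚ, P ≠ 0 ∧ ∀ x : Fin M ⊕ LocalIndex M → ℂ,
      IsDegenerate (localPoly fun d => x (Sum.inr d)) →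
      MvPolynomial.aeval (fun a => MvPolynomial.aeval x (universalCoeff i (sel a).1)) P = 0 := by
  classical
  let S₁ : Set (Fin M ⊕ LocalIndex M → ℂ) := {x |
    (∀ d : Fin M →₀ ℕ, d.degree ≤ 1 → (localPoly fun d => x (Sum.inr d)).coeff d = 0) ∧
    (quadraticMatrix (localPoly fun d => x (Sum.inr d))).rank ≤ 4}
  let S₂ : Set (Fin M ⊕ LocalIndex M → ℂ) := {x |
    (∀ d : Fin M →₀ ℕ, d.degree ≤ 1 → (localPoly fun d => x (Sum.inr d)).coeff d = 0) ∧
    ZerosMeetHyperplanes 2 M (localPoly fun d => x (Sum.inr d))}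
  -- The condition q_1 ≠ 0 is open, so this locus is split by a nonzero linear coefficient; each
  -- piece is closed where that coefficient does not vanish.
  let S₃ : Fin M → Set (Fin M ⊕ LocalIndex M → ℂ) := fun k => {x |
    (localPoly fun d => x (Sum.inr d)).coeff (Finsupp.single k 1) ≠ 0 ∧
    (localPoly fun d => x (Sum.inr d)).coeff 0 = 0 ∧
    ZerosMeetHyperplanes 1 (M - 1) (localPoly fun d => x (Sum.inr d))}
  have hsep0 : ∀ x : Fin M ⊕ LocalIndex M → ℂ,
      (¬ ∀ d : Fin M →₀ ℕ, d.degree ≤ 1 → (localPoly fun d => x (Sum.inr d)).coeff d = 0) →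
      ∃ F : MvPolynomial (Fin M ⊕ LocalIndex M) ℂ, (∀ y : Fin M ⊕ LocalIndex M → ℂ,
        (∀ d : Fin M →₀ ℕ, d.degree ≤ 1 → (localPoly fun d => y (Sum.inr d)).coeff d = 0) →
        MvPolynomial.eval y F = 0) ∧ MvPolynomial.eval x F ≠ 0 := by
    intro x hx
    push Not at hx
    obtain ⟨d, hd, hx⟩ := hx
    refine ⟨(genericLocalPoly M).coeff d, fun y hy => ?_, ?_⟩
    · rw [eval_coeff_genericLocalPoly, hy d hd]
    · rwa [eval_coeff_genericLocalPoly]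
  have hsepZ : ∀ (lo hi : ℕ) (x : Fin M ⊕ LocalIndex M → ℂ),
      (¬ ZerosMeetHyperplanes lo hi (localPoly fun d => x (Sum.inr d))) →
      ∃ F : MvPolynomial (Fin M ⊕ LocalIndex M) ℂ, (∀ y : Fin M ⊕ LocalIndex M → ℂ,
        ZerosMeetHyperplanes lo hi (localPoly fun d => y (Sum.inr d)) →
        MvPolynomial.eval y F = 0) ∧ MvPolynomial.eval x F ≠ 0 := by
    intro lo hi x hx
    rw [← map_genericLocalPoly] at hx
    obtain ⟨F, hF, hxF⟩ := exists_separating_zerosMeetHyperplanes _ hx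
    exact ⟨F, fun y hy => hF y (by rwa [map_genericLocalPoly]), hxF⟩
  have hsepR : ∀ x : Fin M ⊕ LocalIndex M → ℂ,
      (¬ (quadraticMatrix (localPoly fun d => x (Sum.inr d))).rank ≤ 4) →
      ∃ F : MvPolynomial (Fin M ⊕ LocalIndex M) ℂ, (∀ y : Fin M ⊕ LocalIndex M → ℂ,
        (quadraticMatrix (localPoly fun d => y (Sum.inr d))).rank ≤ 4 →
        MvPolynomial.eval y F = 0) ∧ MvPolynomial.eval x F ≠ 0 := by
    intro x hx
    let A : Matrix (Fin M) (Fin M) (MvPolynomial (Fin M ⊕ LocalIndex M) ℂ) := fun m n =>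
      if m = n then (genericLocalPoly M).coeff (Finsupp.single m 2)
      else (genericLocalPoly M).coeff (Finsupp.single m 1 + Finsupp.single n 1) *
        MvPolynomial.C (2⁻¹)
    have hA : ∀ y, A.map (MvPolynomial.eval y) =
        quadraticMatrix (localPoly fun d => y (Sum.inr d)) := by
      intro y
      ext m n
      rw [Matrix.map_apply]
      change MvPolynomial.eval y (ite _ _ _) = ite _ _ _
      split_ifs
      · rw [eval_coeff_genericLocalPoly]
      · rw [map_mul, eval_coeff_genericLocalPoly, MvPolynomial.eval_C, div_eq_mul_inv]
    rw [← hA] at hx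
    obtain ⟨F, hF, hxF⟩ := exists_separating_rank _ hx
    exact ⟨F, fun y hy => hF y (by rwa [hA]), hxF⟩
  have h₁ := exists_relation_of_forall_not_algebraicIndependent S₁ 1 (fun x _ => by simp)
    (fun x hx _ => by
      rcases not_and_or.1 hx with hx | hx
      · obtain ⟨F, hF, hxF⟩ := hsep0 x hx
        exact ⟨F, fun y hy => hF y hy.1, hxF⟩
      · obtain ⟨F, hF, hxF⟩ := hsepR x hx
        exact ⟨F, fun y hy => hF y hy.2, hxF⟩)
    (fun a => universalCoeff i (sel a).1)
    (fun x hx => not_algebraicIndependent_universalCoeff i x sel (by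
      have := transRank_localCoeffs_add_le_of_rank_le hM hx.1 hx.2
      omega))
  have h₂ := exists_relation_of_forall_not_algebraicIndependent S₂ 1 (fun x _ => by simp)
    (fun x hx _ => by
      rcases not_and_or.1 hx with hx | hx
      · obtain ⟨F, hF, hxF⟩ := hsep0 x hx
        exact ⟨F, fun y hy => hF y hy.1, hxF⟩
      · obtain ⟨F, hF, hxF⟩ := hsepZ _ _ x hx
        exact ⟨F, fun y hy => hF y hy.2, hxF⟩)
    (fun a => universalCoeff i (sel a).1)
    (fun x hx => not_algebraicIndependent_universalCoeff i x sel (by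
      have := transRank_localCoeffs_add_le_of_zerosMeetHyperplanes_two hM hx.1 hx.2
      omega))
  have h₃ := fun k => exists_relation_of_forall_not_algebraicIndependent (S₃ k)
    ((genericLocalPoly M).coeff (Finsupp.single k 1))
    (fun x hx => by rw [eval_coeff_genericLocalPoly]; exact hx.1)
    (fun x hx hxk => by
      rw [eval_coeff_genericLocalPoly] at hxk
      rcases not_and_or.1 (fun h => hx ⟨hxk, h⟩) with hx | hx
      · refine ⟨(genericLocalPoly M).coeff 0, fun y hy => ?_, ?_⟩
        · rw [eval_coeff_genericLocalPoly, hy.2.1]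
        · rwa [eval_coeff_genericLocalPoly]
      · obtain ⟨F, hF, hxF⟩ := hsepZ _ _ x hx
        exact ⟨F, fun y hy => hF y hy.2.2, hxF⟩)
    (fun a => universalCoeff i (sel a).1)
    (fun x hx => not_algebraicIndependent_universalCoeff i x sel (by
      have := transRank_localCoeffs_add_le_of_zerosMeetHyperplanes_one hM hx.2.1 hx.1 hx.2.2
      omega))
  obtain ⟨P₁, hP₁, hz₁⟩ := h₁
  obtain ⟨P₂, hP₂, hz₂⟩ := h₂
  choose P₃ hP₃ hz₃ using h₃
  refine ⟨P₁ * P₂ * ∏ k, P₃ k, mul_ne_zero (mul_ne_zero hP₁ hP₂)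
    (Finset.prod_ne_zero_iff.2 fun k _ => hP₃ k), ?_⟩
  rintro x (hx | hx | ⟨k, hx⟩)
  · rw [map_mul, map_mul, hz₁ x hx, zero_mul, zero_mul]
  · rw [map_mul, map_mul, hz₂ x hx, mul_zero, zero_mul]
  · rw [map_mul, map_prod, Finset.prod_eq_zero (Finset.mem_univ k) (hz₃ k x hx), mul_zero]

theorem HypersurfaceSpace.isHomogeneous_equation {M : ℕ} (V : HypersurfaceSpace M) :
    V.equation.IsHomogeneous M :=
  (MvPolynomial.mem_homogeneousSubmodule M _).1 (Projectivization.rep (K := ℂ) (V := Forms M) V).2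

theorem exists_isDegenerate_of_notMem_regQsing {M : ℕ} (hM : 1 ≤ M) {V : HypersurfaceSpace M}
    (hV : V ∉ regQsing M 5) : ∃ (p : Fin (M + 1) → ℂ) (i : Fin (M + 1)), p i ≠ 0 ∧
      IsDegenerate (localEquation V.equation p (chartBasis p i)) := by
  by_contra! hcon
  refine hV ⟨fun p hp hVp => ?_, fun p hp hVp => ?_⟩
  all_goals
    obtain ⟨i, hi⟩ := Function.ne_iff.1 hp
    have := conditions_of_not_isDegenerate hM V.isHomogeneous_equation hi hVp (hcon p i hi)
  exacts [this.1, this.2]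

/-- Scaling a local equation preserves degeneracy, so the relation holds along the whole punctured
line of coordinate vectors and need not be homogeneous. -/
theorem exists_relation_coords {M n : ℕ} (hM : 5 ≤ M)
    (hn : Nat.card (LocalIndex M) < n + ((M - 3).choose 2 + 1)) (sel : Fin n → CoeffIndex M) :
    ∃ P : MvPolynomial (Fin n) ℂ, P ≠ 0 ∧ ∀ V ∉ regQsing M 5, ∀ t : ℂ, t ≠ 0 →
      MvPolynomial.eval (t • fun a => V.coords (sel a)) P = 0 := by
  choose P hP hz using fun i => exists_relation_of_isDegenerate hM hn i sel
  refine ⟨MvPolynomial.map (algebraMap ℚ ℂ) (∏ i, P i), ?_, fun V hV t ht => ?_⟩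
  · rw [Ne, map_eq_zero_iff _ (MvPolynomial.map_injective _ (algebraMap ℚ ℂ).injective)]
    exact Finset.prod_ne_zero_iff.2 fun i _ => hP i
  · obtain ⟨p, i, hp, hdeg⟩ := exists_isDegenerate_of_notMem_regQsing (by omega) hV
    set G := localEquation V.equation p (chartBasis p i) with hG
    set c := t / p i ^ M with hc
    have hc0 : c ≠ 0 := div_ne_zero ht (pow_ne_zero _ hp)
    let x : Fin M ⊕ LocalIndex M → ℂ :=
      Sum.elim (fun k => p (i.succAbove k) / p i) fun d => c * G.coeff d.1
    have hx : (localPoly fun d => x (Sum.inr d)) = MvPolynomial.C c * G := by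
      rw [← localPoly_coeff (g := MvPolynomial.C c * G) ((MvPolynomial.totalDegree_mul _ _).trans
        (by
          rw [MvPolynomial.totalDegree_C, zero_add]
          exact totalDegree_localEquation_le V.isHomogeneous_equation _ _))]
      simp [x, MvPolynomial.coeff_C_mul]
    have hu : (t • fun a => V.coords (sel a)) =
        fun a => MvPolynomial.aeval x (universalCoeff i (sel a).1) := by
      ext a
      have := globalForm_eq V.isHomogeneous_equation hp c
      rw [aeval_universalCoeff]
      simp only [x, Sum.elim_inl, Sum.elim_inr, hG]
      rw [this, MvPolynomial.coeff_C_mul, hc, div_mul_cancel₀ _ (pow_ne_zero _ hp)]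
      rfl
    rw [MvPolynomial.eval_map, hu]
    change MvPolynomial.aeval _ _ = 0
    rw [map_prod]
    refine Finset.prod_eq_zero (Finset.mem_univ i) (hz i x ?_)
    rw [hx]
    exact hdeg.C_mul hc0

/-! ### Krull dimension of the space of hypersurfaces -/

/-- Otherwise the quotient by `P'` is algebraic over the subring generated by `s`. An element of `P`
outside `P'` would then divide a nonzero element of that subring, which gives a nonzero polynomial
in `s` inside `P`. -/
theorem exists_insert_algebraicIndepOn {I : Type*} {P' P : Ideal (MvPolynomial I ℂ)}
    [P'.IsPrime] (hlt : P' < P) {s : Set I}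
    (hs : AlgebraicIndepOn ℂ (fun i => Ideal.Quotient.mk P (MvPolynomial.X i)) s) :
    ∃ i ∉ s, AlgebraicIndepOn ℂ (fun i => Ideal.Quotient.mk P' (MvPolynomial.X i))
      (insert i s) := by
  have hmk : ∀ (Q : Ideal (MvPolynomial I ℂ)) (F : MvPolynomial s ℂ),
      MvPolynomial.aeval (fun j : s => Ideal.Quotient.mk Q (MvPolynomial.X (j : I))) F =
        Ideal.Quotient.mk Q (MvPolynomial.rename (↑) F) := fun Q F => by
    have : MvPolynomial.aeval (fun j : s => Ideal.Quotient.mk Q (MvPolynomial.X (j : I))) =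
        (Ideal.Quotient.mkₐ ℂ Q).comp (MvPolynomial.rename (↑)) :=
      MvPolynomial.algHom_ext fun j => by simp
    rw [this]
    rfl
  have hmem : ∀ F : MvPolynomial s ℂ, MvPolynomial.rename (↑) F ∈ P → F = 0 := fun F hF => by
    refine (injective_iff_map_eq_zero _).1 hs F ?_
    exact (hmk P F).trans (Ideal.Quotient.eq_zero_iff_mem.2 hF)
  set x : I → MvPolynomial I ℂ ⧸ P' := fun i => Ideal.Quotient.mk P' (MvPolynomial.X i) with hx
  have hs' : AlgebraicIndepOn ℂ x s := by
    refine (injective_iff_map_eq_zero _).2 fun F hF => hmem F (hlt.le ?_)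
    exact Ideal.Quotient.eq_zero_iff_mem.1 ((hmk P' F).symm.trans hF)
  by_contra! H
  have halg : ∀ i, IsAlgebraic (Algebra.adjoin ℂ (x '' s)) (x i) := fun i => by
    by_cases hi : i ∈ s
    · exact isAlgebraic_algebraMap
        (⟨x i, Algebra.subset_adjoin (Set.mem_image_of_mem x hi)⟩ : Algebra.adjoin ℂ (x '' s))
    · by_contra h
      exact H i hi (hs'.insert h)
  have hall : ∀ F : MvPolynomial I ℂ,
      IsAlgebraic (Algebra.adjoin ℂ (x '' s)) (Ideal.Quotient.mk P' F) := fun F => by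
    induction F using MvPolynomial.induction_on with
    | C a => exact isAlgebraic_algebraMap (algebraMap ℂ (Algebra.adjoin ℂ (x '' s)) a)
    | add F G hF hG => rw [map_add]; exact hF.add hG
    | mul_X F i hF => rw [map_mul]; exact hF.mul (halg i)
  obtain ⟨F, hFP, hFP'⟩ := SetLike.exists_of_lt hlt
  obtain ⟨r, hr, g, hg⟩ := (hall F).exists_nonzero_dvd
    (mem_nonZeroDivisors_of_ne_zero fun h => hFP' (Ideal.Quotient.eq_zero_iff_mem.1 h))
  obtain ⟨G, rfl⟩ := Ideal.Quotient.mk_surjective g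
  have hr' : (r : MvPolynomial I ℂ ⧸ P') ∈ Algebra.adjoin ℂ (Set.range fun j : s => x j) := by
    rw [← Set.image_eq_range]
    exact r.2
  rw [Algebra.adjoin_range_eq_range_aeval] at hr'
  obtain ⟨Q, hQ⟩ := hr'
  have hQr : Ideal.Quotient.mk P' (MvPolynomial.rename (↑) Q) = r := (hmk P' Q).symm.trans hQ
  have hQ0 : Q = 0 := by
    refine hmem Q ?_
    have h1 : Ideal.Quotient.mk P' (MvPolynomial.rename (↑) Q) = Ideal.Quotient.mk P' (F * G) := by
      rw [hQr, map_mul]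
      exact hg
    have h2 := hlt.le (Ideal.Quotient.eq.1 h1)
    have h3 := P.add_mem h2 (P.mul_mem_right G hFP)
    rwa [sub_add_cancel] at h3
  refine hr (Subtype.ext ?_)
  rw [← hQr, hQ0, map_zero, map_zero]
  rfl

namespace HypersurfaceSpace

theorem isClosed_iff {M : ℕ} {S : Set (HypersurfaceSpace M)} :
    IsClosed S ↔ IsZariskiClosed S := by
  rw [← isOpen_compl_iff]
  change IsZariskiClosed Sᶜᶜ ↔ _
  rw [compl_compl]

instance (M : ℕ) : Finite (CoeffIndex M) :=
  inferInstanceAs (Finite (Expts (Fin (M + 1)) M))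

theorem exists_coords_eq {M : ℕ} {v : CoeffIndex M → ℂ} (hv : v ≠ 0) :
    ∃ (V : HypersurfaceSpace M) (t : ℂ), t ≠ 0 ∧ V.coords = t • v := by
  classical
  have := Fintype.ofFinite (CoeffIndex M)
  let F : Forms M := ⟨∑ d : CoeffIndex M, MvPolynomial.monomial d.1 (v d),
    Submodule.sum_mem _ fun d _ => MvPolynomial.isHomogeneous_monomial _ d.2⟩
  have hF : ∀ d : CoeffIndex M, F.1.coeff d.1 = v d := fun d => by
    simp only [F, MvPolynomial.coeff_sum, MvPolynomial.coeff_monomial]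
    rw [Finset.sum_eq_single d (fun e _ he => if_neg fun h => he (Subtype.ext h)) (by simp),
      if_pos rfl]
  have hF0 : F ≠ 0 := by
    intro h
    refine hv (funext fun d => ?_)
    rw [← hF, h]
    simp
  obtain ⟨a, ha⟩ := Projectivization.exists_smul_eq_mk_rep ℂ F hF0
  refine ⟨Projectivization.mk ℂ F hF0, a, a.ne_zero, funext fun d => ?_⟩
  change ((Projectivization.mk ℂ F hF0).rep).1.coeff d.1 = _
  rw [← ha, Pi.smul_apply, ← hF, smul_eq_mul]
  exact MvPolynomial.coeff_smul _ _ _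

theorem coords_ne_zero {M : ℕ} (V : HypersurfaceSpace M) : V.coords ≠ 0 := by
  intro h
  refine Projectivization.rep_nonzero V (Subtype.ext (MvPolynomial.ext _ _ fun d => ?_))
  change V.equation.coeff d = 0
  by_contra hd
  have hdeg : d.degree = M := by
    rw [Finsupp.degree_eq_weight_one]
    exact V.isHomogeneous_equation hd
  exact hd (congrFun h ⟨d, hdeg⟩)

theorem isClosed_setOf_radial {M : ℕ} (F : MvPolynomial (CoeffIndex M) ℂ) :
    IsClosed {V : HypersurfaceSpace M | radial V.coords F = 0} := by
  refine isClosed_iff.2 ⟨Set.range fun k => MvPolynomial.homogeneousComponent k F, ?_, ?_⟩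
  · rintro _ ⟨k, rfl⟩
    exact ⟨k, MvPolynomial.homogeneousComponent_isHomogeneous k F⟩
  · ext V
    simp [zeroLocus, Polynomial.ext_iff, coeff_radial]

/-- The homogeneous ideal of a set of hypersurfaces. -/
noncomputable def vanishingIdeal {M : ℕ} (W : Set (HypersurfaceSpace M)) :
    Ideal (MvPolynomial (CoeffIndex M) ℂ) :=
  ⨅ V ∈ W, RingHom.ker (radial V.coords)

theorem mem_vanishingIdeal {M : ℕ} {W : Set (HypersurfaceSpace M)}
    {F : MvPolynomial (CoeffIndex M) ℂ} :
    F ∈ vanishingIdeal W ↔ ∀ V ∈ W, radial V.coords F = 0 := by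
  simp [vanishingIdeal, RingHom.mem_ker]

theorem isPrime_vanishingIdeal {M : ℕ} {W : Set (HypersurfaceSpace M)} (hW : IsIrreducible W) :
    (vanishingIdeal W).IsPrime := by
  refine ⟨?_, fun {F G} hFG => ?_⟩
  · rw [Ideal.ne_top_iff_one, mem_vanishingIdeal]
    intro h
    obtain ⟨V, hV⟩ := hW.nonempty
    exact one_ne_zero ((map_one _).symm.trans (h V hV))
  · have hsub : W ⊆ {V | radial V.coords F = 0} ∪ {V | radial V.coords G = 0} := fun V hV => by
      have := mem_vanishingIdeal.1 hFG V hV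
      rw [map_mul] at this
      exact mul_eq_zero.1 this
    rcases isPreirreducible_iff_isClosed_union_isClosed.1 hW.isPreirreducible _ _
      (isClosed_setOf_radial F) (isClosed_setOf_radial G) hsub with h | h
    · exact Or.inl (mem_vanishingIdeal.2 h)
    · exact Or.inr (mem_vanishingIdeal.2 h)

theorem vanishingIdeal_lt_vanishingIdeal {M : ℕ} {W W' : Set (HypersurfaceSpace M)}
    (hW : IsClosed W) (h : W ⊂ W') : vanishingIdeal W' < vanishingIdeal W := by
  obtain ⟨T, hT, rfl⟩ := isClosed_iff.1 hW
  obtain ⟨V, hVW', hVW⟩ := Set.exists_of_ssubset h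
  refine lt_of_le_of_ne (fun F hF => mem_vanishingIdeal.2 fun V hV =>
    mem_vanishingIdeal.1 hF V (h.subset hV)) fun heq => hVW fun F hF => ?_
  obtain ⟨k, hk⟩ := hT F hF
  have hmem : F ∈ vanishingIdeal W' := by
    rw [heq, mem_vanishingIdeal]
    intro V hV
    rw [radial_of_isHomogeneous _ hk, hV F hF, map_zero, zero_mul]
  have := mem_vanishingIdeal.1 hmem V hVW'
  rw [radial_of_isHomogeneous _ hk] at this
  simpa using this

theorem vanishingIdeal_lt_ker_eval_zero {M : ℕ} {W : Set (HypersurfaceSpace M)}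
    (hW : W.Nonempty) : vanishingIdeal W <
      RingHom.ker (MvPolynomial.eval (0 : CoeffIndex M → ℂ)) := by
  obtain ⟨V, hV⟩ := hW
  refine lt_of_le_of_ne (fun F hF => ?_) fun heq => ?_
  · have h := congrArg (Polynomial.eval 0) (mem_vanishingIdeal.1 hF V hV)
    rwa [eval_radial, zero_smul, Polynomial.eval_zero] at h
  · obtain ⟨d, hd⟩ := Function.ne_iff.1 V.coords_ne_zero
    have hmem : (MvPolynomial.X d : MvPolynomial (CoeffIndex M) ℂ) ∈ vanishingIdeal W := by
      rw [heq, RingHom.mem_ker, MvPolynomial.eval_X, Pi.zero_apply]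
    have h := congrArg (Polynomial.eval 1) (mem_vanishingIdeal.1 hmem V hV)
    rw [eval_radial, MvPolynomial.eval_X, Polynomial.eval_zero, one_smul] at h
    exact hd h

theorem exists_algebraicIndepOn_of_ltSeries {M : ℕ}
    (p : LTSeries (TopologicalSpace.IrreducibleCloseds (HypersurfaceSpace M))) (k : ℕ)
    (hk : k < p.length + 1) : ∃ s : Set (CoeffIndex M), s.ncard = k + 1 ∧ AlgebraicIndepOn ℂ
      (fun i => Ideal.Quotient.mk (vanishingIdeal (p ⟨k, hk⟩ : Set (HypersurfaceSpace M)))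
        (MvPolynomial.X i)) s := by
  have hprime := fun i => isPrime_vanishingIdeal (p i).isIrreducible
  induction k with
  | zero =>
    -- The irrelevant ideal serves as an extra bottom term, whence k + 1 independent coordinates
    -- after k inclusions.
    have hlt := vanishingIdeal_lt_ker_eval_zero (p ⟨0, hk⟩).isIrreducible.nonempty
    have := hprime ⟨0, hk⟩
    have : Nontrivial (MvPolynomial (CoeffIndex M) ℂ ⧸
        RingHom.ker (MvPolynomial.eval (0 : CoeffIndex M → ℂ))) :=
      Ideal.Quotient.nontrivial_iff.2 (RingHom.ker_ne_top _)
    obtain ⟨i, -, hi⟩ := exists_insert_algebraicIndepOn (s := ∅) hlt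
      (algebraicIndependent_empty_type_iff.2 (algebraMap ℂ _).injective)
    exact ⟨_, by simp, hi⟩
  | succ k ih =>
    obtain ⟨s, hs, hind⟩ := ih (by omega)
    have hlt : p ⟨k, by omega⟩ < p ⟨k + 1, hk⟩ := p.strictMono (Fin.mk_lt_mk.2 (Nat.lt_succ_self k))
    have := hprime ⟨k + 1, hk⟩
    obtain ⟨i, his, hi⟩ := exists_insert_algebraicIndepOn
      (vanishingIdeal_lt_vanishingIdeal (p ⟨k, by omega⟩).isClosed (SetLike.coe_ssubset_coe.2 hlt))
      hind
    exact ⟨_, by rw [Set.ncard_insert_of_notMem his, hs], hi⟩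

/-- The top of a chain carries p.length + 1 algebraically independent coordinates, and a relation
valid on `B` passes to the closure. -/
theorem length_add_one_ne_of_relations {M n : ℕ} {B : Set (HypersurfaceSpace M)}
    (hB : ∀ sel : Fin n → CoeffIndex M, ∃ P : MvPolynomial (Fin n) ℂ, P ≠ 0 ∧ ∀ V ∈ B, ∀ t : ℂ,
      t ≠ 0 → MvPolynomial.eval (t • fun a => V.coords (sel a)) P = 0)
    (p : LTSeries (TopologicalSpace.IrreducibleCloseds (closure B))) : p.length + 1 ≠ n := by
  rintro rfl
  have hind := Topology.IsInducing.subtypeVal (t := closure B)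
  let q := p.map _ (TopologicalSpace.IrreducibleCloseds.map_strictMono_of_isInducing hind)
  obtain ⟨s, hs, hsind⟩ := exists_algebraicIndepOn_of_ltSeries q p.length (Nat.lt_succ_self _)
  have hqB : (q ⟨p.length, Nat.lt_succ_self _⟩ : Set (HypersurfaceSpace M)) ⊆ closure B := by
    refine closure_minimal ?_ isClosed_closure
    rintro _ ⟨V, -, rfl⟩
    exact V.2
  set W := (q ⟨p.length, Nat.lt_succ_self _⟩ : Set (HypersurfaceSpace M))
  let e : Fin (p.length + 1) ≃ s := (Finite.equivFinOfCardEq (by rw [Nat.card_coe_set_eq, hs])).symm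
  obtain ⟨P, hP, hPB⟩ := hB fun a => e a
  have hBr : B ⊆ {V | radial V.coords
      (MvPolynomial.rename (fun a => (e a : CoeffIndex M)) P) = 0} := by
    intro V hV
    refine Polynomial.eq_zero_of_infinite_isRoot _
      ((Set.finite_singleton (0 : ℂ)).infinite_compl.mono fun t ht => ?_)
    change Polynomial.eval t _ = 0
    rw [eval_radial, MvPolynomial.eval_rename]
    exact hPB V hV t ht
  have hmem : MvPolynomial.rename (fun a => (e a : CoeffIndex M)) P ∈ vanishingIdeal W :=
    mem_vanishingIdeal.2 (hqB.trans (closure_minimal hBr (isClosed_setOf_radial _)))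
  have hind' := hsind.comp e e.injective
  refine hP ((injective_iff_map_eq_zero _).1 hind' P ?_)
  have : MvPolynomial.aeval ((fun i : s => Ideal.Quotient.mk (vanishingIdeal W)
      (MvPolynomial.X (i : CoeffIndex M))) ∘ e) =
      (Ideal.Quotient.mkₐ ℂ (vanishingIdeal W)).comp
        (MvPolynomial.rename (fun a => (e a : CoeffIndex M))) :=
    MvPolynomial.algHom_ext fun j => by simp
  exact (congrArg (fun φ => φ P) this).trans (Ideal.Quotient.eq_zero_iff_mem.2 hmem)

/-- The linear subspace where the coordinates outside of `s` vanish. -/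
def coordinateSubspace {M : ℕ} (s : Set (CoeffIndex M)) : Set (HypersurfaceSpace M) :=
  {V | ∀ d ∉ s, V.coords d = 0}

theorem isClosed_coordinateSubspace {M : ℕ} (s : Set (CoeffIndex M)) :
    IsClosed (coordinateSubspace s) := by
  refine isClosed_iff.2 ⟨MvPolynomial.X '' sᶜ, ?_, ?_⟩
  · rintro _ ⟨d, -, rfl⟩
    exact ⟨1, MvPolynomial.isHomogeneous_X _ _⟩
  · ext V
    simp only [zeroLocus, coordinateSubspace, Set.mem_ofPred_eq, Set.forall_mem_image,
      Set.mem_compl_iff, MvPolynomial.eval_X]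

theorem exists_homogeneous_eval_ne_zero {M : ℕ} {U : Set (HypersurfaceSpace M)} (hU : IsOpen U)
    {V : HypersurfaceSpace M} (hV : V ∈ U) : ∃ (F : MvPolynomial (CoeffIndex M) ℂ) (k : ℕ),
      F.IsHomogeneous k ∧ MvPolynomial.eval V.coords F ≠ 0 ∧
      ∀ V' : HypersurfaceSpace M, MvPolynomial.eval V'.coords F ≠ 0 → V' ∈ U := by
  obtain ⟨T, hT, hUT⟩ := isClosed_iff.1 hU.isClosed_compl
  have hV' : V ∉ zeroLocus T := by rw [← hUT]; exact fun h => h hV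
  simp only [zeroLocus, Set.mem_ofPred_eq, not_forall] at hV'
  obtain ⟨F, hF, hFV⟩ := hV'
  obtain ⟨k, hk⟩ := hT F hF
  refine ⟨F, k, hk, hFV, fun V' h => ?_⟩
  by_contra hcon
  have : V' ∈ zeroLocus T := by rw [← hUT]; exact hcon
  exact h (this F hF)

theorem isIrreducible_coordinateSubspace {M : ℕ} {s : Set (CoeffIndex M)} (hs : s.Nonempty) :
    IsIrreducible (coordinateSubspace s) := by
  classical
  constructor
  · obtain ⟨d, hd⟩ := hs
    obtain ⟨V, t, -, hV⟩ := exists_coords_eq (v := (Pi.single d 1 : CoeffIndex M → ℂ)) (by simp)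
    refine ⟨V, fun e he => ?_⟩
    rw [hV, Pi.smul_apply, Pi.single_eq_of_ne (by rintro rfl; exact he hd), smul_zero]
  · rintro U U' hU hU' ⟨V, hVs, hVU⟩ ⟨V', hVs', hVU'⟩
    obtain ⟨F, k, hF, hFV, hFU⟩ := exists_homogeneous_eval_ne_zero hU hVU
    obtain ⟨G, l, hG, hGV, hGU⟩ := exists_homogeneous_eval_ne_zero hU' hVU'
    obtain ⟨d, hd⟩ := Function.ne_iff.1 V.coords_ne_zero
    let ρ : MvPolynomial (CoeffIndex M) ℂ →ₐ[ℂ] MvPolynomial (CoeffIndex M) ℂ :=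
      MvPolynomial.aeval fun e => if e ∈ s then MvPolynomial.X e else 0
    have hρ : ∀ w H, MvPolynomial.eval w (ρ H) =
        MvPolynomial.eval (fun e => if e ∈ s then w e else 0) H := fun w H => by
      have : (MvPolynomial.aeval w).comp ρ =
          MvPolynomial.aeval (R := ℂ) (fun e => if e ∈ s then w e else 0) :=
        MvPolynomial.algHom_ext fun e => by
          simp only [ρ, AlgHom.comp_apply, MvPolynomial.aeval_X]
          split_ifs <;> simp
      exact congrArg (fun φ => φ H) this
    have hmask : ∀ W ∈ coordinateSubspace s,
        (fun e => if e ∈ s then coords W e else 0) = W.coords := fun W hW => by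
      ext e
      split_ifs with he
      · rfl
      · exact (hW e he).symm
    have hne : ∀ W ∈ coordinateSubspace s, ∀ H, MvPolynomial.eval (coords W) H ≠ 0 → ρ H ≠ 0 :=
      fun W hW H hH h0 => hH (by rw [← hmask W hW, ← hρ, h0, map_zero])
    -- The factor X_d keeps the vector obtained from `w` nonzero, so that it defines a hypersurface.
    obtain ⟨w, hw⟩ : ∃ w, MvPolynomial.eval w (ρ (F * G * MvPolynomial.X d)) ≠ 0 := by
      by_contra! h
      have h0 : ρ (F * G * MvPolynomial.X d) = 0 :=
        MvPolynomial.funext fun w => by rw [h w, map_zero]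
      rw [map_mul, map_mul] at h0
      exact mul_ne_zero (mul_ne_zero (hne V hVs F hFV) (hne V' hVs' G hGV))
        (hne V hVs _ (by rwa [MvPolynomial.eval_X])) h0
    rw [hρ, map_mul, map_mul, MvPolynomial.eval_X] at hw
    set u : CoeffIndex M → ℂ := fun e => if e ∈ s then w e else 0 with hu
    obtain ⟨W, t, ht, hW⟩ := exists_coords_eq (v := u) fun h =>
      right_ne_zero_of_mul hw (congrFun h d)
    refine ⟨W, fun e he => ?_, hFU W ?_, hGU W ?_⟩
    · rw [hW, Pi.smul_apply, hu]
      simp [he]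
    · rw [hW, hF.eval_smul]
      exact mul_ne_zero (pow_ne_zero _ ht) (left_ne_zero_of_mul (left_ne_zero_of_mul hw))
    · rw [hW, hG.eval_smul]
      exact mul_ne_zero (pow_ne_zero _ ht) (right_ne_zero_of_mul (left_ne_zero_of_mul hw))

theorem coordinateSubspace_ssubset {M : ℕ} {s s' : Set (CoeffIndex M)} (h : s ⊂ s') :
    coordinateSubspace s ⊂ coordinateSubspace s' := by
  classical
  obtain ⟨d, hd', hd⟩ := Set.exists_of_ssubset h
  have hsub : coordinateSubspace s ⊆ coordinateSubspace s' := fun V hV e he =>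
    hV e fun h' => he (h.subset h')
  refine (Set.ssubset_iff_of_subset hsub).2 ?_
  obtain ⟨V, t, ht, hV⟩ := exists_coords_eq (v := (Pi.single d 1 : CoeffIndex M → ℂ)) (by simp)
  refine ⟨V, fun e he => ?_, fun hcon => ht ?_⟩
  · rw [hV, Pi.smul_apply, Pi.single_eq_of_ne (by rintro rfl; exact he hd'), smul_zero]
  · have := hcon d hd
    rwa [hV, Pi.smul_apply, Pi.single_eq_same, smul_eq_mul, mul_one] at this

theorem le_topologicalKrullDim {M n : ℕ} (hn : n < Nat.card (CoeffIndex M)) :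
    (n : WithBot ℕ∞) ≤ topologicalKrullDim (HypersurfaceSpace M) := by
  let e := (Finite.equivFin (CoeffIndex M)).symm
  let s : Fin (n + 1) → Set (CoeffIndex M) := fun k => {d | (e.symm d : ℕ) ≤ k}
  have hs : ∀ k, (s k).Nonempty := fun k => ⟨e ⟨0, by omega⟩, by simp [s]⟩
  have hss : StrictMono s := fun a b hab => by
    refine (Set.ssubset_iff_of_subset fun d hd => ?_).2 ⟨e ⟨b, by omega⟩, by simp [s], ?_⟩
    · exact (show (e.symm d : ℕ) ≤ a from hd).trans (by exact_mod_cast hab.le)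
    · simpa [s] using hab
  let f : Fin (n + 1) → TopologicalSpace.IrreducibleCloseds (HypersurfaceSpace M) := fun k =>
    ⟨coordinateSubspace (s k), isIrreducible_coordinateSubspace (hs k),
      isClosed_coordinateSubspace (s k)⟩
  exact Order.LTSeries.length_le_krullDim (LTSeries.mk n f
    fun a b hab => coordinateSubspace_ssubset (hss hab))

end HypersurfaceSpace

theorem card_localIndex_le (M : ℕ) : Nat.card (LocalIndex M) ≤ Nat.card (CoeffIndex M) := by
  refine Nat.card_le_card_of_injective
    (fun d => (⟨Finsupp.cons (M - d.1.degree) d.1, ?_⟩ : CoeffIndex M)) fun d e h => ?_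
  · rw [Finsupp.degree_eq_sum, Fin.sum_univ_succ]
    simp only [Finsupp.cons_zero, Finsupp.cons_succ]
    rw [← Finsupp.degree_eq_sum, Nat.sub_add_cancel d.2]
  · refine Subtype.ext ?_
    have := congrArg Finsupp.tail (congrArg Subtype.val h)
    rwa [Finsupp.tail_cons, Finsupp.tail_cons] at this

theorem theorem2 (M : ℕ) (hM : 5 ≤ M) :
    CodimAtLeast ((M - 3).choose 2 + 1) (regQsing M 5)ᶜ := by
  set c := (M - 3).choose 2 + 1
  have hlen : ∀ p : LTSeries (TopologicalSpace.IrreducibleCloseds (closure (regQsing M 5)ᶜ)),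
      p.length + c < Nat.card (CoeffIndex M) := fun p => by
    by_contra! hlt
    refine HypersurfaceSpace.length_add_one_ne_of_relations (n := p.length + 1)
      (fun sel => ?_) p rfl
    refine exists_relation_coords hM ?_ sel
    have := card_localIndex_le M
    omega
  -- When there are no irreducible closed subsets, the dimension is ⊥. Otherwise a chain of length
  -- zero ensures that c < N, so the truncated subtractions below are exact.
  rcases isEmpty_or_nonempty (TopologicalSpace.IrreducibleCloseds (closure (regQsing M 5)ᶜ))
    with h | h
  · rw [CodimAtLeast, topologicalKrullDim, Order.krullDim_eq_bot, WithBot.bot_add]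
    exact bot_le
  · have hc := hlen (RelSeries.singleton _ h.some)
    set N := Nat.card (CoeffIndex M)
    have h1 : topologicalKrullDim (closure (regQsing M 5)ᶜ) ≤ ((N - 1 - c : ℕ) : WithBot ℕ∞) :=
      iSup_le fun p => by
        have := hlen p
        exact_mod_cast (show p.length ≤ N - 1 - c by omega)
    calc topologicalKrullDim (closure (regQsing M 5)ᶜ) + (c : WithBot ℕ∞)
        ≤ ((N - 1 - c : ℕ) : WithBot ℕ∞) + (c : WithBot ℕ∞) := by gcongr
      _ = ((N - 1 : ℕ) : WithBot ℕ∞) := by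
        rw [← Nat.cast_add]
        congr 1
        omega
      _ ≤ topologicalKrullDim (HypersurfaceSpace M) :=
        HypersurfaceSpace.le_topologicalKrullDim (by omega)
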